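/- An instance of the parametric weight knapsack problem consists of a number $n\ge 1$ of items, profits $p_i\in\mathbb{N}_{>0}$, integers $a_i,b_i\in\mathbb{Z}$ ($i\in\{1,\dots,n\}$) and a capacity $W\in\mathbb{Z}$. At the parameter value $\lambda\in\mathbb{R}$ a set $x\subseteq\{1,\dots,n\}$ is feasible if $\sum_{i\in x}(a_i+\lambda b_i)\le W$; let $p^*(\lambda)$ be the maximum of the profits $p(x)=\sum_{i\in x}p_i$ of the feasible sets (and $0$ if there are none). Put $M=\max\{|W|,\,n\cdot\max_i\max\{|a_i|,|b_i|\}\}$, and let $\operatorname{lg}x=\max\{1,\ln x\}$ for $x>0$ and $\operatorname{lg}0=1$. Theorem. There is a single deterministic random access machine program with the following property. Its input is an instance, an integer $P\le\sum_{i=1}^n p_i$ with $p^*(\lambda)\le P$ for all $\lambda\in\mathbb{R}$, and a rational $\varepsilon=u/v\in(0,1)$ with integers $0<u<v$. It computes rational numbers $\lambda_1<\dots<\lambda_k$ and a partition of $\mathbb{R}$ into $k+1$ consecutive intervals with these endpoints (each $\lambda_j$ is assigned to exactly one of the two intervals that it separates), together with a set $x^{(j)}\subseteq\{1,\dots,n\}$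 for each interval, such that for every $\lambda$ in the $j$-th interval at which some feasible set exists, $x^{(j)}$ is feasible at $\lambda$ and $p(x^{(j)})\ge(1-\varepsilon)\,p^*(\lambda)$. Its running time is $$O\!\left(\frac{n^3}{\varepsilon^2}\cdot \operatorname{lg}^2 P\cdot\min\left\{\operatorname{lg} M,\ \frac{n\operatorname{lg}(n/\varepsilon)}{\operatorname{lg}\bigl(n\operatorname{lg}(n/\varepsilon)\bigr)}\right\}\right),$$ with an absolute constant. Here every arithmetic operation ($+$, $-$, $\cdot$, integer division), comparison, memory access and assignment on integers takes unit time, and all integers that occur during the computation (memory addresses included) are bounded in absolute value by $B^{c}$, where $B=2+n+|W|+\sum_i(|a_i|+|b_i|+p_i)+P+u+v$ and $c$ is an absolute constant, i.e. they have $O(\log B)$ bits. In particular, this is a fully polynomial-time approximation scheme for the problem. -/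

import Mathlib

namespace ParamKnapsack

/-! ### The parametric weight knapsack problem -/

/-- An instance with `n` items: item `i` has profit `p i > 0` and weight `a i + r * b i` at the
parameter value `r`, and the knapsack has capacity `W`. -/
structure Problem (n : ℕ) where
  a : Fin n → ℤ
  b : Fin n → ℤ
  p : Fin n → ℕ
  p_pos : ∀ i, 0 < p i
  W : ℤ

namespace Problem

variable {n : ℕ} (I : Problem n)

/-- The weight of item `i` at the parameter value `r`. -/
def weight (r : ℝ) (i : Fin n) : ℝ := (I.a i : ℝ) + r * (I.b i : ℝ)

/-- The item set `x` (the items with `x_i = 1`) fits into the knapsack at the parameter `r`. -/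
def Feasible (r : ℝ) (x : Finset (Fin n)) : Prop := ∑ i ∈ x, I.weight r i ≤ (I.W : ℝ)

/-- The total profit of an item set. -/
def profit (x : Finset (Fin n)) : ℕ := ∑ i ∈ x, I.p i

open Classical in
/-- The optimal profit `p*(r)` (and `0` if no item set at all is feasible at `r`, which can
only happen for `W < 0`). -/
noncomputable def optProfit (r : ℝ) : ℕ :=
  (Finset.univ.filter (fun x : Finset (Fin n) => I.Feasible r x)).sup I.profit

/-- `x` is a `(1 - ε)`-approximate solution at the parameter value `r`. -/
def IsApproxAt (ε : ℝ) (r : ℝ) (x : Finset (Fin n)) : Prop :=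
  I.Feasible r x ∧ (1 - ε) * (I.optProfit r : ℝ) ≤ (I.profit x : ℝ)

/-- `M = max {|W|, n * max_i {|a_i|, |b_i|}}`. -/
def M : ℕ :=
  max I.W.natAbs (n * Finset.univ.sup (fun i => max (I.a i).natAbs (I.b i).natAbs))

end Problem

/-- A partition of the real line into `k + 1` intervals by `k` breakpoints, with one item set for
each interval. The breakpoint `bp i` separates the intervals number `i` and `i + 1`; it is an
element of the former if `left i = true` and of the latter otherwise. -/
structure Answer (n : ℕ) where
  k : ℕ
  bp : Fin k → ℚ
  left : Fin k → Bool
  sol : Fin (k + 1) → Finset (Fin n)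

namespace Answer

variable {n : ℕ} (S : Answer n)

/-- The interval number `j`: everything to the right of the breakpoints with index `< j` and to
the left of the breakpoints with index `≥ j`. -/
def piece (j : Fin (S.k + 1)) : Set ℝ :=
  {r | (∀ i : Fin S.k, i.val < j.val → (S.bp i : ℝ) < r ∨ ((S.bp i : ℝ) = r ∧ S.left i = false)) ∧
       (∀ i : Fin S.k, j.val ≤ i.val → r < (S.bp i : ℝ) ∨ (r = (S.bp i : ℝ) ∧ S.left i = true))}

/-- The answer solves the parametric problem up to the precision `ε`: the breakpoints are strictly
increasing (so that the pieces form a partition of the real line into nonempty intervals), and on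
each piece its item set is a `(1 - ε)`-approximate solution for all parameter values
(at which the problem has a feasible solution at all). -/
def IsApproxFor (I : Problem n) (ε : ℝ) : Prop :=
  StrictMono S.bp ∧
    ∀ j, ∀ r ∈ S.piece j, (∃ x, I.Feasible r x) → I.IsApproxAt ε r (S.sol j)

end Answer

/-! ### The machine model: a random access machine with bounded integer words

Programs are while-programs over integer registers and integer arrays. Every arithmetic
operation, memory access, comparison and assignment takes unit time. A computation only exists
as long as all the numbers that it produces are at most `B` in absolute value (`B` bounds
the machine word), no divisor is zero and no array index is negative. -/

/-- Memory contents: registers and arrays of integers. -/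
structure Store where
  reg : ℕ → ℤ
  arr : ℕ → ℕ → ℤ

/-- Integer expressions; `div` is division rounding down for positive divisors. -/
inductive Expr
  | const (z : ℤ)
  | reg (x : ℕ)
  | get (v : ℕ) (i : Expr)
  | add (e f : Expr)
  | sub (e f : Expr)
  | mul (e f : Expr)
  | div (e f : Expr)

namespace Expr

/-- The value of an expression. -/
def eval (s : Store) : Expr → ℤ
  | const z => z
  | reg x => s.reg x
  | get v i => s.arr v (i.eval s).toNat
  | add e f => e.eval s + f.eval s
  | sub e f => e.eval s - f.eval s
  | mul e f => e.eval s * f.eval s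
  | div e f => e.eval s / f.eval s

/-- The number of unit-time operations in the evaluation of an expression. -/
def cost : Expr → ℕ
  | const _ => 1
  | reg _ => 1
  | get _ i => i.cost + 1
  | add e f => e.cost + f.cost + 1
  | sub e f => e.cost + f.cost + 1
  | mul e f => e.cost + f.cost + 1
  | div e f => e.cost + f.cost + 1

/-- The expression can be evaluated with words bounded by `B`: no value occurring in the
evaluation exceeds `B` in absolute value, array indices are nonnegative, divisors are nonzero. -/
def Safe (B : ℕ) (s : Store) : Expr → Prop
  | const z => |z| ≤ (B : ℤ)
  | reg x => |s.reg x| ≤ (B : ℤ)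
  | get v i => i.Safe B s ∧ 0 ≤ i.eval s ∧ |(get v i).eval s| ≤ (B : ℤ)
  | add e f => e.Safe B s ∧ f.Safe B s ∧ |(add e f).eval s| ≤ (B : ℤ)
  | sub e f => e.Safe B s ∧ f.Safe B s ∧ |(sub e f).eval s| ≤ (B : ℤ)
  | mul e f => e.Safe B s ∧ f.Safe B s ∧ |(mul e f).eval s| ≤ (B : ℤ)
  | div e f => e.Safe B s ∧ f.Safe B s ∧ f.eval s ≠ 0 ∧ |(div e f).eval s| ≤ (B : ℤ)

end Expr

/-- Programs: `skip`, `reg x := e`, `arr v [i] := e`, composition,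
`if e ≤ f then P else Q`, and `while e ≤ f do P`. -/
inductive Prog
  | skip
  | assign (x : ℕ) (e : Expr)
  | put (v : ℕ) (i e : Expr)
  | seq (P Q : Prog)
  | iteLE (e f : Expr) (P Q : Prog)
  | whileLE (e f : Expr) (P : Prog)

namespace Store

/-- Overwrite a register. -/
def setReg (s : Store) (x : ℕ) (z : ℤ) : Store :=
  { s with reg := Function.update s.reg x z }

/-- Overwrite an array cell. -/
def setArr (s : Store) (v : ℕ) (i : ℕ) (z : ℤ) : Store :=
  { s with arr := Function.update s.arr v (Function.update (s.arr v) i z) }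

end Store

/-- `Exec B P s s' t`: with words bounded by `B`, the program `P` started in the store `s` halts in
the store `s'` after exactly `t` unit-time steps. -/
inductive Exec (B : ℕ) : Prog → Store → Store → ℕ → Prop
  | skip (s : Store) : Exec B Prog.skip s s 1
  | assign (s : Store) (x : ℕ) (e : Expr) : e.Safe B s →
      Exec B (Prog.assign x e) s (s.setReg x (e.eval s)) (e.cost + 1)
  | put (s : Store) (v : ℕ) (i e : Expr) : i.Safe B s → 0 ≤ i.eval s → e.Safe B s →
      Exec B (Prog.put v i e) s (s.setArr v (i.eval s).toNat (e.eval s)) (i.cost + e.cost + 1)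
  | seq (P Q : Prog) (s s' s'' : Store) (t t' : ℕ) : Exec B P s s' t → Exec B Q s' s'' t' →
      Exec B (Prog.seq P Q) s s'' (t + t')
  | ite_true (e f : Expr) (P Q : Prog) (s s' : Store) (t : ℕ) :
      e.Safe B s → f.Safe B s → e.eval s ≤ f.eval s → Exec B P s s' t →
      Exec B (Prog.iteLE e f P Q) s s' (e.cost + f.cost + 1 + t)
  | ite_false (e f : Expr) (P Q : Prog) (s s' : Store) (t : ℕ) :
      e.Safe B s → f.Safe B s → ¬ e.eval s ≤ f.eval s → Exec B Q s s' t →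
      Exec B (Prog.iteLE e f P Q) s s' (e.cost + f.cost + 1 + t)
  | while_false (e f : Expr) (P : Prog) (s : Store) :
      e.Safe B s → f.Safe B s → ¬ e.eval s ≤ f.eval s →
      Exec B (Prog.whileLE e f P) s s (e.cost + f.cost + 1)
  | while_true (e f : Expr) (P : Prog) (s s' s'' : Store) (t t' : ℕ) :
      e.Safe B s → f.Safe B s → e.eval s ≤ f.eval s → Exec B P s s' t →
      Exec B (Prog.whileLE e f P) s' s'' t' →
      Exec B (Prog.whileLE e f P) s s'' (e.cost + f.cost + 1 + t + t')

/-! ### Input and output conventions -/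

/-- Registers `0, …, 4` hold `n, W, P, u, v`, where `ε = u / v`; arrays `0, 1, 2` hold the `a_i`, the
`b_i` and the `p_i`; everything else is zero. -/
def inputStore {n : ℕ} (I : Problem n) (P u v : ℕ) : Store where
  reg x := match x with
    | 0 => (n : ℤ)
    | 1 => I.W
    | 2 => (P : ℤ)
    | 3 => (u : ℤ)
    | 4 => (v : ℤ)
    | _ => 0
  arr w j := if h : j < n then
      match w with
      | 0 => I.a ⟨j, h⟩
      | 1 => I.b ⟨j, h⟩
      | 2 => (I.p ⟨j, h⟩ : ℤ)
      | _ => 0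
    else 0

/-- The size of the numbers in the input (their sum); it is at least `2`. -/
def inputMagnitude {n : ℕ} (I : Problem n) (P u v : ℕ) : ℕ :=
  2 + n + I.W.natAbs + (∑ i, ((I.a i).natAbs + (I.b i).natAbs + I.p i)) + P + u + v

/-- The store `s` holds the answer `S`: register `5` is the number of breakpoints, arrays `3` and
`4` hold the numerators and the (positive) denominators of the breakpoints, array `5` tells
to which side each breakpoint belongs, and array `6` holds the `0`-`1`-vectors of the item sets,
one after the other. -/
def Holds {n : ℕ} (s : Store) (S : Answer n) : Prop :=
  s.reg 5 = (S.k : ℤ) ∧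
  (∀ i : Fin S.k, 0 < s.arr 4 i.val ∧ S.bp i = (s.arr 3 i.val : ℚ) / (s.arr 4 i.val : ℚ) ∧
    s.arr 5 i.val = if S.left i = true then 1 else 0) ∧
  (∀ (j : Fin (S.k + 1)) (i : Fin n),
    s.arr 6 (j.val * n + i.val) = if i ∈ S.sol j then 1 else 0)

/-! ### The running time -/

/-- The logarithm in running times, `max {1, log x}`. -/
noncomputable def lg (x : ℝ) : ℝ := max 1 (Real.log x)

/-- `n³ / ε² · log² P · min {log M, n log (n / ε) / log (n log (n / ε))}`. -/
noncomputable def timeBound (n : ℕ) (ε : ℝ) (P M : ℕ) : ℝ :=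
  (n : ℝ) ^ 3 / ε ^ 2 * lg (P : ℝ) ^ 2 *
    min (lg (M : ℝ)) ((n : ℝ) * lg ((n : ℝ) / ε) / lg ((n : ℝ) * lg ((n : ℝ) / ε)))

end ParamKnapsack

open ParamKnapsack

namespace ParamKnapsack

/-! ### Halving chains of subset sums -/

section Chain

variable {v : ℕ → ℤ} {N : ℕ} {K : Finset ℕ}

/-! Let everything outside an open gap of the parameter axis be solved already, and let the optimum
in the gap be at most `r`. Put `m = ⌈2/ε⌉` and `q = r - ⌊r/m⌋`, replace the profits by `⌊p_i n m /
q⌋`, and demand a scaled profit of at least `T = n (m - 1)`. Rounding loses less than one unit per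
item, so every set of profit at least `q` meets the demand (`reach_of_le_profit`). Conversely, a set
that meets it has profit at least `((m - 1) / m)² r ≥ (1 - ε) r` (`le_profit_of_reach`), so wherever
it is feasible in the gap it is good enough (`appr_of_reach`).

The least weight of a set that meets the demand is a minimum of lines, hence concave, and it exceeds
the capacity only on an interval. A set of positive slope is feasible everywhere to the left of the
point where it fills the knapsack. So one set serves the whole stretch from the left frontier of the
gap to that interval, and by reflection (`σ = -1`) one set serves the stretch on the right. A level
thus costs at most one breakpoint per side. Either a set turns up that serves the whole gap, or no
set between the new frontiers meets the demand and the optimum there is at most `q - 1`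
(`optProfit_le_of_tight`). Since `(q - 1) m ≤ r (m - 1)`, there are `O(m log P)` levels
(`next_level`, `lt_of_pow_le`).

The end of a stretch is found by Newton's method. One evaluation is a knapsack dynamic program with
`O(n T) = O(n² m)` entries. To bound the number of iterations independently of the size of the
numbers, each step is tried at twice its length. If this succeeds, the slope of the current line
halves (`slope_halves`); if it overshoots, the excess of the line at the final point halves
(`value_halves`). A halving sequence of positive integers has logarithmic length. If moreover its
members are subset sums of `d` fixed numbers, its length is below `2 d²`: distinct subfamilies have
distinct sums, but these sums are determined by coefficient vectors of which there are only
polynomially many (`chain_card_pow`, `lt_of_two_pow_le`). Hence `O(min (log M) n²)` iterations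
suffice (`NewtonRun.length_le`).

The product of the three counts lies within the claimed bound, since `n lg y / lg (n lg y) ≥ n / 2`
for `y = n / ε` (`newtonBound_le`). The program itself is verified with triples `Tri` that track
correctness, time and word length together; its memory cells stay below a fixed power of the input
magnitude. -/

theorem chain_pos (hmono : ∀ k < N, v (k + 1) ≤ v k) (hpos : 0 < v N) :
    ∀ k ≤ N, 0 < v k := by
  intro k hk
  induction hk using Nat.decreasingInduction with
  | self => exact hpos
  | of_succ k hk ih => exact ih.trans_le (hmono k hk)

/-- A nonincreasing sequence of positive integers has at most `log₂` many halving steps. -/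
theorem chain_two_pow_le (hmono : ∀ k < N, v (k + 1) ≤ v k) (hpos : 0 < v N)
    (hK : ∀ k ∈ K, k < N ∧ 2 * v (k + 1) ≤ v k) : 2 ^ K.card ≤ v 0 := by
  have key : ∀ j ≤ N, 2 ^ (K.filter (· < j)).card * v j ≤ v 0 := by
    intro j
    induction j with
    | zero => simp
    | succ j ih =>
      intro hj
      have ih := ih (by omega)
      have hv := hmono j (by omega)
      by_cases hjK : j ∈ K
      · have : K.filter (· < j + 1) = insert j (K.filter (· < j)) := by
          ext k
          simp only [Finset.mem_filter, Finset.mem_insert]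
          constructor
          · rintro ⟨h1, h2⟩
            rcases Nat.lt_succ_iff_lt_or_eq.mp h2 with h | h
            · exact Or.inr ⟨h1, h⟩
            · exact Or.inl h
          · rintro (rfl | ⟨h1, h2⟩)
            · exact ⟨hjK, by omega⟩
            · exact ⟨h1, by omega⟩
        rw [this, Finset.card_insert_of_notMem (by simp), pow_succ, mul_assoc]
        exact (mul_le_mul_of_nonneg_left (hK j hjK).2 (by positivity)).trans ih
      · have : K.filter (· < j + 1) = K.filter (· < j) := by
          ext k
          simp only [Finset.mem_filter]
          constructor
          · rintro ⟨h1, h2⟩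
            refine ⟨h1, lt_of_le_of_ne (by omega) ?_⟩
            rintro rfl
            exact hjK h1
          · rintro ⟨h1, h2⟩
            exact ⟨h1, by omega⟩
        rw [this]
        exact (mul_le_mul_of_nonneg_left hv (by positivity)).trans ih
  have h := key N le_rfl
  rw [Finset.filter_true_of_mem (fun k hk => (hK k hk).1)] at h
  have : (2 : ℤ) ^ K.card * 1 ≤ 2 ^ K.card * v N :=
    mul_le_mul_of_nonneg_left (by omega) (by positivity)
  linarith

/-- Selected members decay geometrically: in the downward induction `v j` is added to a rest that is
below `2 * v (j + 1) ≤ v j`. -/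
theorem chain_sum_lt (hmono : ∀ k < N, v (k + 1) ≤ v k) (hpos : 0 < v N)
    (hK : ∀ k ∈ K, k < N ∧ 2 * v (k + 1) ≤ v k) {j : ℕ} (hj : j ≤ N) :
    ∀ A ⊆ K, (∀ k ∈ A, j ≤ k) → ∑ k ∈ A, v k < 2 * v j := by
  induction hj using Nat.decreasingInduction with
  | self =>
    intro A hA hjA
    have : A = ∅ := by
      refine Finset.eq_empty_of_forall_notMem fun k hk => ?_
      have h1 := (hK k (hA hk)).1
      have h2 := hjA k hk
      omega
    simpa [this] using hpos
  | of_succ j hj ih =>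
    intro A hA hjA
    by_cases hm : j ∈ A
    · have h1 := ih (A.erase j) ((Finset.erase_subset _ _).trans hA) (by
        intro k hk
        have h1 := hjA k (Finset.mem_of_mem_erase hk)
        have h2 := Finset.ne_of_mem_erase hk
        omega)
      have h2 := (hK j (hA hm)).2
      rw [← Finset.add_sum_erase A v hm]
      linarith
    · have h1 := ih A hA (by
        intro k hk
        refine lt_of_le_of_ne (hjA k hk) ?_
        rintro rfl
        exact hm hk)
      have := hmono j hj
      linarith

/-- At the first index where two subfamilies differ, the member of the one outweighs all later
members of the other, by `chain_sum_lt`. The proof phrases this as a descent: every element of `A \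
B` is preceded by one of `B \ A`, and vice versa. -/
theorem chain_sum_injOn (hmono : ∀ k < N, v (k + 1) ≤ v k) (hpos : 0 < v N)
    (hK : ∀ k ∈ K, k < N ∧ 2 * v (k + 1) ≤ v k) {A B : Finset ℕ} (hA : A ⊆ K) (hB : B ⊆ K)
    (h : ∑ k ∈ A, v k = ∑ k ∈ B, v k) : A = B := by
  have aux : ∀ A B : Finset ℕ, A ⊆ K → B ⊆ K → ∑ k ∈ A, v k = ∑ k ∈ B, v k →
      ∀ k ∈ A \ B, ∃ l ∈ B \ A, l < k := by
    intro A B hA hB h k hk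
    by_contra! hcon
    have hkA := (Finset.mem_sdiff.mp hk)
    have hkK := hK k (hA hkA.1)
    have h1 := chain_sum_lt hmono hpos hK (j := k + 1) hkK.1 (B \ A)
      (Finset.sdiff_subset.trans hB) (by
        intro l hl
        refine lt_of_le_of_ne (hcon l hl) ?_
        rintro rfl
        exact (Finset.mem_sdiff.mp hl).2 hkA.1)
    have h2 : v k ≤ ∑ l ∈ A \ B, v l :=
      Finset.single_le_sum (f := v) (fun l hl => (chain_pos hmono hpos l
        (hK l (hA (Finset.mem_sdiff.mp hl).1)).1.le).le) hk
    have h3 := Finset.sum_sdiff_sub_sum_sdiff (s₁ := B) (s₂ := A) (f := v)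
    linarith [hkK.2]
  have hsub : ∀ k, ∀ A B : Finset ℕ, A ⊆ K → B ⊆ K → ∑ k ∈ A, v k = ∑ k ∈ B, v k →
      k ∉ A \ B := by
    intro k
    induction k using Nat.strong_induction_on with
    | _ k ih =>
      intro A B hA hB h hk
      obtain ⟨l, hl, hlk⟩ := aux A B hA hB h k hk
      exact ih l hlk B A hB hA h.symm hl
  ext k
  have h1 := hsub k A B hA hB h
  have h2 := hsub k B A hB hA h.symm
  simp only [Finset.mem_sdiff, not_and, not_not] at h1 h2
  exact ⟨h1, h2⟩

/-- A halving chain of subset sums of `d` numbers is short: its distinct subfamilies have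
distinct sums. -/
theorem chain_card_pow {ι : Type*} [Fintype ι] (c : ι → ℤ) (x : ℕ → ι → ℕ)
    (hx : ∀ k i, x k i ≤ 1) (hmono : ∀ k < N, v (k + 1) ≤ v k) (hpos : 0 < v N)
    (hK : ∀ k ∈ K, k < N ∧ 2 * v (k + 1) ≤ v k) (hv : ∀ k ∈ K, v k = ∑ i, c i * x k i) :
    2 ^ K.card ≤ (K.card + 1) ^ Fintype.card ι := by
  classical
  -- A subfamily is sent to the vector that counts, for each `i`, how many of its members use `c i`.
  -- The vector determines the sum of the subfamily, and its entries are at most `K.card`.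
  have h := Finset.card_le_card_of_injOn (s := K.powerset)
    (t := Fintype.piFinset fun _ : ι => Finset.range (K.card + 1))
    (fun A i => ∑ k ∈ A, x k i) ?_ ?_
  · simpa using h
  · intro A hA
    have hA := Finset.mem_powerset.mp hA
    simp only [Finset.mem_coe, Fintype.mem_piFinset, Finset.mem_range]
    intro i
    have : ∑ k ∈ A, x k i ≤ ∑ k ∈ A, 1 := Finset.sum_le_sum fun k _ => hx k i
    have h2 := Finset.card_le_card hA
    simp only [Finset.sum_const, smul_eq_mul, mul_one] at this
    omega
  · intro A hA B hB hAB
    have hA := Finset.mem_powerset.mp hA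
    have hB := Finset.mem_powerset.mp hB
    refine chain_sum_injOn hmono hpos hK hA hB ?_
    have key : ∀ A ⊆ K, ∑ k ∈ A, v k = ∑ i, c i * ((∑ k ∈ A, x k i : ℕ) : ℤ) := by
      intro A hA
      rw [Finset.sum_congr rfl (fun k hk => hv k (hA hk)), Finset.sum_comm]
      simp [Finset.mul_sum]
    rw [key A hA, key B hB]
    exact Finset.sum_congr rfl fun i _ => by rw [show ∑ k ∈ A, x k i = ∑ k ∈ B, x k i from
      congrFun hAB i]

end Chain

/-- With `y = m / d`, an `m ≥ 2 d²` would give `2 d ≤ y`, hence `m + 1 ≤ d (y + 1) ≤ y (y + 1) / 2 <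
2 ^ y`. The `d`-th power of this contradicts the hypothesis. -/
theorem lt_of_two_pow_le {m d : ℕ} (hd : 1 ≤ d) (h : 2 ^ m ≤ (m + 1) ^ d) : m < 2 * d ^ 2 := by
  by_contra! hm
  have hx : 2 * d ≤ m / d := by
    rw [Nat.le_div_iff_mul_le hd]
    nlinarith
  have htwo : ∀ y : ℕ, y * (y + 1) < 2 * 2 ^ y := by
    intro y
    induction y with
    | zero => simp
    | succ y ih =>
      have : y + 1 ≤ 2 ^ y := Nat.lt_two_pow_self
      rw [pow_succ]
      nlinarith
  have h1 : m + 1 < 2 ^ (m / d) := by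
    have h2 := htwo (m / d)
    have h3 : m < d * (m / d + 1) := Nat.lt_mul_div_succ m hd
    have h4 : 2 * (d * (m / d + 1)) ≤ m / d * (m / d + 1) := by nlinarith
    omega
  have h2 : (m + 1) ^ d < (2 ^ (m / d)) ^ d := Nat.pow_lt_pow_left h1 (by omega)
  rw [← pow_mul] at h2
  have h3 : 2 ^ (m / d * d) ≤ 2 ^ m := Nat.pow_le_pow_right (by norm_num) (Nat.div_mul_le_self m d)
  omega

/-! ### The number of iterations of the accelerated Newton method -/

/-- A run of the accelerated Newton method: in step `k` the point `cur k` is evaluated and the line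
`A k + t * G k` is found, `pr (k + 1)` is the root of this line, and the next evaluation takes
place there or, by looking ahead, at twice the distance from `pr k`. -/
structure NewtonRun {n : ℕ} (a b : Fin n → ℤ) (W : ℤ) (N : ℕ) (x : ℕ → Finset (Fin n))
    (cur pr : ℕ → ℚ) (A G : ℕ → ℤ) : Prop where
  hA : ∀ k ≤ N, A k = ∑ i ∈ x k, a i - W
  hG : ∀ k ≤ N, G k = ∑ i ∈ x k, b i
  pos : ∀ k ≤ N, 0 < G k
  feas : ∀ k ≤ N, A k + cur k * G k ≤ 0
  lexmin : ∀ k ≤ N, ∀ j ≤ N, A k + cur k * G k < A j + cur k * G j ∨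
    (A k + cur k * G k = A j + cur k * G j ∧ G k ≤ G j)
  start : pr 0 ≤ cur 0
  root : ∀ k < N, pr (k + 1) * G k = - A k
  lt : ∀ k < N, pr k < pr (k + 1)
  next : ∀ k < N, cur (k + 1) = 2 * pr (k + 1) - pr k ∨
    (cur (k + 1) = pr (k + 1) ∧ cur N ≤ 2 * pr (k + 1) - pr k)

namespace NewtonRun

variable {n : ℕ} {a b : Fin n → ℤ} {W : ℤ} {N : ℕ} {x : ℕ → Finset (Fin n)}
  {cur pr : ℕ → ℚ} {A G : ℕ → ℤ}

theorem cur_le_root (h : NewtonRun a b W N x cur pr A G) {k : ℕ} (hk : k < N) :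
    cur k ≤ pr (k + 1) := by
  have h1 := h.feas k hk.le
  have h2 := h.root k hk
  have h3 : (0 : ℚ) < G k := by exact_mod_cast h.pos k hk.le
  by_contra! hc
  nlinarith

theorem root_le_cur (h : NewtonRun a b W N x cur pr A G) {k : ℕ} (hk : k < N) :
    pr (k + 1) ≤ cur (k + 1) := by
  rcases h.next k hk with h1 | ⟨h1, -⟩
  · linarith [h.lt k hk]
  · exact h1.ge

theorem pr_le_cur (h : NewtonRun a b W N x cur pr A G) {k : ℕ} (hk : k ≤ N) : pr k ≤ cur k := by
  cases k with
  | zero => exact h.start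
  | succ k => exact h.root_le_cur hk

theorem cur_le_cur_last (h : NewtonRun a b W N x cur pr A G) {k : ℕ} (hk : k ≤ N) :
    cur k ≤ cur N := by
  induction hk using Nat.decreasingInduction with
  | self => exact le_rfl
  | of_succ k hk ih => exact (h.cur_le_root hk).trans ((h.root_le_cur hk).trans ih)

/-- Concavity of a minimum of lines: minimizers at later points are not steeper. If the evaluation
point is repeated, the tie-breaking by slope decides. -/
theorem slope_mono (h : NewtonRun a b W N x cur pr A G) {k : ℕ} (hk : k < N) :
    G (k + 1) ≤ G k := by
  have h0 : cur k ≤ cur (k + 1) := (h.cur_le_root hk).trans (h.root_le_cur hk)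
  rcases h0.eq_or_lt with he | hl
  · rcases h.lexmin (k + 1) hk k hk.le with h1 | ⟨-, h1⟩
    · rcases h.lexmin k hk.le (k + 1) hk with h2 | ⟨h2, -⟩
      · rw [he] at h2
        exact absurd h1 h2.asymm
      · rw [he] at h2
        exact absurd h2 h1.ne'
    · exact h1
  · have h1 : (A k : ℚ) + cur k * G k ≤ A (k + 1) + cur k * G (k + 1) := by
      rcases h.lexmin k hk.le (k + 1) hk with h1 | h1
      exacts [h1.le, h1.1.le]
    have h2 : (A (k + 1) : ℚ) + cur (k + 1) * G (k + 1) ≤ A k + cur (k + 1) * G k := by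
      rcases h.lexmin (k + 1) hk k hk.le with h1 | h1
      exacts [h1.le, h1.1.le]
    have h3 : (G (k + 1) : ℚ) ≤ G k := by
      by_contra! hc
      nlinarith
    exact_mod_cast h3

/-- Line `k + 1` is at least `-G k * (pr (k + 1) - cur k)` at `cur k`, by minimality of line `k`,
and still nonpositive at `cur (k + 1)`. As `pr k ≤ cur k`, the latter point is at least twice as far
from `cur k` as the root of line `k`, so the slope is at most half. -/
theorem slope_halves (h : NewtonRun a b W N x cur pr A G) {k : ℕ} (hk : k < N)
    (hs : cur (k + 1) = 2 * pr (k + 1) - pr k) : 2 * G (k + 1) ≤ G k := by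
  have h1 : (A k : ℚ) + cur k * G k ≤ A (k + 1) + cur k * G (k + 1) := by
    rcases h.lexmin k hk.le (k + 1) hk with h1 | h1
    exacts [h1.le, h1.1.le]
  have h2 := h.feas (k + 1) hk
  have h3 := h.root k hk
  have h4 : (0 : ℚ) < G (k + 1) := by exact_mod_cast h.pos (k + 1) hk
  have h5 := h.cur_le_root hk
  have h6 := h.pr_le_cur hk.le
  have h7 := h.lt k hk
  have h8 : 2 * (G (k + 1) : ℚ) ≤ G k := by
    rcases h5.eq_or_lt with he | hl
    · nlinarith
    · by_contra! hc
      nlinarith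
  exact_mod_cast h8

theorem value_eq (h : NewtonRun a b W N x cur pr A G) {k : ℕ} (hk : k < N) :
    A k + cur N * G k = G k * (cur N - pr (k + 1)) := by
  linarith [h.root k hk]

/-- In `value_eq` both the slope and the distance from the root to the final point do not grow. -/
theorem value_mono (h : NewtonRun a b W N x cur pr A G) {k : ℕ} (hk : k + 1 < N) :
    A (k + 1) + cur N * G (k + 1) ≤ A k + cur N * G k := by
  rw [h.value_eq hk, h.value_eq (by omega : k < N)]
  have h1 : (G (k + 1) : ℚ) ≤ G k := by exact_mod_cast h.slope_mono (by omega : k < N)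
  have h2 := h.lt (k + 1) hk
  have h3 := (h.root_le_cur hk).trans (h.cur_le_cur_last (by omega))
  have h4 : (0 : ℚ) < G (k + 1) := by exact_mod_cast h.pos (k + 1) (by omega)
  have h5 : (0 : ℚ) < G k := h4.trans_le h1
  exact mul_le_mul h1 (by linarith) (by linarith) h5.le

/-- In `value_eq` the slope does not grow, and the distance to the final point halves: the
hypothesis says that the final point is no farther from the new root than the new root is from the
previous one. -/
theorem value_halves (h : NewtonRun a b W N x cur pr A G) {k : ℕ} (hk : k + 1 < N)
    (hf : cur N ≤ 2 * pr (k + 2) - pr (k + 1)) :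
    2 * (A (k + 1) + cur N * G (k + 1)) ≤ A k + cur N * G k := by
  rw [h.value_eq hk, h.value_eq (by omega : k < N)]
  have h1 : (G (k + 1) : ℚ) ≤ G k := by exact_mod_cast h.slope_mono (by omega : k < N)
  have h2 := h.lt (k + 1) hk
  have h3 := (h.root_le_cur hk).trans (h.cur_le_cur_last (by omega))
  have h4 : (0 : ℚ) < G (k + 1) := by exact_mod_cast h.pos (k + 1) (by omega)
  have h5 : (0 : ℚ) < G k := h4.trans_le h1
  have h6 : (G (k + 1) : ℚ) * (2 * (cur N - pr (k + 1 + 1))) ≤ G k * (cur N - pr (k + 1)) :=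
    mul_le_mul h1 (by linarith) (by linarith) h5.le
  linarith

theorem value_pos (h : NewtonRun a b W N x cur pr A G) {k : ℕ} (hk : k + 1 < N) :
    0 < A k + cur N * G k := by
  rw [h.value_eq (by omega : k < N)]
  have h2 := h.lt (k + 1) hk
  have h3 := (h.root_le_cur hk).trans (h.cur_le_cur_last (by omega))
  have h5 : (0 : ℚ) < G k := by exact_mod_cast h.pos k (by omega)
  exact mul_pos h5 (by linarith)

end NewtonRun

/-- The incidence vector of an item set, extended by an entry `1`. -/
def incidence {n : ℕ} (y : Finset (Fin n)) : Option (Fin n) → ℕ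
  | none => 1
  | some i => if i ∈ y then 1 else 0

theorem incidence_le_one {n : ℕ} (y : Finset (Fin n)) (i : Option (Fin n)) :
    incidence y i ≤ 1 := by
  cases i with
  | none => exact le_rfl
  | some i => simp only [incidence]; split_ifs <;> simp

theorem sum_incidence {n : ℕ} (y : Finset (Fin n)) (c : Option (Fin n) → ℤ) :
    ∑ i, c i * incidence y i = c none + ∑ i ∈ y, c (some i) := by
  simp [Fintype.sum_option, incidence, Finset.sum_ite_mem]

namespace NewtonRun

variable {n : ℕ} {a b : Fin n → ℤ} {W : ℤ} {N : ℕ} {x : ℕ → Finset (Fin n)}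
  {cur pr : ℕ → ℚ} {A G : ℕ → ℤ}

/-- The length of a run of the accelerated Newton method is polynomial in the number of items and
logarithmic in the size of the numbers. -/
theorem length_le (h : NewtonRun a b W N x cur pr A G) {M : ℕ} (hAM : ∀ k ≤ N, |A k| ≤ 2 * M)
    (hGM : ∀ k ≤ N, |G k| ≤ M) {cn cd : ℤ} (hcd : 0 < cd) (hcdM : cd ≤ M ^ 2)
    (hcur : cur N = cn / cd) :
    N ≤ 4 * (n + 1) ^ 2 + 2 ∧ 2 ^ N ≤ 16 * M ^ 5 := by
  classical
  have hM : 1 ≤ M := by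
    have h1 := h.pos N le_rfl
    have h2 := (abs_le.mp (hGM N le_rfl)).2
    omega
  have hcard : Fintype.card (Option (Fin n)) = n + 1 := by simp
  rcases Nat.lt_or_ge N 2 with hN | hN
  · refine ⟨by omega, ?_⟩
    have : 1 ≤ M ^ 5 := Nat.one_le_pow _ _ hM
    interval_cases N <;> omega
  -- Positivity and monotonicity of the values at the final point stop short of the end of the run,
  -- so two steps are split off; they account for the `+ 2` and for a factor `4` in the conclusion.
  obtain ⟨N, rfl⟩ : ∃ N', N = N' + 2 := ⟨N - 2, by omega⟩
  set K₁ := (Finset.range (N + 2)).filter (fun k => 2 * G (k + 1) ≤ G k) with hK₁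
  have hm1 : ∀ k < N + 2, G (k + 1) ≤ G k := fun k hk => h.slope_mono hk
  have hp1 : 0 < G (N + 2) := h.pos _ le_rfl
  have hk1 : ∀ k ∈ K₁, k < N + 2 ∧ 2 * G (k + 1) ≤ G k := by
    intro k hk
    simpa [hK₁] using hk
  have e1 := chain_two_pow_le hm1 hp1 hk1
  have f1 := chain_card_pow (fun o : Option (Fin n) => o.elim 0 b) (fun k => incidence (x k))
    (fun k i => incidence_le_one _ _) hm1 hp1 hk1 (by
      intro k hk
      rw [sum_incidence, h.hG k (hk1 k hk).1.le]
      simp)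
  -- Clearing the denominator of the final point turns the values there into integers, namely subset
  -- sums of the `n + 1` numbers `-(cd * W)` and `cd * a i + cn * b i`.
  set V : ℕ → ℤ := fun k => cd * A k + cn * G k with hV
  have hcd' : (0 : ℚ) < cd := by exact_mod_cast hcd
  have hVq : ∀ k, (V k : ℚ) = cd * (A k + cur (N + 2) * G k) := by
    intro k
    rw [hV, hcur]
    push_cast
    field_simp
  set K₂ := (Finset.range N).filter (fun k => 2 * V (k + 1) ≤ V k) with hK₂
  have hm2 : ∀ k < N, V (k + 1) ≤ V k := by
    intro k hk
    have := h.value_mono (k := k) (by omega)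
    have h2 : (V (k + 1) : ℚ) ≤ V k := by
      rw [hVq, hVq]
      exact mul_le_mul_of_nonneg_left this hcd'.le
    exact_mod_cast h2
  have hp2 : 0 < V N := by
    have := h.value_pos (k := N) (by omega)
    have h2 : (0 : ℚ) < V N := by
      rw [hVq]
      exact mul_pos hcd' this
    exact_mod_cast h2
  have hk2 : ∀ k ∈ K₂, k < N ∧ 2 * V (k + 1) ≤ V k := by
    intro k hk
    simpa [hK₂] using hk
  have e2 := chain_two_pow_le hm2 hp2 hk2
  have f2 := chain_card_pow (fun o : Option (Fin n) => o.elim (-(cd * W))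
      (fun i => cd * a i + cn * b i)) (fun k => incidence (x k))
    (fun k i => incidence_le_one _ _) hm2 hp2 hk2 (by
      intro k hk
      have hk' := (hk2 k hk).1
      rw [sum_incidence, hV]
      simp only [h.hA k (by omega), h.hG k (by omega), Option.elim, Finset.sum_add_distrib,
        Finset.mul_sum]
      rw [mul_sub, Finset.mul_sum]
      ring)
  rw [hcard] at f1 f2
  have g1 := lt_of_two_pow_le (by omega) f1
  have g2 := lt_of_two_pow_le (by omega) f2
  -- A successful look-ahead halves the slope from `k + 1` to `k + 2`, a failed one halves the value
  -- from `k` to `k + 1`. This offset is the reason for the shift by `k - 1`.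
  have hcover : Finset.range N ⊆ K₂ ∪ K₁.image (fun k => k - 1) := by
    intro k hk
    have hk' := Finset.mem_range.mp hk
    rcases h.next (k + 1) (by omega) with h1 | ⟨-, h1⟩
    · refine Finset.mem_union_right _ (Finset.mem_image.mpr ⟨k + 1, ?_, by simp⟩)
      simp only [hK₁, Finset.mem_filter, Finset.mem_range]
      exact ⟨by omega, h.slope_halves (by omega) h1⟩
    · refine Finset.mem_union_left _ ?_
      simp only [hK₂, Finset.mem_filter, Finset.mem_range]
      refine ⟨hk', ?_⟩
      have h2 := h.value_halves (k := k) (by omega) h1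
      have h3 : (2 * V (k + 1) : ℚ) ≤ V k := by
        rw [hVq, hVq]
        nlinarith
      exact_mod_cast h3
  have hlen : N ≤ K₂.card + K₁.card := by
    have h1 := Finset.card_le_card hcover
    have h2 := Finset.card_union_le K₂ (K₁.image (fun k => k - 1))
    have h3 := Finset.card_image_le (s := K₁) (f := fun k => k - 1)
    simp only [Finset.card_range] at h1
    omega
  refine ⟨by omega, ?_⟩
  have b1 : G 0 ≤ M := (abs_le.mp (hGM 0 (by omega))).2
  have b2 : V 0 ≤ 4 * (M : ℤ) ^ 4 := by
    have hMz : (1 : ℤ) ≤ M := by exact_mod_cast hM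
    -- The final point is at most `2 * M`: there the last line is nonpositive, its slope is at least
    -- `1` and its constant term at least `-2 * M`.
    have c1 : cn ≤ cd * (2 * M) := by
      have h1 := h.feas (N + 2) le_rfl
      have h2 := (abs_le.mp (hAM (N + 2) le_rfl)).1
      have h3 : V (N + 2) ≤ 0 := by
        have : (V (N + 2) : ℚ) ≤ 0 := by
          rw [hVq]
          exact mul_nonpos_of_nonneg_of_nonpos hcd'.le h1
        exact_mod_cast this
      simp only [hV] at h3
      have h4 : cn * G (N + 2) ≤ cd * (2 * M) := by nlinarith
      by_contra! hc
      have : cd * (2 * M) ≥ 0 := by positivity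
      nlinarith
    have c2 := (abs_le.mp (hAM 0 (by omega))).2
    have c3 := h.pos 0 (by omega)
    have c4 : cn * G 0 ≤ cd * (2 * M) * M :=
      (mul_le_mul_of_nonneg_right c1 c3.le).trans (mul_le_mul_of_nonneg_left b1 (by positivity))
    have c5 : cd * A 0 ≤ cd * (2 * M) := mul_le_mul_of_nonneg_left c2 hcd.le
    have c6 : cd * (2 * M) ≤ (M : ℤ) ^ 2 * (2 * M ^ 2) := by
      refine mul_le_mul hcdM ?_ (by positivity) (by positivity)
      nlinarith
    have c7 : cd * (2 * M) * M ≤ (M : ℤ) ^ 2 * (2 * M ^ 2) := by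
      rw [mul_assoc]
      refine mul_le_mul hcdM ?_ (by positivity) (by positivity)
      nlinarith
    simp only [hV]
    nlinarith
  have h1 : (2 : ℤ) ^ (K₂.card + K₁.card) ≤ 4 * M ^ 4 * M := by
    rw [pow_add]
    exact mul_le_mul (e2.trans b2) (e1.trans b1) (by positivity) (by positivity)
  have h2 : (2 : ℤ) ^ N ≤ 2 ^ (K₂.card + K₁.card) := pow_le_pow_right₀ (by norm_num) hlen
  have h3 : (2 : ℤ) ^ (N + 2) ≤ 16 * M ^ 5 := by
    rw [pow_add]
    nlinarith
  exact_mod_cast h3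

end NewtonRun
end ParamKnapsack

namespace ParamKnapsack

/-! ### The dynamic program -/

/-- The least cost of a subset of the first `i` items with scaled profit at least `t`, where a
subset of smaller scaled profit is admitted with the penalty `inf`. -/
def dpVal (c : ℕ → ℤ) (w : ℕ → ℕ) (inf : ℤ) : ℕ → ℕ → ℤ
  | 0, t => if t = 0 then 0 else inf
  | i + 1, t => min (dpVal c w inf i t) (dpVal c w inf i (t - w i) + c i)

/-- Truncated subtraction in `t - w i` implements "at least `t`": an overshoot leaves the demand
`0`. Only this inequality is proved for all sets; that the value is attained is certified by the set
which `backtrack` produces. -/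
theorem dpVal_le {n : ℕ} (c : ℕ → ℤ) (w : ℕ → ℕ) (inf : ℤ) {i : ℕ} (hi : i ≤ n) :
    ∀ (t : ℕ) (y : Finset (Fin n)), (∀ j ∈ y, j.val < i) →
      dpVal c w inf i t ≤ ∑ j ∈ y, c j + if t ≤ ∑ j ∈ y, w j then 0 else inf := by
  induction i with
  | zero =>
    intro t y hy
    have : y = ∅ := Finset.eq_empty_of_forall_notMem fun j hj => by simpa using hy j hj
    simp [this, dpVal]
  | succ i ih =>
    intro t y hy
    have ih := ih (by omega)
    rw [dpVal]
    by_cases hm : (⟨i, hi⟩ : Fin n) ∈ y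
    · refine (min_le_right _ _).trans ?_
      have h1 := ih (t - w i) (y.erase ⟨i, hi⟩) (by
        intro j hj
        have h1 := hy j (Finset.mem_of_mem_erase hj)
        have h2 : j.val ≠ i := fun h => Finset.ne_of_mem_erase hj (Fin.ext h)
        omega)
      rw [← Finset.add_sum_erase y (fun j => c j) hm, ← Finset.add_sum_erase y (fun j => w j) hm]
      simp only [tsub_le_iff_left] at h1
      linarith
    · refine (min_le_left _ _).trans (ih t y ?_)
      intro j hj
      have h1 := hy j hj
      have h2 : j.val ≠ i := by
        rintro rfl
        exact hm hj
      omega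

/-- Keeps all table entries within a machine word. -/
theorem abs_dpVal_le (c : ℕ → ℤ) (w : ℕ → ℕ) {inf : ℤ} (h : 0 ≤ inf) (i t : ℕ) :
    |dpVal c w inf i t| ≤ inf + ∑ j ∈ Finset.range i, |c j| := by
  induction i generalizing t with
  | zero =>
    rw [dpVal]
    split_ifs <;> simp [abs_of_nonneg h, h]
  | succ i ih =>
    rw [dpVal, Finset.sum_range_succ]
    have h1 := ih t
    have h2 := ih (t - w i)
    have h3 := abs_add_le (dpVal c w inf i (t - w i)) (c i)
    have h4 := abs_nonneg (c i)
    refine (abs_min_le_max_abs_abs).trans (max_le ?_ ?_) <;> linarith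

/-- The item set `y` minimizes the line `t ↦ ∑ (a i + t * b i)` at the parameter value `cn / cd`, and
among the minimizers it has the least slope; the competitors are the sets of scaled profit
at least `T`. -/
structure LexMin {n : ℕ} (a b : Fin n → ℤ) (w : Fin n → ℕ) (T : ℕ) (cn cd : ℤ)
    (y : Finset (Fin n)) : Prop where
  reach : T ≤ ∑ i ∈ y, w i
  min : ∀ z : Finset (Fin n), T ≤ ∑ i ∈ z, w i →
    cd * ∑ i ∈ y, a i + cn * ∑ i ∈ y, b i < cd * ∑ i ∈ z, a i + cn * ∑ i ∈ z, b i ∨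
    (cd * ∑ i ∈ y, a i + cn * ∑ i ∈ y, b i = cd * ∑ i ∈ z, a i + cn * ∑ i ∈ z, b i ∧
      ∑ i ∈ y, b i ≤ ∑ i ∈ z, b i)

/-- The outcome of the dynamic program is lexicographically minimal, if the costs combine values and
slopes with a large weight `Z` and the penalty is large. -/
theorem lexMin_of_dpVal {n : ℕ} {a b : Fin n → ℤ} {w : Fin n → ℕ} {T : ℕ} {cn cd inf Z : ℤ}
    {c : ℕ → ℤ} {w' : ℕ → ℕ} (hc : ∀ i : Fin n, c i = Z * (cd * a i + cn * b i) + b i)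
    (hw : ∀ i : Fin n, w' i = w i) (hinf : 2 * ∑ i : Fin n, |c i| < inf)
    (hZ : 2 * ∑ i, |b i| < Z) {y : Finset (Fin n)}
    (hy : dpVal c w' inf n T = ∑ i ∈ y, c i + if T ≤ ∑ i ∈ y, w i then 0 else inf)
    (hz : ∃ z : Finset (Fin n), T ≤ ∑ i ∈ z, w i) : LexMin a b w T cn cd y := by
  have habs : ∀ (f : Fin n → ℤ) (z : Finset (Fin n)), |∑ i ∈ z, f i| ≤ ∑ i, |f i| := fun f z =>
    (Finset.abs_sum_le_sum_abs _ _).trans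
      (Finset.sum_le_sum_of_subset_of_nonneg (Finset.subset_univ _) fun i _ _ => abs_nonneg _)
  have hle : ∀ z : Finset (Fin n), T ≤ ∑ i ∈ z, w i →
      dpVal c w' inf n T ≤ ∑ i ∈ z, c i := by
    intro z hz
    have := dpVal_le c w' inf le_rfl T z fun j _ => j.2
    simpa [hw, hz] using this
  have hreach : T ≤ ∑ i ∈ y, w i := by
    by_contra hcon
    obtain ⟨z, hz⟩ := hz
    have h1 := hle z hz
    rw [hy, if_neg hcon] at h1
    have h2 := abs_le.mp (habs (fun i => c i) z)
    have h3 := abs_le.mp (habs (fun i => c i) y)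
    linarith
  refine ⟨hreach, fun z hz => ?_⟩
  have h1 := hle z hz
  rw [hy, if_pos hreach, add_zero] at h1
  have key : ∀ z : Finset (Fin n), ∑ i ∈ z, c i
      = Z * (cd * ∑ i ∈ z, a i + cn * ∑ i ∈ z, b i) + ∑ i ∈ z, b i := by
    intro z
    rw [Finset.sum_congr rfl fun i _ => hc i, Finset.sum_add_distrib, ← Finset.mul_sum,
      Finset.sum_add_distrib, ← Finset.mul_sum, ← Finset.mul_sum]
  rw [key, key] at h1
  have h2 := abs_le.mp (habs b z)
  have h3 := abs_le.mp (habs b y)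
  have h4 : 0 ≤ ∑ i, |b i| := Finset.sum_nonneg fun i _ => abs_nonneg _
  rcases lt_trichotomy (cd * ∑ i ∈ y, a i + cn * ∑ i ∈ y, b i)
    (cd * ∑ i ∈ z, a i + cn * ∑ i ∈ z, b i) with h | h | h
  · exact Or.inl h
  · refine Or.inr ⟨h, ?_⟩
    rw [h] at h1
    linarith
  · exfalso
    -- Values are integers, so a larger value costs at least `Z`, which no difference of slopes can
    -- make up for.
    have : Z * 1 ≤ Z * ((cd * ∑ i ∈ y, a i + cn * ∑ i ∈ y, b i)
      - (cd * ∑ i ∈ z, a i + cn * ∑ i ∈ z, b i)) :=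
      mul_le_mul_of_nonneg_left (by omega) (by linarith)
    rw [mul_sub] at this
    linarith

end ParamKnapsack

namespace ParamKnapsack

/-! ### Total correctness with running times -/

/-- All memory cells are at most `N` in absolute value. -/
def Store.Bdd (N : ℕ) (s : Store) : Prop :=
  (∀ x, |s.reg x| ≤ (N : ℤ)) ∧ ∀ v i, |s.arr v i| ≤ (N : ℤ)

namespace Store

@[simp] theorem reg_setReg (s : Store) (x y : ℕ) (z : ℤ) :
    (s.setReg x z).reg y = if y = x then z else s.reg y := by
  simp [setReg, Function.update_apply]

@[simp] theorem arr_setReg (s : Store) (x : ℕ) (z : ℤ) : (s.setReg x z).arr = s.arr := rfl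

@[simp] theorem reg_setArr (s : Store) (v i : ℕ) (z : ℤ) : (s.setArr v i z).reg = s.reg := rfl

@[simp] theorem arr_setArr (s : Store) (v i w j : ℕ) (z : ℤ) :
    (s.setArr v i z).arr w j = if w = v ∧ j = i then z else s.arr w j := by
  by_cases hw : w = v
  · subst hw
    simp [setArr, Function.update_apply]
  · simp [setArr, hw]

theorem Bdd.setReg {N : ℕ} {s : Store} (h : s.Bdd N) (x : ℕ) {z : ℤ} (hz : |z| ≤ N) :
    (s.setReg x z).Bdd N := by
  refine ⟨fun y => ?_, h.2⟩
  rw [reg_setReg]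
  split_ifs
  exacts [hz, h.1 y]

theorem Bdd.setArr {N : ℕ} {s : Store} (h : s.Bdd N) (v i : ℕ) {z : ℤ} (hz : |z| ≤ N) :
    (s.setArr v i z).Bdd N := by
  refine ⟨h.1, fun w j => ?_⟩
  rw [arr_setArr]
  split_ifs
  exacts [hz, h.2 w j]

/-- The stores agree on the registers below `k` and on the arrays below `l`. -/
def Same (k l : ℕ) (s s' : Store) : Prop :=
  (∀ x < k, s'.reg x = s.reg x) ∧ ∀ v < l, ∀ i, s'.arr v i = s.arr v i

theorem Same.refl (k l : ℕ) (s : Store) : Same k l s s := ⟨fun _ _ => rfl, fun _ _ _ => rfl⟩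

theorem Same.trans {k l : ℕ} {s s' s'' : Store} (h : Same k l s s') (h' : Same k l s' s'') :
    Same k l s s'' :=
  ⟨fun x hx => (h'.1 x hx).trans (h.1 x hx), fun v hv i => (h'.2 v hv i).trans (h.2 v hv i)⟩

theorem Same.mono {k l k' l' : ℕ} {s s' : Store} (h : Same k l s s') (hk : k' ≤ k) (hl : l' ≤ l) :
    Same k' l' s s' :=
  ⟨fun x hx => h.1 x (hx.trans_le hk), fun v hv => h.2 v (hv.trans_le hl)⟩

theorem Same.setReg {k l : ℕ} {s s' : Store} (h : Same k l s s') {x : ℕ} (hx : k ≤ x) (z : ℤ) :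
    Same k l s (s'.setReg x z) := by
  refine ⟨fun y hy => ?_, h.2⟩
  rw [reg_setReg, if_neg (by omega)]
  exact h.1 y hy

theorem Same.setArr {k l : ℕ} {s s' : Store} (h : Same k l s s') {v : ℕ} (hv : l ≤ v) (i : ℕ)
    (z : ℤ) : Same k l s (s'.setArr v i z) := by
  refine ⟨h.1, fun w hw j => ?_⟩
  rw [arr_setArr, if_neg (by omega)]
  exact h.2 w hw j

end Store

/-! ### Word lengths of expressions -/

namespace Expr

/-- If the memory is bounded by `N`, then the value of `e` is bounded by `N ^ e.deg`. -/
def deg : Expr → ℕ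
  | const _ => 1
  | reg _ => 1
  | get _ i => i.deg
  | add e f => max e.deg f.deg + 1
  | sub e f => max e.deg f.deg + 1
  | mul e f => e.deg + f.deg
  | div e f => max e.deg f.deg

/-- The constants are small, the array indices are nonnegative and the divisors are nonzero. -/
def Ok (s : Store) : Expr → Prop
  | const z => |z| ≤ 4
  | reg _ => True
  | get _ i => i.Ok s ∧ 0 ≤ i.eval s
  | add e f => e.Ok s ∧ f.Ok s
  | sub e f => e.Ok s ∧ f.Ok s
  | mul e f => e.Ok s ∧ f.Ok s
  | div e f => e.Ok s ∧ f.Ok s ∧ f.eval s ≠ 0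

theorem one_le_deg (e : Expr) : 1 ≤ e.deg := by
  induction e with
  | const z => exact le_rfl
  | reg x => exact le_rfl
  | get v i ih => exact ih
  | add e f _ _ => simp [deg]
  | sub e f _ _ => simp [deg]
  | mul e f h1 h2 => simp only [deg]; omega
  | div e f h1 h2 => simp only [deg]; omega

theorem abs_eval_le {N : ℕ} (hN : 4 ≤ N) {s : Store} (hs : s.Bdd N) {e : Expr} (he : e.Ok s) :
    |e.eval s| ≤ (N : ℤ) ^ e.deg := by
  have hN' : (4 : ℤ) ≤ N := by exact_mod_cast hN
  have hmono : ∀ {a b : ℕ}, a ≤ b → (N : ℤ) ^ a ≤ (N : ℤ) ^ b := fun h =>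
    pow_le_pow_right₀ (by linarith) h
  have hadd : ∀ a b : ℕ, (N : ℤ) ^ a + (N : ℤ) ^ b ≤ (N : ℤ) ^ (max a b + 1) := by
    intro a b
    have h1 := hmono (le_max_left a b)
    have h2 := hmono (le_max_right a b)
    have h3 : (0 : ℤ) ≤ (N : ℤ) ^ max a b := by positivity
    rw [pow_succ]
    nlinarith
  induction e with
  | const z => simpa [eval, deg] using le_trans he hN'
  | reg x => simpa [eval, deg] using hs.1 x
  | get v i ih =>
    refine (hs.2 v _).trans ?_
    simpa [deg] using hmono (one_le_deg i)
  | add e f h1 h2 => exact (abs_add_le _ _).trans ((add_le_add (h1 he.1) (h2 he.2)).trans (hadd _ _))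
  | sub e f h1 h2 => exact (abs_sub _ _).trans ((add_le_add (h1 he.1) (h2 he.2)).trans (hadd _ _))
  | mul e f h1 h2 =>
    simp only [eval, deg]
    rw [abs_mul, pow_add]
    exact mul_le_mul (h1 he.1) (h2 he.2) (abs_nonneg _) (by positivity)
  | div e f h1 h2 =>
    simp only [eval, deg]
    have h3 : |e.eval s / f.eval s| ≤ |e.eval s| := Int.abs_ediv_le_abs _ _
    exact h3.trans ((h1 he.1).trans (hmono (le_max_left _ _)))

/-- Subexpressions have no larger degree, so all word-length conditions reduce to one degree check,
which is computable from the program text. -/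
theorem safe_of_ok {N : ℕ} (hN : 4 ≤ N) {s : Store} (hs : s.Bdd N) {e : Expr} (he : e.Ok s)
    {k : ℕ} (hk : e.deg ≤ k) : e.Safe (N ^ k) s := by
  have key : ∀ {f : Expr}, f.Ok s → f.deg ≤ k → |f.eval s| ≤ ((N ^ k : ℕ) : ℤ) := by
    intro f hf hk
    push_cast
    exact (abs_eval_le hN hs hf).trans (pow_le_pow_right₀ (by exact_mod_cast (by omega)) hk)
  have hv := key he hk
  induction e with
  | const z => exact hv
  | reg x => exact hv
  | get v i ih => exact ⟨ih he.1 hk (key he.1 hk), he.2, hv⟩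
  | add e f h1 h2 =>
    simp only [deg] at hk
    exact ⟨h1 he.1 (by omega) (key he.1 (by omega)), h2 he.2 (by omega) (key he.2 (by omega)), hv⟩
  | sub e f h1 h2 =>
    simp only [deg] at hk
    exact ⟨h1 he.1 (by omega) (key he.1 (by omega)), h2 he.2 (by omega) (key he.2 (by omega)), hv⟩
  | mul e f h1 h2 =>
    simp only [deg] at hk
    exact ⟨h1 he.1 (by omega) (key he.1 (by omega)), h2 he.2 (by omega) (key he.2 (by omega)), hv⟩
  | div e f h1 h2 =>
    simp only [deg] at hk
    exact ⟨h1 he.1 (by omega) (key he.1 (by omega)), h2 he.2.1 (by omega) (key he.2.1 (by omega)),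
      he.2.2, hv⟩

end Expr

infixr:60 " ;; " => Prog.seq

/-- Started in `s`, the program `P` halts within `T` steps in a store that is bounded by `N` and
satisfies `Q`; the numbers that occur in between are bounded by `N ^ 8`. -/
def Tri (N : ℕ) (P : Prog) (s : Store) (T : ℕ) (Q : Store → Prop) : Prop :=
  ∃ s' t, Exec (N ^ 8) P s s' t ∧ t ≤ T ∧ s'.Bdd N ∧ Q s'

namespace Tri

variable {N : ℕ} {s : Store} {P P' : Prog} {T T' : ℕ} {Q R : Store → Prop}

theorem mono (h : Tri N P s T Q) (hT : T ≤ T') (hQ : ∀ s', s'.Bdd N → Q s' → R s') :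
    Tri N P s T' R := by
  obtain ⟨s', t, h1, h2, h3, h4⟩ := h
  exact ⟨s', t, h1, h2.trans hT, h3, hQ s' h3 h4⟩

theorem mono_time (h : Tri N P s T Q) (hT : T ≤ T') : Tri N P s T' Q :=
  h.mono hT fun _ _ h => h

/-- The composition rules pass on budgets of the form `T - T₁` in `ℕ`. That a remaining budget is
positive shows that this subtraction was not truncated. -/
theorem pos_time (h : Tri N P s T Q) : 1 ≤ T := by
  obtain ⟨s', t, h1, h2, -⟩ := h
  have key : ∀ {B P s s' t}, Exec B P s s' t → 1 ≤ t := by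
    intro B P s s' t h
    induction h <;> omega
  exact (key h1).trans h2

theorem skip (hb : s.Bdd N) (hQ : Q s) (hT : 1 ≤ T) : Tri N Prog.skip s T Q :=
  ⟨s, 1, Exec.skip s, hT, hb, hQ⟩

theorem assign {x : ℕ} {e : Expr} (hN : 4 ≤ N) (hb : s.Bdd N) (hd : e.deg ≤ 8) (ok : e.Ok s)
    {z : ℤ} (hz : e.eval s = z) (hv : |z| ≤ N) (hT : e.cost + 1 ≤ T) (hQ : Q (s.setReg x z)) :
    Tri N (Prog.assign x e) s T Q := by
  subst hz
  exact ⟨_, _, Exec.assign s x e (Expr.safe_of_ok hN hb ok hd), hT, hb.setReg x hv, hQ⟩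

theorem put {v : ℕ} {i e : Expr} (hN : 4 ≤ N) (hb : s.Bdd N) (hdi : i.deg ≤ 8) (hd : e.deg ≤ 8)
    (oki : i.Ok s) (ok : e.Ok s) {j : ℕ} (hj : i.eval s = j) {z : ℤ} (hz : e.eval s = z)
    (hv : |z| ≤ N) (hT : i.cost + e.cost + 1 ≤ T) (hQ : Q (s.setArr v j z)) :
    Tri N (Prog.put v i e) s T Q := by
  subst hz
  have hj' : (i.eval s).toNat = j := by rw [hj]; simp
  have h := Exec.put (B := N ^ 8) s v i e (Expr.safe_of_ok hN hb oki hdi) (by rw [hj]; positivity)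
    (Expr.safe_of_ok hN hb ok hd)
  rw [hj'] at h
  exact ⟨_, _, h, hT, hb.setArr v j hv, hQ⟩

theorem seq (T₁ : ℕ) (h : Tri N P s T₁ Q)
    (h' : ∀ s', s'.Bdd N → Q s' → Tri N P' s' (T - T₁) R) : Tri N (P ;; P') s T R := by
  obtain ⟨s', t, h1, h2, h3, h4⟩ := h
  have hp := (h' s' h3 h4).pos_time
  obtain ⟨s'', t', h5, h6, h7⟩ := h' s' h3 h4
  exact ⟨s'', t + t', Exec.seq _ _ _ _ _ _ _ h1 h5, by omega, h7⟩

theorem assign_seq {x : ℕ} {e : Expr} (hN : 4 ≤ N) (hb : s.Bdd N) (hd : e.deg ≤ 8) (ok : e.Ok s)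
    {z : ℤ} (hz : e.eval s = z) (hv : |z| ≤ N)
    (h : (s.setReg x z).Bdd N → Tri N P (s.setReg x z) (T - (e.cost + 1)) Q) :
    Tri N (Prog.assign x e ;; P) s T Q :=
  seq _ (assign (Q := fun s' => s' = s.setReg x z) hN hb hd ok hz hv le_rfl rfl)
    fun s' hb' hs' => by
      subst hs'
      exact h hb'

theorem put_seq {v : ℕ} {i e : Expr} (hN : 4 ≤ N) (hb : s.Bdd N) (hdi : i.deg ≤ 8) (hd : e.deg ≤ 8)
    (oki : i.Ok s) (ok : e.Ok s) {j : ℕ} (hj : i.eval s = j) {z : ℤ} (hz : e.eval s = z)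
    (hv : |z| ≤ N)
    (h : (s.setArr v j z).Bdd N → Tri N P (s.setArr v j z) (T - (i.cost + e.cost + 1)) Q) :
    Tri N (Prog.put v i e ;; P) s T Q :=
  seq _ (put (Q := fun s' => s' = s.setArr v j z) hN hb hdi hd oki ok hj hz hv le_rfl rfl)
    fun s' hb' hs' => by
      subst hs'
      exact h hb'

theorem ite {e f : Expr} (hN : 4 ≤ N) (hb : s.Bdd N) (hde : e.deg ≤ 8) (hdf : f.deg ≤ 8)
    (oke : e.Ok s) (okf : f.Ok s)
    (ht : e.eval s ≤ f.eval s → Tri N P s (T - (e.cost + f.cost + 1)) Q)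
    (hf : ¬ e.eval s ≤ f.eval s → Tri N P' s (T - (e.cost + f.cost + 1)) Q) :
    Tri N (Prog.iteLE e f P P') s T Q := by
  have he := Expr.safe_of_ok hN hb oke hde
  have hf' := Expr.safe_of_ok hN hb okf hdf
  by_cases h : e.eval s ≤ f.eval s
  · have hp := (ht h).pos_time
    obtain ⟨s', t, h1, h2, h3⟩ := ht h
    exact ⟨s', _, Exec.ite_true _ _ _ _ _ _ _ he hf' h h1, by omega, h3⟩
  · have hp := (hf h).pos_time
    obtain ⟨s', t, h1, h2, h3⟩ := hf h
    exact ⟨s', _, Exec.ite_false _ _ _ _ _ _ _ he hf' h h1, by omega, h3⟩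

/-- A loop with the invariant `I k` before its `k`-th iteration and with at most `K` iterations, each
of which takes at most `T'` steps. -/
theorem loop {e f : Expr} (hN : 4 ≤ N) (hde : e.deg ≤ 8) (hdf : f.deg ≤ 8) (I : ℕ → Store → Prop)
    (K T' : ℕ) (hok : ∀ k s, s.Bdd N → I k s → e.Ok s ∧ f.Ok s)
    (hbody : ∀ k s, s.Bdd N → I k s → e.eval s ≤ f.eval s → k < K ∧ Tri N P s T' (I (k + 1)))
    (hend : ∀ k s, s.Bdd N → I k s → ¬ e.eval s ≤ f.eval s → Q s) (hb : s.Bdd N) (h0 : I 0 s)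
    (hT : K * (e.cost + f.cost + 1 + T') + (e.cost + f.cost + 1) ≤ T) :
    Tri N (Prog.whileLE e f P) s T Q := by
  -- `d` is the number of iterations that the bound `K` still allows.
  have key : ∀ d k s, k + d = K → s.Bdd N → I k s → Tri N (Prog.whileLE e f P) s
      (d * (e.cost + f.cost + 1 + T') + (e.cost + f.cost + 1)) Q := by
    intro d
    induction d with
    | zero =>
      intro k s hk hb hI
      obtain ⟨oe, of⟩ := hok k s hb hI
      have hn : ¬ e.eval s ≤ f.eval s := fun h => by
        have := (hbody k s hb hI h).1
        omega
      exact ⟨s, _, Exec.while_false _ _ _ _ (Expr.safe_of_ok hN hb oe hde)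
        (Expr.safe_of_ok hN hb of hdf) hn, by omega, hb, hend k s hb hI hn⟩
    | succ d ih =>
      intro k s hk hb hI
      obtain ⟨oe, of⟩ := hok k s hb hI
      by_cases h : e.eval s ≤ f.eval s
      · obtain ⟨s', t, h1, h2, h3, h4⟩ := (hbody k s hb hI h).2
        obtain ⟨s'', t', h5, h6, h7⟩ := ih (k + 1) s' (by omega) h3 h4
        refine ⟨s'', _, Exec.while_true _ _ _ _ _ _ _ _ (Expr.safe_of_ok hN hb oe hde)
          (Expr.safe_of_ok hN hb of hdf) h h1 h5, ?_, h7⟩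
        rw [add_mul, one_mul]
        omega
      · exact ⟨s, _, Exec.while_false _ _ _ _ (Expr.safe_of_ok hN hb oe hde)
          (Expr.safe_of_ok hN hb of hdf) h, by omega, hb, hend k s hb hI h⟩
  exact (key K 0 s (by omega) hb h0).mono_time hT

end Tri
end ParamKnapsack

namespace ParamKnapsack
open _root_.ParamKnapsack.Expr

/-! ### Evaluation at a parameter value -/

/-- `D[0] := 0`, and `D[t] := inf` for `0 < t ≤ T`. -/
def initTable : Prog :=
  Prog.put 20 (const 0) (const 0) ;; Prog.assign 35 (const 1) ;;
  Prog.whileLE (reg 35) (reg 8)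
    (Prog.put 20 (reg 35) (reg 34) ;; Prog.assign 35 (add (reg 35) (const 1)))

/-- The address of the bit that tells whether item `i` is used for the profit `t`. -/
def takeIndex : Expr := add (mul (reg 35) (add (reg 8) (const 1))) (reg 38)

/-- The treatment of the item `i` with cost `reg 36` and scaled profit `reg 37`. -/
def relaxRow : Prog :=
  Prog.assign 38 (reg 8) ;;
  Prog.whileLE (const 0) (reg 38)
    (Prog.iteLE (reg 37) (reg 38)
      (Prog.assign 39 (sub (reg 38) (reg 37))) (Prog.assign 39 (const 0)) ;;
    Prog.iteLE (get 20 (reg 38)) (add (get 20 (reg 39)) (reg 36))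
      (Prog.put 21 takeIndex (const 0))
      (Prog.put 20 (reg 38) (add (get 20 (reg 39)) (reg 36)) ;;
        Prog.put 21 takeIndex (const 1)) ;;
    Prog.assign 38 (sub (reg 38) (const 1)))

variable {N : ℕ}

theorem initTable_spec (hN : 4 ≤ N) {s : Store} (hb : s.Bdd N) {T : ℕ} (hT : s.reg 8 = T)
    (hTN : T + 1 ≤ N) :
    Tri N initTable s (10 * T + 10) fun s' => Store.Same 35 20 s s' ∧
      ∀ t ≤ T, s'.arr 20 t = if t = 0 then 0 else s.reg 34 := by
  have hTN' : (T : ℤ) + 1 ≤ N := by exact_mod_cast hTN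
  refine Tri.put_seq hN hb (by decide) (by decide) (by simp [Ok]) (by simp [Ok]) (j := 0) (z := 0)
    (by simp [eval]) (by simp [eval]) (by simp) fun hb => ?_
  refine Tri.assign_seq hN hb (by decide) (by simp [Ok]) (z := 1) (by simp [eval])
    (by simp; omega) fun hb => ?_
  refine Tri.loop hN (by decide) (by decide) (fun k s' => Store.Same 35 20 s s' ∧
    s'.reg 35 = k + 1 ∧ k ≤ T ∧ ∀ t ≤ k, s'.arr 20 t = if t = 0 then 0 else s.reg 34) T 7
    (fun _ _ _ _ => by simp [Ok]) ?_ ?_ hb ?_ (by simp only [cost]; omega)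
  · rintro k s' hb ⟨hs, hr, hk, ha⟩ hle
    have e8 : s'.reg 8 = T := by rw [hs.1 8 (by norm_num), hT]
    have hk' : k < T := by
      simp only [eval, hr, e8] at hle
      omega
    refine ⟨hk', ?_⟩
    refine Tri.put_seq hN hb (by decide) (by decide) (by simp [Ok])
      (by simp [Ok]) (j := k + 1) (z := s.reg 34) (by simp [eval, hr])
      (by simp [eval, hs.1 34]) (by rw [← hs.1 34 (by norm_num)]; exact hb.1 34) fun hb => ?_
    refine Tri.assign hN hb (by decide) (by simp [Ok]) (z := k + 2)
      (by simp [eval, hr]; ring) (by rw [abs_of_nonneg] <;> omega) (by decide) ?_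
    refine ⟨(hs.setArr (by norm_num) _ _).setReg (by norm_num) _, by simp; ring, hk', ?_⟩
    intro t ht
    by_cases h : t = k + 1
    · simp [h]
    · simp [h, ha t (by omega)]
  · rintro k s' hb ⟨hs, hr, hk, ha⟩ hle
    have e8 : s'.reg 8 = T := by rw [hs.1 8 (by norm_num), hT]
    simp only [eval, hr, e8] at hle
    refine ⟨hs, fun t ht => ha t (by omega)⟩
  · refine ⟨((Store.Same.refl _ _ s).setArr (by norm_num) _ _).setReg (by norm_num) _, by simp,
      by simp, ?_⟩
    intro t ht
    simp [Nat.le_zero.mp ht]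

/-- The row is overwritten in place from `T` downwards. The entry at `t - w i ≤ t` that is read at
`t` therefore still belongs to row `i`, while the entries above `t` already belong to row `i + 1`.
-/
theorem relaxRow_spec (hN : 4 ≤ N) {s : Store} (hb : s.Bdd N) {T i : ℕ} {c : ℕ → ℤ} {w : ℕ → ℕ}
    {inf : ℤ} (hT : s.reg 8 = T) (hTN : T + 1 ≤ N) (hi : s.reg 35 = i) (hc : s.reg 36 = c i)
    (hw : s.reg 37 = w i) (hrow : ∀ t ≤ T, s.arr 20 t = dpVal c w inf i t)
    (hbd : ∀ t, |dpVal c w inf (i + 1) t| ≤ N) :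
    Tri N relaxRow s (50 * (T + 1) + 10) fun s' => Store.Same 38 20 s s' ∧
      (∀ t ≤ T, s'.arr 20 t = dpVal c w inf (i + 1) t) ∧
      (∀ t ≤ T, s'.arr 21 (i * (T + 1) + t)
        = if dpVal c w inf i t ≤ dpVal c w inf i (t - w i) + c i then 0 else 1) ∧
      ∀ l < i * (T + 1), s'.arr 21 l = s.arr 21 l := by
  have hTN' : (T : ℤ) + 1 ≤ N := by exact_mod_cast hTN
  refine Tri.assign_seq hN hb (by decide) (by simp [Ok]) (z := T) (by simp [eval, hT])
    (by rw [abs_of_nonneg] <;> omega) fun hb => ?_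
  refine Tri.loop hN (by decide) (by decide) (fun k s' => Store.Same 38 20 s s' ∧
    s'.reg 38 = T - k ∧ k ≤ T + 1 ∧
    (∀ t ≤ T, s'.arr 20 t = dpVal c w inf (if T < t + k then i + 1 else i) t) ∧
    (∀ t ≤ T, T < t + k → s'.arr 21 (i * (T + 1) + t)
      = if dpVal c w inf i t ≤ dpVal c w inf i (t - w i) + c i then 0 else 1) ∧
    ∀ l < i * (T + 1), s'.arr 21 l = s.arr 21 l) (T + 1) 45
    (fun _ _ _ _ => by simp [Ok]) ?_ ?_ hb ?_ (by simp only [cost]; omega)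
  · rintro k s' hb' ⟨hs, hr, hk, ha, hta, htb⟩ hle
    have hk' : k < T + 1 := by
      simp only [eval, hr] at hle
      omega
    obtain ⟨t, rfl⟩ : ∃ t, T = k + t := ⟨T - k, by omega⟩
    have hrt : s'.reg 38 = t := by rw [hr]; push_cast; ring
    have e8 : s'.reg 8 = (k + t : ℕ) := by rw [hs.1 8 (by norm_num), hT]
    have e35 : s'.reg 35 = i := by rw [hs.1 35 (by norm_num), hi]
    have e36 : s'.reg 36 = c i := by rw [hs.1 36 (by norm_num), hc]
    have e37 : s'.reg 37 = w i := by rw [hs.1 37 (by norm_num), hw]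
    have a1 : s'.arr 20 t = dpVal c w inf i t := by
      rw [ha t (by omega), if_neg (by omega)]
    have a2 : s'.arr 20 (t - w i) = dpVal c w inf i (t - w i) := by
      rw [ha _ (by omega), if_neg (by omega)]
    refine ⟨hk', ?_⟩
    refine Tri.seq (Q := fun s'' => s'' = s'.setReg 39 ((t - w i : ℕ) : ℤ)) 7
      (Tri.ite hN hb' (by decide) (by decide) (by simp [Ok]) (by simp [Ok])
        (fun h => ?_) (fun h => ?_)) ?_
    · simp only [eval, e37, hrt] at h
      exact Tri.assign hN hb' (by decide) (by simp [Ok]) (z := ((t - w i : ℕ) : ℤ))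
        (by simp only [eval, e37, hrt]; omega) (by rw [abs_of_nonneg] <;> omega) (by decide) rfl
    · simp only [eval, e37, hrt] at h
      exact Tri.assign hN hb' (by decide) (by simp [Ok]) (z := ((t - w i : ℕ) : ℤ))
        (by simp only [eval]; omega) (by rw [abs_of_nonneg] <;> omega) (by decide) rfl
    · rintro s'' hb rfl
      have e39 : (s'.setReg 39 ((t - w i : ℕ) : ℤ)).reg 39 = ((t - w i : ℕ) : ℤ) := by simp
      have hidx : takeIndex.eval (s'.setReg 39 ((t - w i : ℕ) : ℤ))
          = (i * (k + t + 1) + t : ℕ) := by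
        simp [takeIndex, eval, e8, e35, hrt]
      have hv : (add (get 20 (reg 39)) (reg 36)).eval (s'.setReg 39 ((t - w i : ℕ) : ℤ))
          = dpVal c w inf i (t - w i) + c i := by
        simp only [eval, e39, Int.toNat_natCast, Store.arr_setReg, a2]
        simp [e36]
      have hv' : (get 20 (reg 38)).eval (s'.setReg 39 ((t - w i : ℕ) : ℤ))
          = dpVal c w inf i t := by
        simp [eval, hrt, a1]
      have hdp : dpVal c w inf (i + 1) t
          = min (dpVal c w inf i t) (dpVal c w inf i (t - w i) + c i) := rfl
      refine Tri.seq (Q := fun s'' => Store.Same 38 20 s s'' ∧ s''.reg 38 = t ∧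
        (∀ l, s''.arr 20 l = if l = t then dpVal c w inf (i + 1) t else s'.arr 20 l) ∧
        ∀ l, s''.arr 21 l = if l = i * (k + t + 1) + t then
          (if dpVal c w inf i t ≤ dpVal c w inf i (t - w i) + c i then 0 else 1)
          else s'.arr 21 l) 30
        (Tri.ite hN hb (by decide) (by decide) (by simp [Ok, eval, hrt])
        (by simp [Ok, eval]) (fun h => ?_) (fun h => ?_)) ?_
      · rw [hv', hv] at h
        refine Tri.put hN hb (by decide) (by decide)
          (by simp [Ok, takeIndex]) (by simp [Ok])
          hidx (z := 0) (by simp [eval]) (by simp) (by decide) ?_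
        refine ⟨(hs.setReg (by norm_num) _).setArr (by norm_num) _ _, by simp [hrt], ?_, ?_⟩
        · intro l
          by_cases hl : l = t
          · simp [hl, hdp, h, a1]
          · simp [hl]
        · intro l
          simp [h]
      · rw [hv', hv] at h
        have hlt := (not_le.mp h).le
        refine Tri.put_seq hN hb (by decide) (by decide) (by simp [Ok])
          (by simp [Ok, eval]) (j := t) (by simp [eval, hrt]) hv
          (by have := hbd t; rwa [hdp, min_eq_right hlt] at this) fun hb => ?_
        refine Tri.put hN hb (by decide) (by decide) (by simp [Ok, takeIndex])
          (by simp [Ok]) (j := i * (k + t + 1) + t)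
          (by simp [takeIndex, eval, e8, e35, hrt]) (z := 1) (by simp [eval])
          (by simp; omega) (by decide) ?_
        refine ⟨((hs.setReg (by norm_num) _).setArr (by norm_num) _ _).setArr (by norm_num)
          _ _, by simp [hrt], ?_, ?_⟩
        · intro l
          by_cases hl : l = t
          · simp [hl, hdp, hlt]
          · simp [hl]
        · intro l
          simp [h]
      · rintro s'' hb ⟨hs', hr', ha', hta'⟩
        refine Tri.assign hN hb (by decide) (by simp [Ok]) (z := (t : ℤ) - 1)
          (by simp [eval, hr']) (by rw [abs_le]; constructor <;> omega) (by decide) ?_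
        refine ⟨hs'.setReg (by norm_num) _, by simp, hk', ?_, ?_, ?_⟩
        · intro l hl
          rw [Store.arr_setReg, ha' l]
          by_cases h : l = t
          · rw [if_pos h, if_pos (by omega), h]
          · rw [if_neg h, ha l hl]
            congr 1
            simp only [show (k + t < l + k) ↔ (k + t < l + (k + 1)) by omega]
        · intro l hl hl'
          rw [Store.arr_setReg, hta']
          by_cases h : l = t
          · rw [if_pos (by rw [h]), h]
          · rw [if_neg (by omega), hta l hl (by omega)]
        · intro l hl
          rw [Store.arr_setReg, hta', if_neg (by omega), htb l hl]
  · rintro k s' hb ⟨hs, hr, hk, ha, hta, htb⟩ hle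
    simp only [eval, hr] at hle
    refine ⟨hs, fun t ht => ?_, fun t ht => hta t ht (by omega), htb⟩
    rw [ha t ht, if_pos (by omega)]
  · refine ⟨(Store.Same.refl _ _ s).setReg (by norm_num) _, by simp, by omega, ?_, ?_, ?_⟩
    · intro t ht
      rw [if_neg (by omega)]
      exact hrow t ht
    · intro t ht h
      omega
    · intro l _
      rfl

end ParamKnapsack

/-! ### Filling the table and recovering an optimal set -/

namespace ParamKnapsack
open _root_.ParamKnapsack.Expr

variable {N : ℕ}

/-- The slope of item `reg 35` on the side `σ`. -/
def slopeExpr (σ : ℤ) : Expr := mul (const σ) (get 1 (reg 35))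

/-- All rows of the dynamic program, for the parameter value `reg 22 / reg 23`. -/
def fillTable (σ : ℤ) : Prog :=
  Prog.assign 35 (const 0) ;;
  Prog.whileLE (add (reg 35) (const 1)) (reg 0)
    (Prog.assign 36 (add (mul (reg 12) (add (mul (reg 23) (get 0 (reg 35)))
      (mul (reg 22) (slopeExpr σ)))) (slopeExpr σ)) ;;
    Prog.assign 37 (get 18 (reg 35)) ;;
    relaxRow ;;
    Prog.assign 35 (add (reg 35) (const 1)))

/-- The item set that attains the value of the dynamic program, with its total weight at `0`, its
slope, and the part of the demanded profit that it misses. -/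
def backtrack (σ : ℤ) : Prog :=
  Prog.assign 30 (const 0) ;; Prog.assign 31 (const 0) ;; Prog.assign 32 (reg 8) ;;
  Prog.assign 35 (sub (reg 0) (const 1)) ;;
  Prog.whileLE (const 0) (reg 35)
    (Prog.iteLE (const 1) (get 21 (add (mul (reg 35) (add (reg 8) (const 1))) (reg 32)))
      (Prog.put 22 (reg 35) (const 1) ;;
        Prog.assign 30 (add (reg 30) (get 0 (reg 35))) ;;
        Prog.assign 31 (add (reg 31) (slopeExpr σ)) ;;
        Prog.iteLE (get 18 (reg 35)) (reg 32)
          (Prog.assign 32 (sub (reg 32) (get 18 (reg 35)))) (Prog.assign 32 (const 0)))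
      (Prog.put 22 (reg 35) (const 0)) ;;
    Prog.assign 35 (sub (reg 35) (const 1)))

theorem fillTable_spec (hN : 4 ≤ N) {σ : ℤ} (hσ : |σ| ≤ 4) {s : Store} (hb : s.Bdd N) {n T : ℕ}
    {c : ℕ → ℤ} {w : ℕ → ℕ} {inf : ℤ} (hn : s.reg 0 = n) (hnN : n ≤ N) (hT : s.reg 8 = T)
    (hTN : T + 1 ≤ N)
    (hc : ∀ i < n, c i = s.reg 12 * (s.reg 23 * s.arr 0 i + s.reg 22 * (σ * s.arr 1 i))
      + σ * s.arr 1 i)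
    (hcN : ∀ i < n, |c i| ≤ N) (hw : ∀ i < n, s.arr 18 i = w i)
    (hrow : ∀ t ≤ T, s.arr 20 t = dpVal c w inf 0 t)
    (hbd : ∀ i ≤ n, ∀ t, |dpVal c w inf i t| ≤ N) :
    Tri N (fillTable σ) s (n * (50 * (T + 1) + 60) + 10) fun s' => Store.Same 35 20 s s' ∧
      ∀ i < n, ∀ t ≤ T, s'.arr 21 (i * (T + 1) + t)
        = if dpVal c w inf i t ≤ dpVal c w inf i (t - w i) + c i then 0 else 1 := by
  refine Tri.assign_seq hN hb (by decide) (by simp [Ok]) (z := 0) (by simp [eval])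
    (by simp) fun hb => ?_
  refine Tri.loop hN (by decide) (by decide) (fun k s' => Store.Same 35 20 s s' ∧
    s'.reg 35 = k ∧ k ≤ n ∧ (∀ t ≤ T, s'.arr 20 t = dpVal c w inf k t) ∧
    ∀ i < k, ∀ t ≤ T, s'.arr 21 (i * (T + 1) + t)
        = if dpVal c w inf i t ≤ dpVal c w inf i (t - w i) + c i then 0 else 1) n
    (50 * (T + 1) + 50) (fun _ _ _ _ => by simp [Ok]) ?_ ?_ hb ?_ ?_
  · rintro k s' hb ⟨hs, hr, hk, hD, hta⟩ hle
    have e0 : s'.reg 0 = n := by rw [hs.1 0 (by norm_num), hn]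
    have hk' : k < n := by
      simp only [eval, hr, e0] at hle
      omega
    refine ⟨hk', ?_⟩
    refine Tri.assign_seq hN hb (by simp [deg, slopeExpr])
      (by simp [Ok, eval, hr, slopeExpr, hσ]) (z := c k)
      (by simp [eval, hr, hc k hk', slopeExpr, hs.1, hs.2]) (hcN k hk') fun hb => ?_
    refine Tri.assign_seq hN hb (by decide) (by simp [Ok, eval, hr]) (z := w k)
      (by simp [eval, hr, hs.2, hw k hk']) ?_ fun hb => ?_
    · rw [← hw k hk', ← hs.2 18 (by norm_num)]
      exact hb.2 18 k
    have hs' := (hs.setReg (x := 36) (by norm_num) (c k)).setReg (x := 37) (by norm_num) (w k)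
    refine Tri.seq _ (relaxRow_spec hN hb (T := T) (i := k) (c := c) (w := w) (inf := inf)
      (by simp [hs.1, hT]) hTN (by simp [hr]) (by simp) (by simp) (by simpa using hD)
      (hbd (k + 1) hk')) ?_
    rintro s'' hb ⟨hs'', hD', hta', htb'⟩
    refine Tri.assign hN hb (by decide) (by simp [Ok]) (z := k + 1)
      (by simp [eval, hs''.1, hr]) (by rw [abs_of_nonneg] <;> omega)
      (by simp [cost, slopeExpr]) ?_
    refine ⟨(hs'.trans (hs''.mono (by norm_num) le_rfl)).setReg (by norm_num) _, by simp, hk', ?_,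
      ?_⟩
    · simpa using hD'
    · intro i hi t ht
      rw [Store.arr_setReg]
      rcases Nat.lt_succ_iff_lt_or_eq.mp hi with h | h
      · have : i * (T + 1) + t < k * (T + 1) := by
          have := Nat.mul_le_mul_right (T + 1) (Nat.succ_le_of_lt h)
          rw [Nat.succ_mul] at this
          omega
        rw [htb' _ this]
        simpa using hta i h t ht
      · subst h
        exact hta' t ht
  · rintro k s' hb ⟨hs, hr, hk, hD, hta⟩ hle
    have e0 : s'.reg 0 = n := by rw [hs.1 0 (by norm_num), hn]
    simp only [eval, hr, e0] at hle
    exact ⟨hs, fun i hi t ht => hta i (by omega) t ht⟩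
  · exact ⟨(Store.Same.refl _ _ s).setReg (by norm_num) _, by simp, by simp, by simpa using hrow,
      by simp⟩
  · simp only [cost]
    ring_nf
    omega

/-- Going from the last item to the first, the invariant splits the final table value into the cost
of the items chosen so far and the table value for the demand that is left. When no items remain,
that table value is `0` or the penalty, according to whether the demand has been met. -/
theorem backtrack_spec (hN : 4 ≤ N) {σ : ℤ} (hσ : |σ| ≤ 4) {s : Store} (hb : s.Bdd N) {n T : ℕ}
    {c : ℕ → ℤ} {w : ℕ → ℕ} {inf : ℤ} (hn : s.reg 0 = n) (hnN : n ≤ N) (hT : s.reg 8 = T)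
    (hTN : T + 1 ≤ N) (hw : ∀ i < n, s.arr 18 i = w i)
    (hA : ∀ Y : Finset (Fin n), |∑ i ∈ Y, s.arr 0 i| ≤ N)
    (hG : ∀ Y : Finset (Fin n), |∑ i ∈ Y, σ * s.arr 1 i| ≤ N)
    (htake : ∀ i < n, ∀ t ≤ T, s.arr 21 (i * (T + 1) + t)
        = if dpVal c w inf i t ≤ dpVal c w inf i (t - w i) + c i then 0 else 1) :
    Tri N (backtrack σ) s (n * 60 + 20) fun s' => Store.Same 30 20 s s' ∧
      ∃ Y : Finset (Fin n), (∀ j : Fin n, s'.arr 22 j = if j ∈ Y then 1 else 0) ∧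
        s'.reg 30 = ∑ i ∈ Y, s.arr 0 i ∧ s'.reg 31 = ∑ i ∈ Y, σ * s.arr 1 i ∧
        s'.reg 32 = (T - ∑ i ∈ Y, w i : ℕ) ∧
        dpVal c w inf n T = ∑ i ∈ Y, c i + if T ≤ ∑ i ∈ Y, w i then 0 else inf := by
  refine Tri.assign_seq hN hb (by decide) (by simp [Ok]) (z := 0) (by simp [eval])
    (by simp) fun hb => ?_
  refine Tri.assign_seq hN hb (by decide) (by simp [Ok]) (z := 0) (by simp [eval])
    (by simp) fun hb => ?_
  refine Tri.assign_seq hN hb (by decide) (by simp [Ok]) (z := T) (by simp [eval, hT])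
    (by rw [abs_of_nonneg] <;> omega) fun hb => ?_
  refine Tri.assign_seq hN hb (by decide) (by simp [Ok]) (z := n - 1) (by simp [eval, hn])
    (by rw [abs_le]; constructor <;> omega) fun hb => ?_
  refine Tri.loop hN (by decide) (by decide) (fun k s' => Store.Same 30 20 s s' ∧
    (∀ l, s'.arr 21 l = s.arr 21 l) ∧ s'.reg 35 = n - k - 1 ∧ k ≤ n ∧
    ∃ Y : Finset (Fin n), (∀ j ∈ Y, n ≤ j.val + k) ∧
      (∀ j : Fin n, n ≤ j.val + k → s'.arr 22 j = if j ∈ Y then 1 else 0) ∧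
        s'.reg 30 = ∑ i ∈ Y, s.arr 0 i ∧ s'.reg 31 = ∑ i ∈ Y, σ * s.arr 1 i ∧
        s'.reg 32 = (T - ∑ i ∈ Y, w i : ℕ) ∧
        dpVal c w inf n T = ∑ i ∈ Y, c i + dpVal c w inf (n - k) (T - ∑ i ∈ Y, w i)) n 52
    (fun _ _ _ _ => by simp [Ok]) ?_ ?_ hb ?_ (by simp [cost]; omega)
  · rintro k s' hb' ⟨hs, hta, hr, hk, Y, hY, hbits, h30, h31, h32, hdp⟩ hle
    have hk' : k < n := by
      simp only [eval, hr] at hle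
      omega
    refine ⟨hk', ?_⟩
    obtain ⟨i, hi⟩ : ∃ i, n = k + i + 1 := ⟨n - k - 1, by omega⟩
    have hin : i < n := by omega
    have hri : s'.reg 35 = i := by rw [hr, hi]; push_cast; ring
    rw [show n - k = i + 1 by omega] at hdp
    set t := T - ∑ i ∈ Y, w i with ht
    have e8 : s'.reg 8 = T := by rw [hs.1 8 (by norm_num), hT]
    have hiY : (⟨i, hin⟩ : Fin n) ∉ Y := fun h => by
      have := hY _ h
      simp only at this
      omega
    have hidx : (add (mul (reg 35) (add (reg 8) (const 1))) (reg 32)).eval s'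
        = (i * (T + 1) + t : ℕ) := by
      simp [eval, e8, hri, h32]
    have hget : (get 21 (add (mul (reg 35) (add (reg 8) (const 1))) (reg 32))).eval s'
        = if dpVal c w inf i t ≤ dpVal c w inf i (t - w i) + c i then 0 else 1 := by
      rw [eval, hidx, Int.toNat_natCast, hta, htake i hin t (by omega)]
    refine Tri.seq (Q := fun s'' => Store.Same 30 20 s s'' ∧
      (∀ l, s''.arr 21 l = s.arr 21 l) ∧ s''.reg 35 = i ∧
      ∃ Y : Finset (Fin n), (∀ j ∈ Y, n ≤ j.val + (k + 1)) ∧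
        (∀ j : Fin n, n ≤ j.val + (k + 1) → s''.arr 22 j = if j ∈ Y then 1 else 0) ∧
          s''.reg 30 = ∑ i ∈ Y, s.arr 0 i ∧ s''.reg 31 = ∑ i ∈ Y, σ * s.arr 1 i ∧
          s''.reg 32 = (T - ∑ i ∈ Y, w i : ℕ) ∧
          dpVal c w inf n T = ∑ i ∈ Y, c i + dpVal c w inf i (T - ∑ i ∈ Y, w i)) 46
      (Tri.ite hN hb' (by decide) (by decide) (by simp [Ok])
        (by simp [Ok]; rw [hidx]; positivity) (fun h => ?_) (fun h => ?_)) ?_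
    · rw [hget] at h
      have htk : ¬ dpVal c w inf i t ≤ dpVal c w inf i (t - w i) + c i := by
        intro hc
        simp [eval, hc] at h
      have sumIns : ∀ f : Fin n → ℤ, ∑ j ∈ insert ⟨i, hin⟩ Y, f j = ∑ j ∈ Y, f j + f ⟨i, hin⟩ :=
        fun f => by rw [Finset.sum_insert hiY, add_comm]
      have sumW : ∑ j ∈ insert ⟨i, hin⟩ Y, w j = ∑ j ∈ Y, w j + w i := by
        rw [Finset.sum_insert hiY, add_comm]
      refine Tri.put_seq hN hb' (by decide) (by decide) (by simp [Ok]) (by simp [Ok])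
        (j := i) (by simp [eval, hri]) (z := 1) (by simp [eval]) (by simp; omega) fun hb => ?_
      refine Tri.assign_seq hN hb (by decide) (by simp [Ok, eval, hri])
        (z := ∑ j ∈ insert ⟨i, hin⟩ Y, s.arr 0 j)
        (by rw [sumIns (fun j => s.arr 0 j)]; simp [eval, hri, h30, hs.2]) (hA _) fun hb => ?_
      refine Tri.assign_seq hN hb (by simp [deg, slopeExpr]) (by simp [Ok, eval, hri, hσ, slopeExpr])
        (z := ∑ j ∈ insert ⟨i, hin⟩ Y, σ * s.arr 1 j)
        (by rw [sumIns (fun j => σ * s.arr 1 j)]; simp [eval, hri, h31, hs.2, slopeExpr]) (hG _) fun hb => ?_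
      have hs₁ := ((hs.setArr (v := 22) (by norm_num) i 1).setReg (x := 30) (by norm_num)
        (∑ j ∈ insert ⟨i, hin⟩ Y, s.arr 0 j)).setReg (x := 31) (by norm_num)
        (∑ j ∈ insert ⟨i, hin⟩ Y, σ * s.arr 1 j)
      have hdp' : dpVal c w inf n T
          = ∑ j ∈ insert ⟨i, hin⟩ Y, c j + dpVal c w inf i (T - ∑ j ∈ insert ⟨i, hin⟩ Y, w j) := by
        rw [sumIns, sumW, hdp, dpVal, min_eq_right (not_le.mp htk).le, ← Nat.sub_sub, ← ht]
        ring
      generalize hX : ((s'.setArr 22 i 1).setReg 30 (∑ j ∈ insert ⟨i, hin⟩ Y, s.arr 0 j)).setReg 31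
        (∑ j ∈ insert ⟨i, hin⟩ Y, σ * s.arr 1 j) = s₁ at hb hs₁ ⊢
      have hX35 : s₁.reg 35 = i := by simp [← hX, hri]
      have hX32 : s₁.reg 32 = t := by simp [← hX, h32]
      have hX18 : s₁.arr 18 i = w i := by rw [hs₁.2 18 (by norm_num), hw i hin]
      refine Tri.mono (Q := fun s'' => s'' = s₁.setReg 32 (t - w i : ℕ))
        (Tri.ite hN hb (by decide) (by decide) (by simp [Ok, eval, hX35]) (by simp [Ok])
          (fun h => ?_) (fun h => ?_)) le_rfl ?_
      · simp only [eval, hX35, hX32, hX18, Int.toNat_natCast] at h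
        exact Tri.assign hN hb (by decide) (by simp [Ok, eval, hX35]) (z := (t - w i : ℕ))
          (by simp only [eval, hX35, hX32, hX18, Int.toNat_natCast]; omega)
          (by rw [abs_of_nonneg] <;> omega) (by simp [cost, slopeExpr]) rfl
      · simp only [eval, hX35, hX32, hX18, Int.toNat_natCast] at h
        exact Tri.assign hN hb (by decide) (by simp [Ok]) (z := (t - w i : ℕ))
          (by simp only [eval]; omega)
          (by rw [abs_of_nonneg] <;> omega) (by simp [cost, slopeExpr]) rfl
      rintro s'' hb rfl
      refine ⟨hs₁.setReg (by norm_num) _, by simpa [← hX] using hta, by simp [hX35],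
        insert ⟨i, hin⟩ Y, ?_, ?_, by simp [← hX], by simp [← hX], ?_, hdp'⟩
      · intro j hj
        rcases Finset.mem_insert.mp hj with rfl | hj
        · simp only; omega
        · have := hY j hj; omega
      · intro j hj
        by_cases hji : j.val = i
        · have : j = ⟨i, hin⟩ := Fin.ext hji
          simp [← hX, this]
        · have : j ≠ ⟨i, hin⟩ := fun h => hji (by rw [h])
          simp [← hX, hji, this, hbits j (by omega)]
      · rw [sumW, ← Nat.sub_sub, ← ht]
        simp
    · rw [hget] at h
      have htk : dpVal c w inf i t ≤ dpVal c w inf i (t - w i) + c i := by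
        by_contra hc
        simp [eval, hc] at h
      refine Tri.put hN hb' (by decide) (by decide) (by simp [Ok]) (by simp [Ok])
        (j := i) (by simp [eval, hri]) (z := 0) (by simp [eval]) (by simp) (by simp [cost]) ?_
      refine ⟨hs.setArr (by norm_num) _ _, by simpa using hta, by simp [hri], Y, ?_, ?_,
        by simpa using h30, by simpa using h31, by simpa using h32, ?_⟩
      · intro j hj
        have := hY j hj
        omega
      · intro j hj
        by_cases hji : j.val = i
        · have : j = ⟨i, hin⟩ := Fin.ext hji
          simp [this, hiY]
        · simp [hji, hbits j (by omega)]
      · rw [hdp, dpVal, min_eq_left htk]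
    · rintro s'' hb ⟨hs, hta, hr, Y, hY⟩
      refine Tri.assign hN hb (by decide) (by simp [Ok]) (z := (i : ℤ) - 1)
        (by simp [eval, hr]) (by rw [abs_le]; constructor <;> omega) (by simp [cost]) ?_
      refine ⟨hs.setReg (by norm_num) _, by simpa using hta, by simp [hi], hk', Y, ?_⟩
      rw [show n - (k + 1) = i by omega]
      simpa using hY
  · rintro k s' hb ⟨hs, hta, hr, hk, Y, hY, hbits, h30, h31, h32, hdp⟩ hle
    simp only [eval, hr] at hle
    obtain rfl : k = n := by omega
    refine ⟨hs, Y, fun j => hbits j (by omega), h30, h31, h32, ?_⟩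
    rw [hdp, Nat.sub_self, dpVal]
    simp only [Nat.sub_eq_zero_iff_le]
  · refine ⟨((((Store.Same.refl _ _ s).setReg (by norm_num) _).setReg (by norm_num) _).setReg
      (by norm_num) _).setReg (by norm_num) _, by simp, by simp, by simp, ∅, by simp, ?_, by simp,
      by simp, by simp, by simp⟩
    intro j hj
    have := j.2
    omega

end ParamKnapsack

/-! ### The verdict at a single parameter value -/

namespace ParamKnapsack
open _root_.ParamKnapsack.Expr

variable {N n : ℕ}

namespace Problem

variable (I : Problem n)

/-- The weight of an item set at the parameter value `0`. -/
def base (y : Finset (Fin n)) : ℤ := ∑ i ∈ y, I.a i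

/-- The slope of the weight of an item set; `σ = -1` reverses the parameter axis. -/
def slope (σ : ℤ) (y : Finset (Fin n)) : ℤ := ∑ i ∈ y, σ * I.b i

/-- The sum of the absolute values of the capacity and of all coefficients. -/
def size : ℕ := I.W.natAbs + ∑ i, ((I.a i).natAbs + (I.b i).natAbs)

theorem sum_abs_add_le : |I.W| + (∑ i, |I.a i| + ∑ i, |I.b i|) = I.size := by
  simp [size, Finset.sum_add_distrib]

theorem abs_base_add_le (y : Finset (Fin n)) : |I.W| + |I.base y| ≤ I.size := by
  have h1 : |I.base y| ≤ ∑ i, |I.a i| := (Finset.abs_sum_le_sum_abs _ _).trans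
    (Finset.sum_le_sum_of_subset_of_nonneg (Finset.subset_univ _) fun i _ _ => abs_nonneg _)
  have h2 : 0 ≤ ∑ i, |I.b i| := Finset.sum_nonneg fun i _ => abs_nonneg _
  have h3 := I.sum_abs_add_le
  linarith

theorem abs_slope_le {σ : ℤ} (hσ : |σ| = 1) (y : Finset (Fin n)) : |I.slope σ y| ≤ I.size := by
  have h1 : |I.slope σ y| ≤ ∑ i, |σ * I.b i| := (Finset.abs_sum_le_sum_abs _ _).trans
    (Finset.sum_le_sum_of_subset_of_nonneg (Finset.subset_univ _) fun i _ _ => abs_nonneg _)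
  simp only [abs_mul, hσ, one_mul] at h1
  have h2 : 0 ≤ ∑ i, |I.a i| := Finset.sum_nonneg fun i _ => abs_nonneg _
  have h3 := I.sum_abs_add_le
  have h4 := abs_nonneg I.W
  linarith

/-- What the evaluation at the parameter value `cn / cd` finds: `0` if no set of scaled profit at
least `T` is feasible there; otherwise a lexicographically minimal such set, and `1` or `2`
according to whether its slope is positive. -/
inductive Outcome (σ : ℤ) (w : Fin n → ℕ) (T : ℕ) (cn cd : ℤ) : Finset (Fin n) → ℤ → Prop
  | none (y : Finset (Fin n)) : (∀ z : Finset (Fin n), T ≤ ∑ i ∈ z, w i →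
      cd * I.W < cd * I.base z + cn * I.slope σ z) → Outcome σ w T cn cd y 0
  | good (y : Finset (Fin n)) : LexMin I.a (fun i => σ * I.b i) w T cn cd y →
      cd * I.base y + cn * I.slope σ y ≤ cd * I.W → 0 < I.slope σ y → Outcome σ w T cn cd y 1
  | flat (y : Finset (Fin n)) : LexMin I.a (fun i => σ * I.b i) w T cn cd y →
      cd * I.base y + cn * I.slope σ y ≤ cd * I.W → I.slope σ y ≤ 0 → Outcome σ w T cn cd y 2

/-- The memory cells that do not change while a profit level is processed. -/
structure Env (w : Fin n → ℕ) (T : ℕ) (s : Store) : Prop where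
  n_eq : s.reg 0 = n
  W_eq : s.reg 1 = I.W
  size_eq : s.reg 6 = I.size
  T_eq : s.reg 8 = T
  Z_eq : s.reg 12 = 2 * I.size + 3
  a_eq : ∀ i : Fin n, s.arr 0 i = I.a i
  b_eq : ∀ i : Fin n, s.arr 1 i = I.b i
  w_eq : ∀ i : Fin n, s.arr 18 i = w i

variable {I}

theorem Env.same {w : Fin n → ℕ} {T : ℕ} {s s' : Store} (h : I.Env w T s)
    (hs : Store.Same 13 19 s s') : I.Env w T s' where
  n_eq := by rw [hs.1 _ (by norm_num), h.n_eq]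
  W_eq := by rw [hs.1 _ (by norm_num), h.W_eq]
  size_eq := by rw [hs.1 _ (by norm_num), h.size_eq]
  T_eq := by rw [hs.1 _ (by norm_num), h.T_eq]
  Z_eq := by rw [hs.1 _ (by norm_num), h.Z_eq]
  a_eq i := by rw [hs.2 _ (by norm_num), h.a_eq]
  b_eq i := by rw [hs.2 _ (by norm_num), h.b_eq]
  w_eq i := by rw [hs.2 _ (by norm_num), h.w_eq]

end Problem

/-- The evaluation at the parameter value `reg 22 / reg 23`. -/
def evaluate (σ : ℤ) : Prog :=
  Prog.assign 34 (mul (const 4) (mul (reg 12) (mul (add (reg 23) (mul (reg 22) (reg 22)))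
    (add (reg 6) (const 1))))) ;;
  initTable ;; fillTable σ ;; backtrack σ ;; Prog.assign 33 (const 0) ;;
  Prog.iteLE (reg 32) (const 0)
    (Prog.iteLE (add (mul (reg 23) (reg 30)) (mul (reg 22) (reg 31))) (mul (reg 23) (reg 1))
      (Prog.iteLE (const 1) (reg 31) (Prog.assign 33 (const 1)) (Prog.assign 33 (const 2)))
      Prog.skip)
    Prog.skip

/-- The penalty in the dynamic program. -/
def penalty (S : ℕ) (cn cd : ℤ) : ℤ := 4 * ((2 * S + 3) * ((cd + cn * cn) * (S + 1)))

/-- `penalty` uses `cn * cn` in place of `|cn|`, so that one arithmetic expression computes it; for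
integers `|cn| ≤ cn * cn`. -/
theorem two_mul_sum_cost_lt (I : Problem n) {σ : ℤ} (hσ : |σ| = 1) {cn cd : ℤ} (hcd : 0 < cd) :
    2 * ∑ i, |(2 * (I.size : ℤ) + 3) * (cd * I.a i + cn * (σ * I.b i)) + σ * I.b i|
      < penalty I.size cn cd := by
  have h1 : ∀ i, |(2 * (I.size : ℤ) + 3) * (cd * I.a i + cn * (σ * I.b i)) + σ * I.b i|
      ≤ (2 * (I.size : ℤ) + 3) * (cd * |I.a i| + |cn| * |I.b i|) + |I.b i| := by
    intro i
    refine (abs_add_le _ _).trans ?_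
    rw [abs_mul, abs_mul σ, hσ, one_mul]
    refine add_le_add ?_ le_rfl
    rw [abs_of_nonneg (by positivity : (0 : ℤ) ≤ 2 * (I.size : ℤ) + 3)]
    refine mul_le_mul_of_nonneg_left ((abs_add_le _ _).trans ?_) (by positivity)
    rw [abs_mul, abs_mul, abs_mul, hσ, one_mul, abs_of_pos hcd]
  have h2 := Finset.sum_le_sum fun i (_ : i ∈ Finset.univ) => h1 i
  rw [Finset.sum_add_distrib, ← Finset.mul_sum, Finset.sum_add_distrib, ← Finset.mul_sum,
    ← Finset.mul_sum] at h2
  have h3 := I.sum_abs_add_le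
  have h4 := abs_nonneg I.W
  have h5 : 0 ≤ ∑ i, |I.a i| := Finset.sum_nonneg fun i _ => abs_nonneg _
  have h6 : 0 ≤ ∑ i, |I.b i| := Finset.sum_nonneg fun i _ => abs_nonneg _
  set α := ∑ i, |I.a i|
  set β := ∑ i, |I.b i|
  set S : ℤ := (I.size : ℤ)
  have h7 : |cn| ≤ cn * cn := by
    rcases eq_or_ne cn 0 with h | h
    · simp [h]
    · have := Int.one_le_abs h
      nlinarith [abs_mul_abs_self cn]
  have h8 : cd * α + |cn| * β ≤ (cd + cn * cn) * S := by
    have e1 : cd * α ≤ cd * S := mul_le_mul_of_nonneg_left (by linarith) hcd.le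
    have e2 : |cn| * β ≤ (cn * cn) * S := mul_le_mul h7 (by linarith) h6 (by nlinarith)
    linarith
  have h9 : (2 * S + 3) * (cd * α + |cn| * β) ≤ (2 * S + 3) * ((cd + cn * cn) * S) :=
    mul_le_mul_of_nonneg_left h8 (by linarith)
  have h10 : 1 ≤ cd + cn * cn := by nlinarith [mul_self_nonneg cn]
  have h11 : (2 * S + 3) * 1 ≤ (2 * S + 3) * (cd + cn * cn) :=
    mul_le_mul_of_nonneg_left h10 (by linarith)
  have h12 : 0 ≤ (2 * S + 3) * ((cd + cn * cn) * S) := by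
    have : 0 ≤ S := by linarith
    positivity
  rw [penalty]
  have : (4 : ℤ) * ((2 * S + 3) * ((cd + cn * cn) * (S + 1)))
    = 4 * ((2 * S + 3) * ((cd + cn * cn) * S)) + 4 * ((2 * S + 3) * (cd + cn * cn)) := by ring
  rw [this]
  linarith

/-- If any set meets the demand, the penalty forces the recovered set to meet it and to be
lexicographically minimal. So a recovered set that misses the demand shows that no set meets it, and
an infeasible one that no set meeting the demand is feasible at this point. -/
theorem evaluate_spec (hN : 4 ≤ N) {I : Problem n} {σ : ℤ} (hσ : |σ| = 1) {w : Fin n → ℕ} {T : ℕ}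
    {s : Store} (hb : s.Bdd N) (hE : I.Env w T s) {cn cd : ℤ} (hcn : s.reg 22 = cn)
    (hcd : s.reg 23 = cd) (hcd0 : 0 < cd) (hinf : 2 * penalty I.size cn cd ≤ N) (hnN : n ≤ N)
    (hTN : T + 1 ≤ N) :
    Tri N (evaluate σ) s (200 * ((n + 1) * (T + 1))) fun s' => Store.Same 30 20 s s' ∧
      ∃ y : Finset (Fin n), (∀ j : Fin n, s'.arr 22 j = if j ∈ y then 1 else 0) ∧
        s'.reg 30 = I.base y ∧ s'.reg 31 = I.slope σ y ∧ I.Outcome σ w T cn cd y (s'.reg 33) := by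
  have hσ4 : |σ| ≤ 4 := by rw [hσ]; norm_num
  set inf := penalty I.size cn cd with hinf'
  set c : ℕ → ℤ := fun i => if h : i < n then (2 * (I.size : ℤ) + 3) * (cd * I.a ⟨i, h⟩
    + cn * (σ * I.b ⟨i, h⟩)) + σ * I.b ⟨i, h⟩ else 0 with hc
  set w' : ℕ → ℕ := fun i => if h : i < n then w ⟨i, h⟩ else 0 with hw'
  have hcF : ∀ i : Fin n, c i = (2 * (I.size : ℤ) + 3) * (cd * I.a i + cn * (σ * I.b i))
    + σ * I.b i := fun i => by simp [hc]
  have hsum : 2 * ∑ i : Fin n, |c i| < inf := by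
    simp only [hcF]
    exact two_mul_sum_cost_lt I hσ hcd0
  have hsum0 : 0 ≤ ∑ i : Fin n, |c i| := Finset.sum_nonneg fun i _ => abs_nonneg _
  have hinf0 : 0 ≤ inf := by linarith
  have hbd : ∀ i ≤ n, ∀ t, |dpVal c w' inf i t| ≤ N := by
    intro i hi t
    refine (abs_dpVal_le c w' hinf0 i t).trans ?_
    have h1 : ∑ j ∈ Finset.range i, |c j| ≤ ∑ j ∈ Finset.range n, |c j| :=
      Finset.sum_le_sum_of_subset_of_nonneg (Finset.range_mono hi) fun _ _ _ => abs_nonneg _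
    rw [Finset.sum_range (n := n) fun j => |c j|] at h1
    linarith
  have hcN : ∀ i < n, |c i| ≤ N := by
    intro i hi
    have := Finset.single_le_sum (f := fun i : Fin n => |c i|) (fun _ _ => abs_nonneg _)
      (Finset.mem_univ ⟨i, hi⟩)
    simp only at this
    linarith
  have hsize : (I.size : ℤ) ≤ N := by
    have : (I.size : ℤ) ≤ inf := by
      have h10 : 1 ≤ cd + cn * cn := by nlinarith [mul_self_nonneg cn]
      have h2 : (0 : ℤ) ≤ I.size := by positivity
      have h3 : 1 * ((I.size : ℤ) + 1) ≤ (cd + cn * cn) * (I.size + 1) :=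
        mul_le_mul_of_nonneg_right h10 (by positivity)
      rw [hinf', penalty]
      nlinarith
    linarith
  refine Tri.mono_time (T := 10 * T + 10 + (n * (50 * (T + 1) + 60) + 10) + (n * 60 + 20) + 60)
    ?_ (by ring_nf; omega)
  refine Tri.assign_seq hN hb (by decide) (by simp [Ok]) (z := inf)
    (by simp [eval, hE.Z_eq, hcn, hcd, hE.size_eq, hinf', penalty])
    (by rw [abs_of_nonneg hinf0]; linarith) fun hb => ?_
  refine Tri.seq _ (initTable_spec hN hb (T := T) (by simp [hE.T_eq]) hTN) ?_
  rintro s₁ hb ⟨hs₁, hrow⟩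
  replace hs₁ := (((Store.Same.refl _ _ s).setReg (by norm_num : 34 ≤ 34) inf)).trans
    (hs₁.mono (by norm_num) le_rfl)
  have hE₁ := hE.same (hs₁.mono (by norm_num) (by norm_num))
  refine Tri.seq _ (fillTable_spec hN hσ4 hb (n := n) (T := T) (c := c) (w := w') (inf := inf)
    hE₁.n_eq hnN hE₁.T_eq hTN ?_ hcN ?_ ?_ hbd) ?_
  · intro i hi
    have h1 := hE₁.a_eq ⟨i, hi⟩
    have h2 := hE₁.b_eq ⟨i, hi⟩
    simp only at h1 h2
    rw [h1, h2, hE₁.Z_eq, hs₁.1 22 (by norm_num), hs₁.1 23 (by norm_num), hcn, hcd]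
    simp [hc, hi]
  · intro i hi
    have h1 := hE₁.w_eq ⟨i, hi⟩
    simpa [hw', hi] using h1
  · intro t ht
    rw [hrow t ht, dpVal]
    simp
  rintro s₂ hb ⟨hs₂, htake⟩
  replace hs₂ := hs₁.trans (hs₂.mono (by norm_num) le_rfl)
  have hE₂ := hE.same (hs₂.mono (by norm_num) (by norm_num))
  have hAY : ∀ Y : Finset (Fin n), ∑ i ∈ Y, s₂.arr 0 i = I.base Y := fun Y =>
    Finset.sum_congr rfl fun i _ => hE₂.a_eq i
  have hGY : ∀ Y : Finset (Fin n), ∑ i ∈ Y, σ * s₂.arr 1 i = I.slope σ Y := fun Y =>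
    Finset.sum_congr rfl fun i _ => by rw [hE₂.b_eq i]
  have hbase : ∀ Y : Finset (Fin n), |I.base Y| ≤ N := fun Y => by
    have h1 := I.abs_base_add_le Y
    have h2 := abs_nonneg I.W
    linarith
  have hslope : ∀ Y : Finset (Fin n), |I.slope σ Y| ≤ N := fun Y =>
    (I.abs_slope_le hσ Y).trans hsize
  refine Tri.seq _ (backtrack_spec hN hσ4 hb (n := n) (T := T) (c := c) (w := w') (inf := inf)
    hE₂.n_eq hnN hE₂.T_eq hTN ?_ (fun Y => ?_) (fun Y => ?_) htake) ?_
  · intro i hi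
    have h1 := hE₂.w_eq ⟨i, hi⟩
    simpa [hw', hi] using h1
  · rw [hAY]; exact hbase Y
  · rw [hGY]; exact hslope Y
  rintro s₃ hb ⟨hs₃, y, hy, h30, h31, h32, hdp⟩
  rw [hAY] at h30
  rw [hGY] at h31
  have hwF : ∀ z : Finset (Fin n), ∑ i ∈ z, w' i = ∑ i ∈ z, w i := fun z =>
    Finset.sum_congr rfl fun i _ => by simp [hw']
  rw [hwF] at h32 hdp
  replace hs₃ := (hs₂.mono (by norm_num) le_rfl).trans hs₃
  -- The weight `Z = 2 * I.size + 3` exceeds twice the sum of the absolute slopes of the items.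
  have hlex : (∃ z : Finset (Fin n), T ≤ ∑ i ∈ z, w i) →
      LexMin I.a (fun i => σ * I.b i) w T cn cd y := by
    refine lexMin_of_dpVal (c := c) (w' := w') (inf := inf) (Z := 2 * I.size + 3) hcF
      (fun i => by simp [hw']) hsum ?_ hdp
    have h1 := I.sum_abs_add_le
    have h4 := abs_nonneg I.W
    have h5 : 0 ≤ ∑ i, |I.a i| := Finset.sum_nonneg fun i _ => abs_nonneg _
    simp only [abs_mul, hσ, one_mul]
    linarith
  have h22 : s₃.reg 22 = cn := by rw [hs₃.1 22 (by norm_num), hcn]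
  have h23 : s₃.reg 23 = cd := by rw [hs₃.1 23 (by norm_num), hcd]
  have h1 : s₃.reg 1 = I.W := by rw [hs₃.1 1 (by norm_num), hE.W_eq]
  refine Tri.assign_seq hN hb (by decide) (by simp [Ok]) (z := 0) (by simp [eval]) (by simp)
    fun hb => ?_
  have hs₄ := hs₃.setReg (x := 33) (by norm_num) 0
  refine Tri.ite hN hb (by decide) (by decide) (by simp [Ok]) (by simp [Ok]) (fun h => ?_)
    (fun h => ?_)
  · simp only [eval] at h
    simp [h32, -Nat.cast_sum, Nat.sub_eq_zero_iff_le] at h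
    have hlex := hlex ⟨y, h⟩
    refine Tri.ite hN hb (by decide) (by decide) (by simp [Ok]) (by simp [Ok]) (fun h => ?_)
      (fun h => ?_)
    · simp only [eval] at h
      simp [h22, h23, h30, h31, h1] at h
      refine Tri.ite hN hb (by decide) (by decide) (by simp [Ok]) (by simp [Ok]) (fun h' => ?_)
        (fun h' => ?_)
      · simp only [eval] at h'
        simp [h31] at h'
        refine Tri.assign hN hb (by decide) (by simp [Ok]) (z := 1) (by simp [eval])
          (by simp; omega) (by simp only [cost]; omega) ?_
        exact ⟨hs₄.setReg (by norm_num) _, y, by simpa using hy, by simpa using h30,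
          by simpa using h31, by simpa using Problem.Outcome.good y hlex h (by omega)⟩
      · simp only [eval] at h'
        simp [h31] at h'
        refine Tri.assign hN hb (by decide) (by simp [Ok]) (z := 2) (by simp [eval])
          (by simp; omega) (by simp only [cost]; omega) ?_
        exact ⟨hs₄.setReg (by norm_num) _, y, by simpa using hy, by simpa using h30,
          by simpa using h31, by simpa using Problem.Outcome.flat y hlex h (by omega)⟩
    · simp only [eval] at h
      simp [h22, h23, h30, h31, h1] at h
      refine Tri.skip hb ⟨hs₄, y, by simpa using hy, by simpa using h30, by simpa using h31, ?_⟩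
        (by simp only [cost]; omega)
      have : I.Outcome σ w T cn cd y 0 := Problem.Outcome.none y fun z hz => by
        rcases hlex.min z hz with h2 | ⟨h2, -⟩
        · exact h.trans h2
        · exact h.trans_eq h2
      simpa using this
  · simp only [eval] at h
    simp [h32, -Nat.cast_sum, Nat.sub_eq_zero_iff_le] at h
    refine Tri.skip hb ⟨hs₄, y, by simpa using hy, by simpa using h30, by simpa using h31, ?_⟩
      (by simp only [cost]; omega)
    have : I.Outcome σ w T cn cd y 0 := Problem.Outcome.none y fun z hz =>
      absurd (hlex ⟨z, hz⟩).reach (by omega)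
    simpa using this

end ParamKnapsack

/-! ### Good sets and the number of Newton iterations -/

namespace ParamKnapsack

variable {n : ℕ}

namespace Problem

variable {I : Problem n} {σ : ℤ} {w : Fin n → ℕ} {T : ℕ}

theorem sum_abs_le_M (f : Fin n → ℤ)
    (hf : ∀ i, (f i).natAbs ≤ max (I.a i).natAbs (I.b i).natAbs) (y : Finset (Fin n)) :
    |∑ i ∈ y, f i| ≤ I.M := by
  have h1 : |∑ i ∈ y, f i| ≤ ∑ i, |f i| := (Finset.abs_sum_le_sum_abs _ _).trans
    (Finset.sum_le_sum_of_subset_of_nonneg (Finset.subset_univ _) fun i _ _ => abs_nonneg _)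
  have h2 : ∑ i, |f i| ≤ ∑ _i : Fin n,
      ((Finset.univ.sup fun i => max (I.a i).natAbs (I.b i).natAbs : ℕ) : ℤ) := by
    refine Finset.sum_le_sum fun i _ => ?_
    rw [Int.abs_eq_natAbs]
    exact_mod_cast (hf i).trans (Finset.le_sup (f := fun i => max (I.a i).natAbs (I.b i).natAbs)
      (Finset.mem_univ i))
  refine h1.trans (h2.trans ?_)
  rw [Finset.sum_const, Finset.card_univ, Fintype.card_fin, nsmul_eq_mul]
  exact_mod_cast le_max_right _ _

theorem abs_base_le_M (y : Finset (Fin n)) : |I.base y| ≤ I.M :=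
  sum_abs_le_M I.a (fun _ => le_max_left _ _) y

theorem abs_slope_le_M (hσ : |σ| = 1) (y : Finset (Fin n)) : |I.slope σ y| ≤ I.M := by
  refine sum_abs_le_M (fun i => σ * I.b i) (fun i => ?_) y
  have : σ.natAbs = 1 := by
    rw [Int.abs_eq_natAbs] at hσ
    exact_mod_cast hσ
  rw [Int.natAbs_mul, this, one_mul]
  exact le_max_right _ _

theorem abs_W_le_M : |I.W| ≤ I.M := by
  rw [Int.abs_eq_natAbs]
  exact_mod_cast le_max_left _ _

variable (I)

/-- The weight of an item set at the (rational) parameter value `t`. -/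
def value (σ : ℤ) (t : ℚ) (y : Finset (Fin n)) : ℚ := I.base y + t * I.slope σ y

/-- Among the sets of scaled profit at least `T`, the set `y` is lexicographically minimal at `t`; it is
feasible there and has positive slope. -/
structure Good (σ : ℤ) (w : Fin n → ℕ) (T : ℕ) (t : ℚ) (y : Finset (Fin n)) : Prop where
  reach : T ≤ ∑ i ∈ y, w i
  min : ∀ z : Finset (Fin n), T ≤ ∑ i ∈ z, w i → I.value σ t y < I.value σ t z ∨
    (I.value σ t y = I.value σ t z ∧ I.slope σ y ≤ I.slope σ z)
  feas : I.value σ t y ≤ I.W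
  pos : 0 < I.slope σ y

variable {I}

theorem value_div {cn cd : ℤ} (hcd : 0 < cd) (y : Finset (Fin n)) :
    I.value σ (cn / cd) y = ((cd * I.base y + cn * I.slope σ y : ℤ) : ℚ) / cd := by
  have : (0 : ℚ) < cd := by exact_mod_cast hcd
  rw [value]
  push_cast
  field_simp

theorem value_div_le_iff {cn cd : ℤ} (hcd : 0 < cd) (y : Finset (Fin n)) :
    I.value σ (cn / cd) y ≤ I.W ↔ cd * I.base y + cn * I.slope σ y ≤ cd * I.W := by
  have : (0 : ℚ) < cd := by exact_mod_cast hcd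
  rw [value_div hcd, div_le_iff₀ this, mul_comm (I.W : ℚ)]
  exact_mod_cast Iff.rfl

theorem Good.of_lexMin {cn cd : ℤ} (hcd : 0 < cd) {y : Finset (Fin n)}
    (h : LexMin I.a (fun i => σ * I.b i) w T cn cd y)
    (hf : cd * I.base y + cn * I.slope σ y ≤ cd * I.W) (hp : 0 < I.slope σ y) :
    I.Good σ w T (cn / cd) y := by
  have hq : (0 : ℚ) < cd := by exact_mod_cast hcd
  refine ⟨h.reach, fun z hz => ?_, (value_div_le_iff hcd y).2 hf, hp⟩
  rw [value_div hcd, value_div hcd, div_lt_div_iff_of_pos_right hq, div_left_inj' hq.ne']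
  exact_mod_cast h.min z hz

/-- All lexicographic minimizers at a point share their value and their slope, so a single verdict
speaks for all of them. -/
theorem Outcome.not_good {cn cd : ℤ} (hcd : 0 < cd) {y : Finset (Fin n)} {f : ℤ}
    (h : I.Outcome σ w T cn cd y f) (hf : f ≠ 1) (z : Finset (Fin n)) :
    ¬ I.Good σ w T (cn / cd) z := by
  intro hz
  have h1 := (value_div_le_iff hcd z).1 hz.feas
  cases h with
  | none h => exact absurd (h z hz.reach) (not_lt.mpr h1)
  | good _ _ _ => exact hf rfl
  | flat h h2 h3 =>
    have hp := hz.pos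
    have hq : (0 : ℚ) < cd := by exact_mod_cast hcd
    have h5 := hz.min y h.reach
    rw [value_div hcd, value_div hcd, div_lt_div_iff_of_pos_right hq, div_left_inj' hq.ne'] at h5
    rcases h.min z hz.reach with h4 | ⟨h4, -⟩
    · rcases h5 with h5 | ⟨h5, -⟩
      · exact absurd (by exact_mod_cast h5) h4.asymm
      · exact h4.ne' (by exact_mod_cast h5)
    · rcases h5 with h5 | ⟨-, h5⟩
      · exact h4.not_gt (by exact_mod_cast h5)
      · omega

/-- Existence of good sets is inherited to the left. If `t' < t`, the lexicographic minimizer `z` at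
`t'` weighs at most as much as `y` there, hence less than `y` at `t`, so it is feasible. Its slope
is positive, since otherwise `z` would undercut `y` at `t`. -/
theorem Good.le_of_not_good {t t' : ℚ} {y : Finset (Fin n)} (h : I.Good σ w T t y)
    (h' : ∀ z, ¬ I.Good σ w T t' z) : t ≤ t' := by
  classical
  by_contra! hlt
  obtain ⟨z, hz, hmin⟩ := Finset.exists_min_image
    (Finset.univ.filter fun z : Finset (Fin n) => T ≤ ∑ i ∈ z, w i)
    (fun z => toLex (I.value σ t' z, I.slope σ z)) ⟨y, by simpa using h.reach⟩
  simp only [Finset.mem_filter, Finset.mem_univ, true_and] at hz hmin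
  have hmin' : ∀ x : Finset (Fin n), T ≤ ∑ i ∈ x, w i → I.value σ t' z < I.value σ t' x ∨
      (I.value σ t' z = I.value σ t' x ∧ I.slope σ z ≤ I.slope σ x) := fun x hx =>
    Prod.Lex.le_iff.mp (hmin x hx)
  have hpos : (0 : ℚ) < I.slope σ y := by exact_mod_cast h.pos
  have h1 : I.value σ t' z ≤ I.value σ t' y := by
    rcases hmin' y h.reach with h1 | h1
    exacts [h1.le, h1.1.le]
  have h2 : I.value σ t' y < I.value σ t y := by
    simp only [value]
    nlinarith
  have h3 : I.value σ t y ≤ I.value σ t z := by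
    rcases h.min z hz with h1 | h1
    exacts [h1.le, h1.1.le]
  refine h' z ⟨hz, hmin', (h1.trans h2.le).trans h.feas, ?_⟩
  by_contra! hs
  have hs' : (I.slope σ z : ℚ) ≤ 0 := by exact_mod_cast hs
  have h4 : I.value σ t z ≤ I.value σ t' z := by
    simp only [value]
    nlinarith
  linarith

variable (I)

/-- The first `k` iterations of the Newton method on one side. -/
structure History (σ : ℤ) (w : Fin n → ℕ) (T k : ℕ) (x : ℕ → Finset (Fin n)) (cur pr : ℕ → ℚ) :
    Prop where
  good : ∀ j < k, I.Good σ w T (cur j) (x j)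
  root : ∀ j < k, pr (j + 1) * I.slope σ (x j) = I.W - I.base (x j)
  lt : ∀ j < k, pr j < pr (j + 1)
  next : ∀ j < k, cur j = 2 * pr j - pr (j - 1) ∨
    (cur j = pr j ∧ ∀ z, ¬ I.Good σ w T (2 * pr j - pr (j - 1)) z)

variable {I}

namespace History

variable {k : ℕ} {x : ℕ → Finset (Fin n)} {cur pr : ℕ → ℚ}

theorem start_le (h : I.History σ w T k x cur pr) {j : ℕ} (hj : j ≤ k) : pr 0 ≤ pr j := by
  induction j with
  | zero => exact le_rfl
  | succ j ih => exact (ih (by omega)).trans (h.lt j (by omega)).le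

theorem extend (h : I.History σ w T k x cur pr) {y : Finset (Fin n)} {c ρ : ℚ}
    (hg : I.Good σ w T c y) (hr : ρ * I.slope σ y = I.W - I.base y) (hlt : pr k < ρ)
    (hn : c = 2 * pr k - pr (k - 1) ∨ (c = pr k ∧ ∀ z, ¬ I.Good σ w T (2 * pr k - pr (k - 1)) z)) :
    I.History σ w T (k + 1) (Function.update x k y) (Function.update cur k c)
      (Function.update pr (k + 1) ρ) := by
  have hpr : ∀ j ≤ k, Function.update pr (k + 1) ρ j = pr j := fun j hj =>
    Function.update_of_ne (by omega) _ _
  refine ⟨?_, ?_, ?_, ?_⟩ <;> intro j hj <;>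
    rcases Nat.lt_succ_iff_lt_or_eq.mp hj with hj | rfl
  · rw [Function.update_of_ne hj.ne, Function.update_of_ne hj.ne]
    exact h.good j hj
  · simpa using hg
  · rw [Function.update_of_ne hj.ne, hpr _ hj]
    exact h.root j hj
  · simpa using hr
  · rw [hpr j hj.le, hpr _ hj]
    exact h.lt j hj
  · rw [hpr j le_rfl]
    simpa using hlt
  · rw [Function.update_of_ne hj.ne, hpr j hj.le, hpr (j - 1) (by omega)]
    exact h.next j hj
  · rw [hpr j le_rfl, hpr (j - 1) (by omega)]
    simpa using hn

theorem rational (h : I.History σ w T k x cur pr) (hσ : |σ| = 1) {n₀ d₀ : ℤ} (h0 : pr 0 = n₀ / d₀)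
    (hd₀ : 0 < d₀) (hd₀M : d₀ ≤ I.M) {j : ℕ} (hj : j ≤ k) :
    ∃ p q : ℤ, 0 < q ∧ q ≤ I.M ∧ pr j = p / q := by
  cases j with
  | zero => exact ⟨n₀, d₀, hd₀, hd₀M, h0⟩
  | succ j =>
    have hp := (h.good j hj).pos
    refine ⟨I.W - I.base (x j), I.slope σ (x j), hp, (abs_le.mp (abs_slope_le_M hσ _)).2, ?_⟩
    have hp' : (I.slope σ (x j) : ℚ) ≠ 0 := by exact_mod_cast hp.ne'
    rw [eq_div_iff hp']
    push_cast
    exact h.root j hj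

/-- A history of `k + 1` good evaluations is a Newton run with `k` steps. By `Good.le_of_not_good` a
failed look-ahead bounds the final point, which is what the halving of the values requires. -/
theorem length_le (h : I.History σ w T (k + 1) x cur pr) (hσ : |σ| = 1) {n₀ d₀ : ℤ}
    (h0 : pr 0 = n₀ / d₀) (hd₀ : 0 < d₀) (hd₀M : d₀ ≤ max 1 I.M) :
    k ≤ 4 * (n + 1) ^ 2 + 2 ∧ 2 ^ k ≤ 16 * I.M ^ 5 := by
  have hM : 1 ≤ I.M := by
    have h1 := (h.good 0 (by omega)).pos
    have h2 := (abs_le.mp (abs_slope_le_M hσ (I := I) (x 0))).2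
    omega
  have hd₀M' : d₀ ≤ I.M := by
    rwa [max_eq_right hM] at hd₀M
  have hrun : NewtonRun I.a (fun i => σ * I.b i) I.W k x cur pr
      (fun j => I.base (x j) - I.W) (fun j => I.slope σ (x j)) := by
    refine ⟨fun _ _ => rfl, fun _ _ => rfl, fun j hj => (h.good j (by omega)).pos, ?_, ?_, ?_, ?_,
      fun j hj => h.lt j (by omega), ?_⟩
    · intro j hj
      have := (h.good j (by omega)).feas
      rw [value] at this
      push_cast
      linarith
    · intro i hi j hj
      have := (h.good i (by omega)).min (x j) (h.good j (by omega)).reach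
      simp only [value] at this
      push_cast
      rcases this with h1 | ⟨h1, h2⟩
      · left; linarith
      · right; exact ⟨by linarith, h2⟩
    -- At index `0` the truncated `0 - 1` makes the look-ahead point the starting point itself.
    · rcases h.next 0 (by omega) with h1 | ⟨h1, -⟩
      · rw [h1]; simp only [Nat.zero_sub]; linarith
      · exact h1.ge
    · intro j hj
      rw [h.root j (by omega)]
      push_cast
      ring
    · intro j hj
      rcases h.next (j + 1) (by omega) with h1 | ⟨h1, h2⟩
      · exact Or.inl h1
      · exact Or.inr ⟨h1, (h.good k (by omega)).le_of_not_good h2⟩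
  obtain ⟨p, q, hq, hqM, hpq⟩ := h.rational hσ h0 hd₀ hd₀M' (j := k) (by omega)
  obtain ⟨p', q', hq', hqM', hpq'⟩ := h.rational hσ h0 hd₀ hd₀M' (j := k - 1) (by omega)
  have hMz : (1 : ℤ) ≤ I.M := by exact_mod_cast hM
  have hcur : ∃ cn cd : ℤ, 0 < cd ∧ cd ≤ I.M ^ 2 ∧ cur k = cn / cd := by
    rcases h.next k (by omega) with h1 | ⟨h1, -⟩
    -- A look-ahead point combines two consecutive roots, whose denominators are at most `M`; hence
    -- the bound `M ^ 2`.
    · refine ⟨2 * p * q' - p' * q, q * q', by positivity, by nlinarith, ?_⟩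
      have e1 : (q : ℚ) ≠ 0 := by exact_mod_cast hq.ne'
      have e2 : (q' : ℚ) ≠ 0 := by exact_mod_cast hq'.ne'
      rw [h1, hpq, hpq']
      push_cast
      field_simp
    · exact ⟨p, q, hq, by nlinarith, h1.trans hpq⟩
  obtain ⟨cn, cd, hcd, hcdM, hcur⟩ := hcur
  refine hrun.length_le (fun j _ => ?_) (fun j _ => abs_slope_le_M hσ _) hcd hcdM hcur
  have h1 := abs_base_le_M (I := I) (x j)
  have h2 := abs_W_le_M (I := I)
  have h3 := abs_sub (I.base (x j)) I.W
  linarith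

end History

variable (I)

/-- A bound on the number of iterations of the Newton method. -/
def newtonBound : ℕ := min (4 * (n + 1) ^ 2 + 2) (Nat.log 2 (16 * I.M ^ 5))

variable {I}

theorem History.length_le_newtonBound {k : ℕ} {x : ℕ → Finset (Fin n)} {cur pr : ℕ → ℚ}
    (h : I.History σ w T k x cur pr) (hσ : |σ| = 1) {n₀ d₀ : ℤ}
    (h0 : pr 0 = n₀ / d₀) (hd₀ : 0 < d₀) (hd₀M : d₀ ≤ max 1 I.M) : k ≤ I.newtonBound + 1 := by
  cases k with
  | zero => omega
  | succ k =>
    obtain ⟨h1, h2⟩ := h.length_le hσ h0 hd₀ hd₀M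
    have : k ≤ I.newtonBound := le_min h1 (Nat.le_log_of_pow_le (by norm_num) h2)
    omega

end Problem
end ParamKnapsack

namespace ParamKnapsack
open _root_.ParamKnapsack.Expr

variable {N n : ℕ}

/-! ### The Newton method as a program -/

/-- Copy `n` cells of the array `src` from the address `reg 27` on to the array `dst`, from the address
`reg 26` on. -/
def copyRow (dst src : ℕ) : Prog :=
  Prog.assign 28 (const 0) ;;
  Prog.whileLE (add (reg 28) (const 1)) (reg 0)
    (Prog.put dst (add (reg 26) (reg 28)) (get src (add (reg 27) (reg 28))) ;;
      Prog.assign 28 (add (reg 28) (const 1)))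

theorem copyRow_spec (hN : 4 ≤ N) {dst src : ℕ} (hds : src ≠ dst) {s : Store} (hb : s.Bdd N)
    (hn : s.reg 0 = n) (hnN : n ≤ N) {d r : ℕ} (hd : s.reg 26 = d) (hr : s.reg 27 = r) :
    Tri N (copyRow dst src) s (20 * n + 10) fun s' => (∀ x ≠ 28, s'.reg x = s.reg x) ∧
      (∀ v ≠ dst, ∀ l, s'.arr v l = s.arr v l) ∧
      (∀ j < n, s'.arr dst (d + j) = s.arr src (r + j)) ∧
      ∀ l, l < d ∨ d + n ≤ l → s'.arr dst l = s.arr dst l := by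
  refine Tri.assign_seq hN hb (by decide) (by simp [Ok]) (z := 0) (by simp [eval])
    (by simp) fun hb => ?_
  refine Tri.loop hN (by decide) (by decide) (fun k s' => (∀ x ≠ 28, s'.reg x = s.reg x) ∧
      (∀ v ≠ dst, ∀ l, s'.arr v l = s.arr v l) ∧
      (∀ j < k, s'.arr dst (d + j) = s.arr src (r + j)) ∧
      (∀ l, l < d ∨ d + k ≤ l → s'.arr dst l = s.arr dst l) ∧ s'.reg 28 = k ∧ k ≤ n) n 12
    (fun _ _ _ _ => by simp [Ok]) ?_ ?_ hb ?_ (by simp only [cost]; omega)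
  · rintro k s' hb ⟨h1, h2, h3, h4, h5, h6⟩ hle
    have e0 : s'.reg 0 = n := by rw [h1 0 (by norm_num), hn]
    have e26 : s'.reg 26 = d := by rw [h1 26 (by norm_num), hd]
    have e27 : s'.reg 27 = r := by rw [h1 27 (by norm_num), hr]
    simp only [eval, h5, e0] at hle
    refine ⟨by omega, ?_⟩
    have hv : (get src (add (reg 27) (reg 28))).eval s' = s.arr src (r + k) := by
      simp only [eval, e27, h5, ← Nat.cast_add, Int.toNat_natCast, h2 src hds]
    refine Tri.put_seq hN hb (by simp [deg]) (by simp [deg]) (by simp [Ok])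
      (by simp [Ok, eval, e27, h5]; omega) (j := d + k) (by simp [eval, e26, h5]) hv
      (by rw [← h2 src hds]; exact hb.2 _ _) fun hb => ?_
    refine Tri.assign hN hb (by decide) (by simp [Ok]) (z := k + 1) (by simp [eval, h5])
      (by rw [abs_of_nonneg] <;> omega) (by simp [cost]) ?_
    refine ⟨?_, ?_, ?_, ?_, by simp, by omega⟩
    · intro x hx
      simp [hx, h1]
    · intro v hv l
      simp [hv, h2]
    · intro j hj
      by_cases hjk : j = k
      · simp [hjk]
      · simp [hjk, h3 j (by omega)]
    · intro l hl
      have : l ≠ d + k := by omega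
      simp [this, h4 l (by omega)]
  · rintro k s' hb ⟨h1, h2, h3, h4, h5, h6⟩ hle
    have e0 : s'.reg 0 = n := by rw [h1 0 (by norm_num), hn]
    simp only [eval, h5, e0] at hle
    obtain rfl : k = n := by omega
    exact ⟨h1, h2, h3, h4⟩
  · refine ⟨fun x hx => by simp [hx], fun v _ l => by simp, by simp, fun l _ => by simp, by simp,
      by simp⟩

/-- Evaluate at `reg 22 / reg 23`, and then, unless that point is good, at `reg 20 / reg 21`. -/
def evalBack (σ : ℤ) : Prog :=
  evaluate σ ;;
  Prog.iteLE (mul (sub (reg 33) (const 1)) (sub (reg 33) (const 1))) (const 0) Prog.skip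
    (Prog.assign 22 (reg 20) ;; Prog.assign 23 (reg 21) ;; evaluate σ)

/-- The accelerated Newton method, started at `reg 20 / reg 21`. -/
def newton (σ : ℤ) : Prog :=
  Prog.assign 19 (const 0) ;; Prog.assign 22 (reg 20) ;; Prog.assign 23 (reg 21) ;;
  Prog.whileLE (reg 19) (const 0)
    (evalBack σ ;;
    Prog.iteLE (mul (sub (reg 33) (const 1)) (sub (reg 33) (const 1))) (const 0)
      (Prog.assign 25 (sub (reg 1) (reg 30)) ;;
      Prog.iteLE (mul (reg 25) (reg 21)) (mul (reg 20) (reg 31))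
        (Prog.assign 19 (const 1))
        (Prog.assign 26 (const 0) ;; Prog.assign 27 (const 0) ;; copyRow 19 22 ;;
        Prog.assign 22 (sub (mul (const 2) (mul (reg 25) (reg 21))) (mul (reg 20) (reg 31))) ;;
        Prog.assign 23 (mul (reg 31) (reg 21)) ;;
        Prog.assign 20 (reg 25) ;; Prog.assign 21 (reg 31)))
      (Prog.assign 19 (const 1)))

theorem evalBack_spec (hN : 4 ≤ N) {I : Problem n} {σ : ℤ} (hσ : |σ| = 1) {w : Fin n → ℕ} {T : ℕ}
    {s : Store} (hb : s.Bdd N) (hE : I.Env w T s) (hcd : 0 < s.reg 23) (hpd : 0 < s.reg 21)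
    (hinf : 2 * penalty I.size (s.reg 22) (s.reg 23) ≤ N)
    (hinf' : 2 * penalty I.size (s.reg 20) (s.reg 21) ≤ N) (hnN : n ≤ N) (hTN : T + 1 ≤ N) :
    Tri N (evalBack σ) s (500 * ((n + 1) * (T + 1))) fun s' => Store.Same 22 20 s s' ∧
      ∃ y : Finset (Fin n), (∀ j : Fin n, s'.arr 22 j = if j ∈ y then 1 else 0) ∧
        s'.reg 30 = I.base y ∧ s'.reg 31 = I.slope σ y ∧
        ((s'.reg 33 = 1 ∧ I.Good σ w T (s.reg 22 / s.reg 23) y) ∨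
        ((∀ z, ¬ I.Good σ w T (s.reg 22 / s.reg 23) z) ∧
          I.Outcome σ w T (s.reg 20) (s.reg 21) y (s'.reg 33))) := by
  have hone : 1 ≤ (n + 1) * (T + 1) := Nat.one_le_iff_ne_zero.mpr (by positivity)
  refine Tri.seq _ (evaluate_spec hN hσ hb hE rfl rfl hcd hinf hnN hTN) ?_
  rintro s₁ hb ⟨hs₁, y, hy, h30, h31, hO⟩
  -- The machine can test only `≤`; equality is tested by a square that is at most `0`.
  have hflag : (mul (sub (reg 33) (const 1)) (sub (reg 33) (const 1))).eval s₁
      ≤ (const 0 : Expr).eval s₁ ↔ s₁.reg 33 = 1 := by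
    simp only [eval]
    constructor
    · intro h
      by_contra hne
      have : 0 < (s₁.reg 33 - 1) * (s₁.reg 33 - 1) := by
        have := mul_self_pos.mpr (sub_ne_zero.mpr hne)
        exact this
      omega
    · intro h
      simp [h]
  refine Tri.ite hN hb (by decide) (by decide) (by simp [Ok]) (by simp [Ok]) (fun h => ?_)
    (fun h => ?_)
  · rw [hflag] at h
    refine Tri.skip hb ⟨hs₁.mono (by norm_num) le_rfl, y, hy, h30, h31, Or.inl ⟨h, ?_⟩⟩
      (by simp only [cost]; omega)
    rw [h] at hO
    cases hO with
    | good h1 h2 h3 => exact Problem.Good.of_lexMin hcd h1 h2 h3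
  · rw [hflag] at h
    refine Tri.assign_seq hN hb (by decide) (by simp [Ok]) (z := s.reg 20)
      (by simp [eval, hs₁.1]) (by rw [← hs₁.1 20 (by norm_num)]; exact hb.1 _) fun hb => ?_
    refine Tri.assign_seq hN hb (by decide) (by simp [Ok]) (z := s.reg 21)
      (by simp [eval, hs₁.1]) (by have := hb.1 21; simpa [hs₁.1 21] using this) fun hb => ?_
    have hs₂ := ((hs₁.mono (by norm_num : 22 ≤ 30) le_rfl).setReg (x := 22) (by norm_num)
      (s.reg 20)).setReg (x := 23) (by norm_num) (s.reg 21)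
    refine Tri.mono (evaluate_spec hN hσ hb (hE.same (hs₂.mono (by norm_num) (by norm_num)))
      (cn := s.reg 20) (cd := s.reg 21) (by simp) (by simp) hpd hinf' hnN hTN)
      (by simp only [cost]; omega) ?_
    rintro s₃ hb ⟨hs₃, y', hy', h30', h31', hO'⟩
    exact ⟨hs₂.trans (hs₃.mono (by norm_num) le_rfl), y', hy', h30', h31',
      Or.inr ⟨hO.not_good hcd h, hO'⟩⟩

/-- The bound on `cn` gives `cd + cn * cn ≤ 10 (S + 2) ^ 4`, and the constant is `160 = 2 * 4 * 2 *
10`. -/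
theorem two_mul_penalty_le {S : ℕ} {cn cd : ℤ} (hcn : |cn| ≤ 3 * (S + 2) ^ 2) (hcd : 0 < cd)
    (hcd' : cd ≤ (S + 2) ^ 2) (hSN : 160 * (S + 2) ^ 6 ≤ N) : 2 * penalty S cn cd ≤ N := by
  have hSN' : (160 : ℤ) * (S + 2) ^ 6 ≤ N := by exact_mod_cast hSN
  have h1 : cn * cn ≤ 9 * ((S : ℤ) + 2) ^ 4 := by
    rw [← abs_mul_abs_self]
    have := mul_le_mul hcn hcn (abs_nonneg _) (by positivity)
    linarith
  have h2 : ((S : ℤ) + 2) ^ 2 ≤ ((S : ℤ) + 2) ^ 4 := pow_le_pow_right₀ (by omega) (by norm_num)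
  have h3 : cd + cn * cn ≤ 10 * ((S : ℤ) + 2) ^ 4 := by linarith
  have h4 : (cd + cn * cn) * ((S : ℤ) + 1) ≤ 10 * ((S : ℤ) + 2) ^ 4 * (S + 2) :=
    mul_le_mul h3 (by omega) (by positivity) (by positivity)
  have h5 : (2 * (S : ℤ) + 3) * ((cd + cn * cn) * ((S : ℤ) + 1))
      ≤ (2 * ((S : ℤ) + 2)) * (10 * ((S : ℤ) + 2) ^ 4 * (S + 2)) := by
    refine mul_le_mul (by omega) h4 ?_ (by positivity)
    have := mul_self_nonneg cn
    positivity
  rw [penalty]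
  nlinarith

/-! ### Invariant and result of the Newton program -/

namespace Problem

variable (I : Problem n)

/-- The memory after `k` iterations of the Newton method that was started at `n₀ / d₀`. -/
structure NewtonInv (σ : ℤ) (w : Fin n → ℕ) (T : ℕ) (n₀ d₀ : ℤ) (k : ℕ) (s : Store)
    (x : ℕ → Finset (Fin n)) (cur pr : ℕ → ℚ) : Prop where
  hist : I.History σ w T k x cur pr
  start : pr 0 = n₀ / d₀
  pr_eq : pr k = s.reg 20 / s.reg 21
  pd_pos : 0 < s.reg 21
  pn_le : |s.reg 20| ≤ I.size + 2
  pd_le : s.reg 21 ≤ I.size + 1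
  cur_eq : (s.reg 22 / s.reg 23 : ℚ) = 2 * pr k - pr (k - 1)
  cd_pos : 0 < s.reg 23
  cn_le : |s.reg 22| ≤ 3 * (I.size + 2) ^ 2
  cd_le : s.reg 23 ≤ (I.size + 2) ^ 2
  zero : k = 0 → s.reg 20 = n₀ ∧ s.reg 21 = d₀
  pos : 0 < k → s.reg 20 = I.W - I.base (x (k - 1)) ∧ s.reg 21 = I.slope σ (x (k - 1)) ∧
    ∀ j : Fin n, s.arr 19 j = if j ∈ x (k - 1) then 1 else 0

/-- The result of the Newton method: either the starting point, or a greater point `reg 20 / reg 21`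
with a set in array `19` that is feasible up to this point. Moreover, `reg 33 = 2` and array
`22` holds a set that is feasible from this point on, or no set of nonpositive slope is. -/
structure NewtonPost (σ : ℤ) (w : Fin n → ℕ) (T : ℕ) (n₀ d₀ : ℤ) (s : Store) : Prop where
  left : (s.reg 20 = n₀ ∧ s.reg 21 = d₀) ∨ (n₀ * s.reg 21 < s.reg 20 * d₀ ∧
    ∃ x : Finset (Fin n), (∀ j : Fin n, s.arr 19 j = if j ∈ x then 1 else 0) ∧
      T ≤ ∑ i ∈ x, w i ∧ 0 < I.slope σ x ∧ s.reg 20 = I.W - I.base x ∧ s.reg 21 = I.slope σ x)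
  right : (s.reg 33 = 2 ∧ ∃ y : Finset (Fin n), (∀ j : Fin n, s.arr 22 j = if j ∈ y then 1 else 0) ∧
      T ≤ ∑ i ∈ y, w i ∧ s.reg 21 * I.base y + s.reg 20 * I.slope σ y ≤ s.reg 21 * I.W ∧
      I.slope σ y ≤ 0) ∨
    (s.reg 33 ≠ 2 ∧ ∀ z : Finset (Fin n), T ≤ ∑ i ∈ z, w i →
      s.reg 21 * I.W < s.reg 21 * I.base z + s.reg 20 * I.slope σ z ∨
      (s.reg 21 * I.W = s.reg 21 * I.base z + s.reg 20 * I.slope σ z ∧ 0 < I.slope σ z))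

variable {I}

theorem NewtonInv.post_left {σ : ℤ} {w : Fin n → ℕ} {T k : ℕ} {n₀ d₀ : ℤ} (hd₀ : 0 < d₀)
    {s : Store} {x : ℕ → Finset (Fin n)} {cur pr : ℕ → ℚ}
    (h : I.NewtonInv σ w T n₀ d₀ k s x cur pr) :
    (s.reg 20 = n₀ ∧ s.reg 21 = d₀) ∨ (n₀ * s.reg 21 < s.reg 20 * d₀ ∧
    ∃ x : Finset (Fin n), (∀ j : Fin n, s.arr 19 j = if j ∈ x then 1 else 0) ∧
      T ≤ ∑ i ∈ x, w i ∧ 0 < I.slope σ x ∧ s.reg 20 = I.W - I.base x ∧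
      s.reg 21 = I.slope σ x) := by
  rcases Nat.eq_zero_or_pos k with hk | hk
  · exact Or.inl (h.zero hk)
  · right
    obtain ⟨h1, h2, h3⟩ := h.pos hk
    have hg := h.hist.good (k - 1) (by omega)
    refine ⟨?_, x (k - 1), h3, hg.reach, hg.pos, h1, h2⟩
    have h4 := (h.hist.start_le (j := k - 1) (by omega)).trans_lt (h.hist.lt (k - 1) (by omega))
    rw [Nat.sub_add_cancel hk, h.start, h.pr_eq,
      div_lt_div_iff₀ (by exact_mod_cast hd₀) (by exact_mod_cast h.pd_pos)] at h4
    exact_mod_cast h4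

theorem History.pr_le {σ : ℤ} {w : Fin n → ℕ} {T k : ℕ} {x : ℕ → Finset (Fin n)} {cur pr : ℕ → ℚ}
    (h : I.History σ w T k x cur pr) : pr k ≤ 2 * pr k - pr (k - 1) := by
  rcases Nat.eq_zero_or_pos k with hk | hk
  · subst hk
    simp only [Nat.zero_sub]
    linarith
  · have h4 := h.lt (k - 1) (by omega)
    rw [Nat.sub_add_cancel hk] at h4
    linarith

/-- The next look-ahead point is `2 ρ - p` for the new root `ρ = (W - base) / slope` and the old
point `p`, over a common denominator. Fractions are never reduced, but the root is read off anew
from the current set each time, so sizes do not accumulate. -/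
theorem NewtonInv.extend {σ : ℤ} {w : Fin n → ℕ} {T k : ℕ} {n₀ d₀ : ℤ}
    {s s' : Store} {x : ℕ → Finset (Fin n)} {cur pr : ℕ → ℚ}
    (h : I.NewtonInv σ w T n₀ d₀ k s x cur pr) {c : ℚ} {y : Finset (Fin n)}
    (hg : I.Good σ w T c y) (hn : c = 2 * pr k - pr (k - 1) ∨
      (c = pr k ∧ ∀ z, ¬ I.Good σ w T (2 * pr k - pr (k - 1)) z))
    (hlt : s.reg 20 * I.slope σ y < (I.W - I.base y) * s.reg 21)
    (h20 : s'.reg 20 = I.W - I.base y) (h21 : s'.reg 21 = I.slope σ y)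
    (h22 : s'.reg 22 = 2 * ((I.W - I.base y) * s.reg 21) - s.reg 20 * I.slope σ y)
    (h23 : s'.reg 23 = I.slope σ y * s.reg 21) (b20 : |I.W - I.base y| ≤ I.size + 2)
    (b21 : I.slope σ y ≤ I.size + 1)
    (b22 : |2 * ((I.W - I.base y) * s.reg 21) - s.reg 20 * I.slope σ y| ≤ 3 * (I.size + 2) ^ 2)
    (b23 : I.slope σ y * s.reg 21 ≤ (I.size + 2) ^ 2)
    (hy : ∀ j : Fin n, s'.arr 19 j = if j ∈ y then 1 else 0) :
    I.NewtonInv σ w T n₀ d₀ (k + 1) s' (Function.update x k y) (Function.update cur k c)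
      (Function.update pr (k + 1) (((I.W - I.base y : ℤ) : ℚ) / I.slope σ y)) := by
  have hpd0 := h.pd_pos
  have hs0 := hg.pos
  have hsq : (0 : ℚ) < I.slope σ y := by exact_mod_cast hs0
  have hpq : (0 : ℚ) < s.reg 21 := by exact_mod_cast hpd0
  have hlt' : pr k < ((I.W - I.base y : ℤ) : ℚ) / I.slope σ y := by
    rw [h.pr_eq, div_lt_div_iff₀ hpq hsq]
    exact_mod_cast hlt
  refine ⟨h.hist.extend hg (by rw [div_mul_cancel₀ _ hsq.ne']; push_cast; ring) hlt' hn,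
    ?_, by rw [Function.update_self, h20, h21], by rwa [h21], by rwa [h20], by rwa [h21], ?_,
    by rw [h23]; exact mul_pos hs0 hpd0, by rwa [h22], by rwa [h23], by simp,
    fun _ => ⟨by simpa using h20, by simpa using h21, by simpa using hy⟩⟩
  · rw [Function.update_of_ne (by omega)]
    exact h.start
  · rw [Nat.add_sub_cancel, Function.update_self, Function.update_of_ne (by omega), h.pr_eq,
      h22, h23]
    push_cast
    field_simp

/-- If a good set does not lead beyond the point `t`, then it is tight at `t`. -/
theorem Good.tight {σ : ℤ} {w : Fin n → ℕ} {T : ℕ} {c : ℚ} {pn pd : ℤ} {y : Finset (Fin n)}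
    (h : I.Good σ w T c y) (hpd : 0 < pd) (hc : (pn / pd : ℚ) ≤ c)
    (hle : (I.W - I.base y) * pd ≤ pn * I.slope σ y) (z : Finset (Fin n))
    (hz : T ≤ ∑ i ∈ z, w i) : pd * I.W < pd * I.base z + pn * I.slope σ z ∨
      (pd * I.W = pd * I.base z + pn * I.slope σ z ∧ 0 < I.slope σ z) := by
  have hpd' : (0 : ℚ) < pd := by exact_mod_cast hpd
  have hs : (0 : ℚ) < I.slope σ y := by exact_mod_cast h.pos
  have h1 := h.feas
  have h2 : (I.W : ℚ) ≤ I.value σ (pn / pd) y := by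
    rw [value_div hpd, le_div_iff₀ hpd']
    have : I.W * pd ≤ pd * I.base y + pn * I.slope σ y := by linarith
    exact_mod_cast this
  -- The set weighs at least `W` at `pn / pd` and at most `W` at `c`, to the right of it. As its
  -- slope is positive, the two points coincide.
  have h3 : c = pn / pd := by
    refine le_antisymm ?_ hc
    by_contra! hlt
    have : I.value σ (pn / pd) y < I.value σ c y := by
      simp only [value]
      nlinarith
    linarith
  subst h3
  have h4 : (I.W : ℚ) = I.value σ (pn / pd) y := le_antisymm h2 h1
  have h5 := h.min z hz
  rw [← h4, value_div hpd, lt_div_iff₀ hpd', eq_div_iff hpd'.ne'] at h5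
  rcases h5 with h5 | ⟨h5, h6⟩
  · left
    rw [mul_comm]
    exact_mod_cast h5
  · right
    refine ⟨?_, h.pos.trans_le h6⟩
    rw [mul_comm]
    exact_mod_cast h5

end Problem

set_option maxHeartbeats 1000000 in
-- The loop has three exits. A good set may fail to lead beyond the current point, which is then
-- tight (`Good.tight`). If neither the look-ahead point nor the current point is good, then either
-- no set that meets the demand is feasible at the current point, or a feasible set of nonpositive
-- slope has been found there, and this set stays feasible from there on.
theorem newton_spec (hN : 4 ≤ N) {I : Problem n} {σ : ℤ} (hσ : |σ| = 1) {w : Fin n → ℕ} {T : ℕ}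
    {s : Store} (hb : s.Bdd N) (hE : I.Env w T s) {n₀ d₀ : ℤ} (h20 : s.reg 20 = n₀)
    (h21 : s.reg 21 = d₀) (hd₀ : 0 < d₀) (hd₀S : d₀ ≤ I.size + 1) (hd₀M : d₀ ≤ max 1 I.M)
    (hn₀S : |n₀| ≤ I.size + 2) (hnN : n ≤ N) (hTN : T + 1 ≤ N)
    (hSN : 160 * (I.size + 2) ^ 6 ≤ N) :
    Tri N (newton σ) s ((I.newtonBound + 2) * (600 * ((n + 1) * (T + 1))) + 20) fun s' =>
      Store.Same 19 19 s s' ∧ 0 < s'.reg 21 ∧ I.NewtonPost σ w T n₀ d₀ s' := by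
  have hone : 1 ≤ (n + 1) * (T + 1) := Nat.one_le_iff_ne_zero.mpr (by positivity)
  have hnT : n + 1 ≤ (n + 1) * (T + 1) := Nat.le_mul_of_pos_right _ (by positivity)
  have hSN' : (160 : ℤ) * ((I.size : ℤ) + 2) ^ 6 ≤ N := by exact_mod_cast hSN
  set S : ℤ := (I.size : ℤ) with hS
  have hS0 : 0 ≤ S := by positivity
  have hS6 : (S + 2) ^ 2 ≤ (S + 2) ^ 6 := pow_le_pow_right₀ (by omega) (by norm_num)
  have hS2 : S + 2 ≤ (S + 2) ^ 2 := by nlinarith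
  have hflag : ∀ s₁ : Store, (mul (sub (reg 33) (const 1)) (sub (reg 33) (const 1))).eval s₁
      ≤ (const 0 : Expr).eval s₁ ↔ s₁.reg 33 = 1 := by
    intro s₁
    simp only [eval]
    constructor
    · intro h
      by_contra hne
      have := mul_self_pos.mpr (sub_ne_zero.mpr hne)
      omega
    · intro h
      simp [h]
  refine Tri.assign_seq hN hb (by decide) (by simp [Ok]) (z := 0) (by simp [eval])
    (by simp) fun hb => ?_
  refine Tri.assign_seq hN hb (by decide) (by simp [Ok]) (z := n₀) (by simp [eval, h20])
    (by linarith) fun hb => ?_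
  refine Tri.assign_seq hN hb (by decide) (by simp [Ok]) (z := d₀) (by simp [eval, h21])
    (by rw [abs_of_pos hd₀]; linarith) fun hb => ?_
  refine Tri.loop hN (by decide) (by decide) (fun k s' => Store.Same 19 19 s s' ∧
    ((s'.reg 19 = 0 ∧ ∃ x cur pr, I.NewtonInv σ w T n₀ d₀ k s' x cur pr) ∨
      (s'.reg 19 = 1 ∧ 0 < s'.reg 21 ∧ I.NewtonPost σ w T n₀ d₀ s'))) (I.newtonBound + 2)
    (597 * ((n + 1) * (T + 1))) (fun _ _ _ _ => by simp [Ok]) ?_ ?_ hb ?_ ?_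
  · rintro k s₁ hb ⟨hs₁, h | h⟩ hle
    swap
    · simp only [eval, h.1] at hle
      norm_num at hle
    obtain ⟨h19, x, cur, pr, hI⟩ := h
    -- All completed iterations form a history, so the combinatorial bound on histories bounds the
    -- loop.
    have hlen := hI.hist.length_le_newtonBound hσ hI.start hd₀ hd₀M
    refine ⟨by omega, ?_⟩
    have hE₁ := hE.same (hs₁.mono (by norm_num) le_rfl)
    have hpn := hI.pn_le
    have hpd := hI.pd_le
    have hpd0 := hI.pd_pos
    rw [← hS] at hpn hpd
    refine Tri.seq _ (evalBack_spec hN hσ hb hE₁ hI.cd_pos hI.pd_pos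
      (two_mul_penalty_le hI.cn_le hI.cd_pos hI.cd_le hSN)
      (two_mul_penalty_le (by rw [← hS]; linarith) hI.pd_pos (by rw [← hS]; linarith) hSN)
      hnN hTN) ?_
    rintro s₂ hb ⟨hs₂, y, hy, h30, h31, hO⟩
    have hs₂' := hs₁.trans (hs₂.mono (by norm_num) (by norm_num))
    have e1 : s₂.reg 1 = I.W := by rw [hs₂.1 1 (by norm_num), hE₁.W_eq]
    have e20 := hs₂.1 20 (by norm_num)
    have e21 := hs₂.1 21 (by norm_num)
    have e19 : s₂.reg 19 = 0 := by rw [hs₂.1 19 (by norm_num), h19]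
    have hleft := hI.post_left hd₀
    have ea19 : ∀ j, s₂.arr 19 j = s₁.arr 19 j := hs₂.2 19 (by norm_num)
    refine Tri.ite hN hb (by decide) (by decide) (by simp [Ok]) (by simp [Ok]) (fun h => ?_)
      (fun h => ?_)
    · rw [hflag] at h
      obtain ⟨c, hg, hn⟩ : ∃ c : ℚ, I.Good σ w T c y ∧ (c = 2 * pr k - pr (k - 1) ∨
          (c = pr k ∧ ∀ z, ¬ I.Good σ w T (2 * pr k - pr (k - 1)) z)) := by
        rcases hO with ⟨-, hO⟩ | ⟨hO, hO'⟩
        · exact ⟨_, hO, Or.inl hI.cur_eq⟩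
        · rw [h] at hO'
          cases hO' with
          | good h1 h2 h3 =>
            refine ⟨_, Problem.Good.of_lexMin hI.pd_pos h1 h2 h3, Or.inr ⟨hI.pr_eq.symm, ?_⟩⟩
            rwa [← hI.cur_eq]
      have hWb : |I.W - I.base y| ≤ S := by
        have h1 := I.abs_base_add_le y
        have h2 := abs_sub I.W (I.base y)
        linarith
      have hsl : I.slope σ y ≤ S := (abs_le.mp (I.abs_slope_le hσ y)).2
      have hs0 := hg.pos
      refine Tri.assign_seq hN hb (by decide) (by simp [Ok]) (z := I.W - I.base y)
        (by simp [eval, e1, h30]) (by linarith) fun hb => ?_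
      refine Tri.ite hN hb (by decide) (by decide) (by simp [Ok]) (by simp [Ok]) (fun h' => ?_)
        (fun h' => ?_)
      · simp only [eval] at h'
        simp [e20, e21, h31] at h'
        refine Tri.assign hN hb (by decide) (by simp [Ok]) (z := 1)
          (by simp [eval]) (by simp; omega) (by simp only [cost]; omega)
          ⟨(hs₂'.setReg (by norm_num) _).setReg (by norm_num) _, Or.inr ⟨by simp,
            by simpa [e21] using hpd0, ⟨by simpa [e20, e21, ea19] using hleft, Or.inr ?_⟩⟩⟩
        refine ⟨by simp [h], fun z hz => ?_⟩
        have hc : (s₁.reg 20 / s₁.reg 21 : ℚ) ≤ c := by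
          rw [← hI.pr_eq]
          rcases hn with hn | ⟨hn, -⟩
          · rw [hn]; exact hI.hist.pr_le
          · exact hn.ge
        simpa [e20, e21] using hg.tight hpd0 hc h' z hz
      · simp only [eval] at h'
        simp [e20, e21, h31] at h'
        refine Tri.assign_seq hN hb (by decide) (by simp [Ok]) (z := 0)
          (by simp [eval]) (by simp) fun hb => ?_
        refine Tri.assign_seq hN hb (by decide) (by simp [Ok]) (z := 0)
          (by simp [eval]) (by simp) fun hb => ?_
        refine Tri.seq _ (copyRow_spec hN (by norm_num : 22 ≠ 19) hb (n := n) (d := 0) (r := 0)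
          (by simp [hs₂.1, hE₁.n_eq]) hnN (by simp) (by simp)) ?_
        rintro s₃ hb ⟨hr, ha, hx, -⟩
        have hs₃ : Store.Same 19 19 s s₃ := by
          refine hs₂'.trans ⟨fun v hv => ?_, fun v hv l => ?_⟩
          · rw [hr v (by omega)]
            simp [show v ≠ 27 by omega, show v ≠ 26 by omega, show v ≠ 25 by omega]
          · rw [ha v (by omega)]
            simp
        have f20 : s₃.reg 20 = s₁.reg 20 := by rw [hr 20 (by norm_num)]; simp [e20]
        have f21 : s₃.reg 21 = s₁.reg 21 := by rw [hr 21 (by norm_num)]; simp [e21]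
        have f25 : s₃.reg 25 = I.W - I.base y := by rw [hr 25 (by norm_num)]; simp
        have f31 : s₃.reg 31 = I.slope σ y := by rw [hr 31 (by norm_num)]; simp [h31]
        have f19 : s₃.reg 19 = 0 := by rw [hr 19 (by norm_num)]; simp [e19]
        have fx : ∀ j : Fin n, s₃.arr 19 j = if j ∈ y then 1 else 0 := by
          intro j
          have := hx j j.2
          simp only [zero_add] at this
          rw [this, ← hy j]
          simp
        have b1 : |2 * ((I.W - I.base y) * s₁.reg 21) - s₁.reg 20 * I.slope σ y|
            ≤ 3 * (S + 2) ^ 2 := by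
          have c1 : |(I.W - I.base y) * s₁.reg 21| ≤ (S + 2) * (S + 2) := by
            rw [abs_mul, abs_of_pos hpd0]
            exact mul_le_mul (by linarith) (by linarith) (by linarith) (by linarith)
          have c2 : |s₁.reg 20 * I.slope σ y| ≤ (S + 2) * (S + 2) := by
            rw [abs_mul, abs_of_pos hs0]
            exact mul_le_mul (by linarith) (by linarith) (by linarith) (by linarith)
          have c3 := abs_sub (2 * ((I.W - I.base y) * s₁.reg 21)) (s₁.reg 20 * I.slope σ y)
          rw [abs_mul 2, abs_two] at c3
          nlinarith
        have b2 : I.slope σ y * s₁.reg 21 ≤ (S + 2) ^ 2 := by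
          have := mul_le_mul (hsl.trans (by linarith : S ≤ S + 2))
            (hpd.trans (by linarith : S + 1 ≤ S + 2)) hpd0.le (by linarith)
          linarith
        have b3 : 0 < I.slope σ y * s₁.reg 21 := mul_pos hs0 hpd0
        refine Tri.assign_seq hN hb (by decide) (by simp [Ok])
          (z := 2 * ((I.W - I.base y) * s₁.reg 21) - s₁.reg 20 * I.slope σ y)
          (by simp [eval, f20, f21, f25, f31]) (by linarith) fun hb => ?_
        refine Tri.assign_seq hN hb (by decide) (by simp [Ok]) (z := I.slope σ y * s₁.reg 21)
          (by simp [eval, f21, f31]) (by rw [abs_of_pos b3]; linarith) fun hb => ?_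
        refine Tri.assign_seq hN hb (by decide) (by simp [Ok]) (z := I.W - I.base y)
          (by simp [eval, f25]) (by linarith) fun hb => ?_
        refine Tri.assign hN hb (by decide) (by simp [Ok]) (z := I.slope σ y)
          (by simp [eval, f31]) (by rw [abs_of_pos hs0]; linarith) (by simp only [cost]; omega) ?_
        refine ⟨(((hs₃.setReg (by norm_num) _).setReg (by norm_num) _).setReg (by norm_num) _).setReg
          (by norm_num) _, Or.inl ⟨by simp [f19], ?_⟩⟩
        exact ⟨_, _, _, hI.extend hg hn h' (by simp) (by simp) (by simp) (by simp)
          (hWb.trans (by linarith)) (hsl.trans (by linarith)) b1 b2 (by simpa using fx)⟩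
    · rw [hflag] at h
      rcases hO with ⟨hO, -⟩ | ⟨-, hO⟩
      · exact absurd hO h
      refine Tri.assign hN hb (by decide) (by simp [Ok]) (z := 1)
        (by simp [eval]) (by simp; omega) (by simp only [cost]; omega)
        ⟨hs₂'.setReg (by norm_num) _, Or.inr ⟨by simp, by simpa [e21] using hpd0,
          ⟨by simpa [e20, e21, ea19] using hleft, ?_⟩⟩⟩
      generalize hf : s₂.reg 33 = f at hO h
      cases hO with
      | none h1 =>
        right
        refine ⟨by simp [hf], fun z hz => Or.inl ?_⟩
        simpa [e20, e21] using h1 z hz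
      | good => exact absurd rfl h
      | flat h1 h2 h3 =>
        left
        refine ⟨by simp [hf], y, by simpa using hy, h1.reach, by simpa [e20, e21] using h2, h3⟩
  · rintro k s₁ hb ⟨hs₁, h | h⟩ hle
    · simp only [eval, h.1] at hle
      norm_num at hle
    · exact ⟨hs₁, h.2⟩
  · have hs₁ := (((Store.Same.refl 19 19 s).setReg (x := 19) le_rfl 0).setReg (x := 22) (by norm_num)
      n₀).setReg (x := 23) (by norm_num) d₀
    refine ⟨hs₁, Or.inl ⟨by simp, fun _ => ∅, fun _ => 0, fun _ => n₀ / d₀, ?_⟩⟩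
    refine ⟨⟨by simp, by simp, by simp, by simp⟩, rfl, by simp [h20, h21], by simpa [h21] using hd₀,
      by simpa [h20] using hn₀S, by simpa [h21] using hd₀S, ?_, by simpa using hd₀, ?_, ?_,
      fun _ => by simp [h20, h21], by simp⟩
    · simp; ring
    · simp only [Store.reg_setReg]
      norm_num
      rw [← hS]
      linarith
    · simp only [Store.reg_setReg]
      norm_num
      rw [← hS]
      linarith
  · have h3 : 3 + 597 * ((n + 1) * (T + 1)) ≤ 600 * ((n + 1) * (T + 1)) := by omega
    simp only [cost]
    generalize 597 * ((n + 1) * (T + 1)) = X at h3 ⊢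
    generalize 600 * ((n + 1) * (T + 1)) = Y at h3 ⊢
    have h4 : (I.newtonBound + 2) * (1 + 1 + 1 + X) ≤ (I.newtonBound + 2) * Y :=
      Nat.mul_le_mul_left _ h3
    generalize (I.newtonBound + 2) * Y = Z at h4 ⊢
    generalize (I.newtonBound + 2) * (1 + 1 + 1 + X) = Z' at h4 ⊢
    omega

end ParamKnapsack

namespace ParamKnapsack

variable {n : ℕ}

/-! ### Sweeping the parameter axis from both ends -/

namespace Problem

variable {I : Problem n} {σ : ℤ} {ε : ℝ}

theorem feasible_iff (I : Problem n) (σ : ℤ) (t : ℝ) (y : Finset (Fin n)) :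
    I.Feasible (σ * t) y ↔ (I.base y : ℝ) + t * I.slope σ y ≤ I.W := by
  have : ∑ i ∈ y, I.weight (σ * t) i = (I.base y : ℝ) + t * I.slope σ y := by
    simp only [weight, base, slope]
    push_cast
    rw [Finset.sum_add_distrib, Finset.mul_sum]
    congr 1
    exact Finset.sum_congr rfl fun i _ => by ring
  rw [Feasible, this]

theorem lt_optProfit_iff {r : ℝ} {q : ℕ} :
    q < I.optProfit r ↔ ∃ y, I.Feasible r y ∧ q < I.profit y := by
  classical
  rw [optProfit, Finset.lt_sup_iff]
  simp

variable (I)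

/-- `x` is a `(1 - ε)`-approximate solution at `r`, if there is a feasible set at all. -/
def Appr (ε r : ℝ) (x : Finset (Fin n)) : Prop := (∃ y, I.Feasible r y) → I.IsApproxAt ε r x

/-- The scaled profit of item `i` on the profit level `q`. -/
def scaled (m q : ℕ) (i : Fin n) : ℕ := I.p i * (n * m) / q

variable {I}

/-- Before rounding the scaled profit is at least `n * m`, and each of the at most `n` items loses
less than one unit. -/
theorem reach_of_le_profit {m q : ℕ} (hq : 0 < q) {y : Finset (Fin n)} (h : q ≤ I.profit y) :
    n * (m - 1) ≤ ∑ i ∈ y, I.scaled m q i := by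
  have h1 : ∑ i ∈ y, I.p i * (n * m) ≤ ∑ i ∈ y, q * (I.scaled m q i + 1) :=
    Finset.sum_le_sum fun i _ => (Nat.lt_mul_div_succ _ hq).le
  rw [← Finset.sum_mul, ← Finset.mul_sum, Finset.sum_add_distrib, Finset.sum_const, smul_eq_mul,
    mul_one] at h1
  have h2 : q * (n * m) ≤ q * (∑ i ∈ y, I.scaled m q i + y.card) :=
    (Nat.mul_le_mul_right _ h).trans h1
  have h3 := Nat.le_of_mul_le_mul_left h2 hq
  have h4 : y.card ≤ n := by simpa using Finset.card_le_univ y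
  rw [Nat.mul_sub_one]
  omega

/-- Rounding down never overstates a profit, so the demand can be converted back to the original
unit `q / (n * m)`. -/
theorem le_profit_of_reach {m q : ℕ} (hn : 0 < n) {y : Finset (Fin n)}
    (h : n * (m - 1) ≤ ∑ i ∈ y, I.scaled m q i) : q * (m - 1) ≤ I.profit y * m := by
  have h1 : ∑ i ∈ y, q * I.scaled m q i ≤ ∑ i ∈ y, I.p i * (n * m) :=
    Finset.sum_le_sum fun i _ => Nat.mul_div_le _ _
  rw [← Finset.sum_mul, ← Finset.mul_sum] at h1
  have h2 : n * (q * (m - 1)) ≤ n * (I.profit y * m) := by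
    have := Nat.mul_le_mul_left q h
    rw [profit]
    nlinarith
  exact Nat.le_of_mul_le_mul_left h2 hn

/-- A feasible set of large scaled profit on the level `r - r / m` is nearly optimal, if the optimal
profit is at most `r`. -/
theorem appr_of_reach {m r : ℕ} (hn : 0 < n) (hm : 1 ≤ m) (hε : 2 ≤ ε * m) {t : ℝ}
    {y : Finset (Fin n)} (hf : I.Feasible t y) (hr : I.optProfit t ≤ r)
    (h : n * (m - 1) ≤ ∑ i ∈ y, I.scaled m (r - r / m) i) : I.Appr ε t y := by
  intro _
  refine ⟨hf, ?_⟩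
  have h1 := le_profit_of_reach hn h
  have h2 : r * (m - 1) ≤ (r - r / m) * m := by
    rw [Nat.mul_sub_one, Nat.sub_mul]
    have := Nat.div_mul_le_self r m
    omega
  obtain ⟨m, rfl⟩ : ∃ m', m = m' + 1 := ⟨m - 1, by omega⟩
  simp only [Nat.add_sub_cancel] at h1 h2
  have h3 : r * m * m ≤ I.profit y * (m + 1) * (m + 1) :=
    (Nat.mul_le_mul_right m h2).trans (by nlinarith)
  have h3' : (r : ℝ) * m * m ≤ I.profit y * (m + 1) * (m + 1) := by exact_mod_cast h3
  have hr' : (I.optProfit t : ℝ) ≤ r := by exact_mod_cast hr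
  push_cast at hε
  have hp : (0 : ℝ) < (m + 1) * (m + 1) := by positivity
  -- For `ε ≥ 1` the left-hand side is not positive; below, `1 - ε` must be nonnegative in a product
  -- of inequalities.
  rcases le_or_gt 1 ε with h1 | h1
  · exact (mul_nonpos_of_nonpos_of_nonneg (by linarith) (by positivity)).trans (by positivity)
  refine le_of_mul_le_mul_right ?_ hp
  -- With the former `m` now written as `m + 1`, the assumption `2 ≤ ε * (m + 1)` gives `(1 - ε) (m
  -- + 1)² ≤ (m + 1)² - 2 (m + 1) < m²`.
  have h4 : (1 - ε) * ((m + 1) * (m + 1)) ≤ m * m := by nlinarith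
  calc (1 - ε) * (I.optProfit t : ℝ) * ((m + 1) * (m + 1))
      = (I.optProfit t : ℝ) * ((1 - ε) * ((m + 1) * (m + 1))) := by ring
    _ ≤ r * (m * m) := mul_le_mul hr' h4 (mul_nonneg (by linarith) hp.le) (by positivity)
    _ ≤ I.profit y * ((m + 1) * (m + 1)) := by linarith

/-- Profits are positive, so where the optimum is `0` no set but the empty one can be feasible. -/
theorem appr_empty {t : ℝ} (h : I.optProfit t ≤ 0) : I.Appr ε t ∅ := by
  rintro ⟨y, hy⟩
  have h1 : I.profit y = 0 := by
    by_contra hne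
    have := lt_optProfit_iff.mpr ⟨y, hy, Nat.pos_of_ne_zero hne⟩
    omega
  have h2 : y = ∅ := by
    refine Finset.eq_empty_of_forall_notMem fun i hi => ?_
    have := (Finset.sum_eq_zero_iff.mp h1) i hi
    exact (I.p_pos i).ne' this
  subst h2
  refine ⟨hy, ?_⟩
  have : I.optProfit t = 0 := by omega
  simp [this]

variable (I)

/-- Every set of scaled profit at least `T` is infeasible at `f / g`, or it fills the knapsack exactly
at `f / g` and is infeasible to the right of this point. -/
def Tight (σ : ℤ) (w : Fin n → ℕ) (T : ℕ) (f g : ℤ) : Prop :=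
  ∀ z : Finset (Fin n), T ≤ ∑ i ∈ z, w i → g * I.W < g * I.base z + f * I.slope σ z ∨
    (g * I.W = g * I.base z + f * I.slope σ z ∧ 0 < I.slope σ z)

variable {I}

/-- The weight of `z` is linear in the parameter and at least `W` at both frontiers. If its slope is
nonzero, it exceeds `W` strictly inside; if the slope is zero, tightness rules out equality with
`W`. -/
theorem not_feasible_of_tight {w : Fin n → ℕ} {T : ℕ} {f g f' g' : ℤ} (hg : 0 < g) (hg' : 0 < g')
    (h : I.Tight 1 w T f g) (h' : I.Tight (-1) w T f' g') {t : ℝ} (ht : (f / g : ℝ) < t)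
    (ht' : t < -(f' / g' : ℝ)) {z : Finset (Fin n)} (hz : T ≤ ∑ i ∈ z, w i) : ¬ I.Feasible t z := by
  have e : I.slope (-1) z = - I.slope 1 z := by simp [slope]
  have hgr : (0 : ℝ) < g := by exact_mod_cast hg
  have hgr' : (0 : ℝ) < g' := by exact_mod_cast hg'
  rw [div_lt_iff₀ hgr] at ht
  rw [lt_neg, div_lt_iff₀ hgr'] at ht'
  intro hf
  have hf' : (I.base z : ℝ) + t * I.slope 1 z ≤ I.W := by
    rw [← feasible_iff]
    simpa using hf
  have h1 : (g : ℝ) * I.W ≤ g * I.base z + f * I.slope 1 z := by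
    rcases h z hz with h1 | ⟨h1, -⟩
    · exact_mod_cast h1.le
    · exact_mod_cast h1.le
  have h2 : (g' : ℝ) * I.W ≤ g' * I.base z - f' * I.slope 1 z := by
    have : g' * I.W ≤ g' * I.base z - f' * I.slope 1 z := by
      have := h' z hz
      rw [e] at this
      rcases this with h1 | ⟨h1, -⟩ <;> linarith
    exact_mod_cast this
  rcases lt_trichotomy (I.slope 1 z) 0 with hs | hs | hs
  · have hs' : (I.slope 1 z : ℝ) < 0 := by exact_mod_cast hs
    nlinarith
  · rcases h z hz with h3 | ⟨-, h3⟩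
    · rw [hs] at h3 hf'
      have h4 : (g : ℝ) * I.W < g * I.base z := by
        have : g * I.W < g * I.base z := by linarith
        exact_mod_cast this
      have := lt_of_mul_lt_mul_left h4 hgr.le
      simp at hf'
      norm_cast at hf' this
      omega
    · omega
  · have hs' : (0 : ℝ) < I.slope 1 z := by exact_mod_cast hs
    nlinarith

/-- This is what allows the profit level to drop: a feasible set of profit at least `q` would meet
the demand. -/
theorem optProfit_le_of_tight {m q : ℕ} (hq : 0 < q) {f g f' g' : ℤ} (hg : 0 < g) (hg' : 0 < g')
    (h : I.Tight 1 (I.scaled m q) (n * (m - 1)) f g)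
    (h' : I.Tight (-1) (I.scaled m q) (n * (m - 1)) f' g') {t : ℝ} (ht : (f / g : ℝ) < t)
    (ht' : t < -(f' / g' : ℝ)) : I.optProfit t ≤ q - 1 := by
  by_contra! hlt
  obtain ⟨y, hy, hp⟩ := lt_optProfit_iff.mp hlt
  exact not_feasible_of_tight hg hg' h h' ht ht' (reach_of_le_profit hq (by omega)) hy

end Problem

/-- A list of breakpoints `num i / den i`, each with an item set. -/
structure Stack (n : ℕ) where
  k : ℕ
  num : ℕ → ℤ
  den : ℕ → ℤ
  set : ℕ → Finset (Fin n)

namespace Stack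

variable (K : Stack n)

/-- The breakpoints. -/
noncomputable def pt (i : ℕ) : ℝ := K.num i / K.den i

/-- Add a breakpoint. -/
def push (f g : ℤ) (x : Finset (Fin n)) : Stack n where
  k := K.k + 1
  num := Function.update K.num K.k f
  den := Function.update K.den K.k g
  set := Function.update K.set K.k x

theorem pt_push_of_lt {f g : ℤ} {x : Finset (Fin n)} {i : ℕ} (hi : i < K.k) :
    (K.push f g x).pt i = K.pt i := by
  simp [pt, push, Function.update_of_ne hi.ne]

theorem pt_push_self {f g : ℤ} {x : Finset (Fin n)} : (K.push f g x).pt K.k = f / g := by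
  simp [pt, push]

/-- The breakpoints in `K` solve the problem on the side `σ` up to the frontier `f / g`. -/
structure Front (K : Stack n) (I : Problem n) (ε : ℝ) (σ f g : ℤ) : Prop where
  g_pos : 0 < g
  f_le : |f| ≤ I.size + 2
  g_le : g ≤ I.size + 1
  g_le_M : g ≤ max 1 I.M
  den_pos : ∀ i < K.k, 0 < K.den i
  bound : ∀ i < K.k, |K.pt i| ≤ I.size
  mono : ∀ i j, i < j → j < K.k → K.pt i < K.pt j
  le : ∀ i < K.k, K.pt i ≤ f / g
  last : (f = -(I.size + 2) ∧ g = 1) ∨ ∃ i < K.k, (f / g : ℝ) = K.pt i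
  appr : ∀ i < K.k, ∀ t : ℝ, -((I.size : ℝ) + 2) < t → (∀ j < i, K.pt j < t) → t ≤ K.pt i →
    I.Appr ε (σ * t) (K.set i)

variable {K}

theorem Front.lt_of_forall {I : Problem n} {ε : ℝ} {σ f g : ℤ} (h : K.Front I ε σ f g) {t : ℝ}
    (h1 : -((I.size : ℝ) + 2) < t) (h2 : ∀ j < K.k, K.pt j < t) : (f / g : ℝ) < t := by
  rcases h.last with ⟨rfl, rfl⟩ | ⟨i, hi, h3⟩
  · push_cast
    simpa using h1
  · rw [h3]
    exact h2 i hi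

/-- All size bounds follow from the new breakpoint being `(W - base) / slope` with an integral slope
of at least `1`. The new set only has to work beyond the old frontier, since by `Front.lt_of_forall`
this is where the points beyond all old breakpoints lie. -/
theorem Front.push {I : Problem n} {ε : ℝ} {σ f g : ℤ} (hσ : |σ| = 1) (h : K.Front I ε σ f g)
    {f' g' : ℤ} {x : Finset (Fin n)} (hf' : f' = I.W - I.base x) (hg' : g' = I.slope σ x)
    (hpos : 0 < g') (hlt : (f / g : ℝ) < f' / g')
    (hx : ∀ t : ℝ, (f / g : ℝ) < t → t ≤ f' / g' → I.Appr ε (σ * t) x) :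
    (K.push f' g' x).Front I ε σ f' g' := by
  have hgr : (0 : ℝ) < g' := by exact_mod_cast hpos
  have hWb : |f'| ≤ I.size := by
    have h1 := I.abs_base_add_le x
    have h2 := abs_sub I.W (I.base x)
    rw [hf']
    linarith
  have hk : ∀ {i}, i < (K.push f' g' x).k → i < K.k ∨ i = K.k := fun hi =>
    Nat.lt_succ_iff_lt_or_eq.mp hi
  refine ⟨hpos, by linarith, ?_, ?_, ?_, ?_, ?_, ?_, ?_, ?_⟩
  · have := (abs_le.mp (I.abs_slope_le hσ x)).2
    omega
  · have := (abs_le.mp (Problem.abs_slope_le_M hσ (I := I) x)).2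
    rw [← hg'] at this
    push_cast
    exact this.trans (le_max_right _ _)
  · intro i hi
    rcases hk hi with hi | rfl
    · simpa [Stack.push, Function.update_of_ne hi.ne] using h.den_pos i hi
    · simpa [Stack.push] using hpos
  · intro i hi
    rcases hk hi with hi | rfl
    · rw [pt_push_of_lt K hi]
      exact h.bound i hi
    · rw [pt_push_self, abs_div, abs_of_pos hgr, div_le_iff₀ hgr]
      have h1 : |(f' : ℝ)| ≤ I.size := by exact_mod_cast hWb
      have h2 : (1 : ℝ) ≤ g' := by exact_mod_cast hpos
      nlinarith [abs_nonneg (f' : ℝ)]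
  · intro i j hij hj
    rcases hk hj with hj | rfl
    · rw [pt_push_of_lt K hj, pt_push_of_lt K (hij.trans hj)]
      exact h.mono i j hij hj
    · rw [pt_push_self, pt_push_of_lt K hij]
      exact (h.le i hij).trans_lt hlt
  · intro i hi
    rcases hk hi with hi | rfl
    · rw [pt_push_of_lt K hi]
      exact (h.le i hi).trans hlt.le
    · rw [pt_push_self]
  · exact Or.inr ⟨K.k, by simp [Stack.push], (K.pt_push_self).symm⟩
  · intro i hi t h1 h2 h3
    rcases hk hi with hi | rfl
    · rw [pt_push_of_lt K hi] at h3
      have := h.appr i hi t h1 (fun j hj => by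
        rw [← pt_push_of_lt K (hj.trans hi)]
        exact h2 j hj) h3
      simpa [Stack.push, Function.update_of_ne hi.ne] using this
    · rw [pt_push_self] at h3
      have := hx t (h.lt_of_forall h1 fun j hj => by
        rw [← pt_push_of_lt K hj]
        exact h2 j hj) h3
      simpa [Stack.push] using this

end Stack
end ParamKnapsack

namespace ParamKnapsack
open _root_.ParamKnapsack.Expr

variable {N n : ℕ}

/-! ### One step from each side as a program -/

/-- The orientation of a side: `false` sweeps upwards and `true` sweeps downwards. -/
def orient : Bool → ℤ
  | false => 1
  | true => -1

/-- The register with the number of breakpoints on a side. -/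
def countReg : Bool → ℕ
  | false => 13
  | true => 14

/-- The register with the numerator of the frontier of a side. -/
def numReg : Bool → ℕ
  | false => 15
  | true => 16

/-- The register with the denominator of the frontier of a side. -/
def denReg : Bool → ℕ
  | false => 17
  | true => 18

/-- The array with the numerators of the breakpoints of a side. -/
def numArr : Bool → ℕ
  | false => 3
  | true => 10

/-- The array with the denominators of the breakpoints of a side. -/
def denArr : Bool → ℕ
  | false => 4
  | true => 11

/-- The array that tells to which interval the breakpoints of a side belong. -/
def leftArr : Bool → ℕ
  | false => 5
  | true => 12

/-- The array with the item sets of a side. -/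
def setArr : Bool → ℕ
  | false => 6
  | true => 13

theorem abs_orient (d : Bool) : |orient d| = 1 := by cases d <;> rfl

/-- The set that is held in the array `src` solves the problem on the whole gap. -/
def closeGap (src : ℕ) : Prog :=
  Prog.assign 26 (const 0) ;; Prog.assign 27 (const 0) ;; copyRow 16 src ;; Prog.assign 11 (const 1)

/-- Add the breakpoint `reg 20 / reg 21` with the set in array `19`. -/
def advance (d : Bool) : Prog :=
  Prog.put (numArr d) (reg (countReg d)) (reg 20) ;;
  Prog.put (denArr d) (reg (countReg d)) (reg 21) ;;
  Prog.put (leftArr d) (reg (countReg d)) (const 1) ;;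
  Prog.assign 26 (mul (reg (countReg d)) (reg 0)) ;; Prog.assign 27 (const 0) ;;
  copyRow (setArr d) 19 ;;
  Prog.assign (countReg d) (add (reg (countReg d)) (const 1)) ;;
  Prog.assign (numReg d) (reg 20) ;; Prog.assign (denReg d) (reg 21)

/-- One application of the Newton method to a side. -/
def side (d : Bool) : Prog :=
  Prog.iteLE (reg 11) (const 0)
    (Prog.assign 20 (reg (numReg d)) ;; Prog.assign 21 (reg (denReg d)) ;; newton (orient d) ;;
    Prog.iteLE (mul (reg 20) (reg (denReg d))) (mul (reg (numReg d)) (reg 21)) Prog.skip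
      (Prog.iteLE (sub (const 0) (mul (reg (numReg !d)) (reg 21)))
        (mul (reg 20) (reg (denReg !d))) (closeGap 19) (advance d)) ;;
    Prog.iteLE (reg 11) (const 0)
      (Prog.iteLE (mul (sub (reg 33) (const 2)) (sub (reg 33) (const 2))) (const 0)
        (closeGap 22) Prog.skip)
      Prog.skip)
    Prog.skip

/-- The stack `K` is held in the memory. -/
structure Stack.Rep (K : Stack n) (d : Bool) (s : Store) : Prop where
  count : s.reg (countReg d) = K.k
  num : ∀ i < K.k, s.arr (numArr d) i = K.num i
  den : ∀ i < K.k, s.arr (denArr d) i = K.den i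
  left : ∀ i < K.k, s.arr (leftArr d) i = 1
  set : ∀ i < K.k, ∀ j : Fin n, s.arr (setArr d) (i * n + j) = if j ∈ K.set i then 1 else 0

theorem Stack.Rep.congr {K : Stack n} {d : Bool} {s s' : Store} (h : K.Rep d s)
    (hr : s'.reg (countReg d) = s.reg (countReg d))
    (ha : ∀ v, v = numArr d ∨ v = denArr d ∨ v = leftArr d ∨ v = setArr d →
      ∀ i, s'.arr v i = s.arr v i) : K.Rep d s' := by
  refine ⟨hr.trans h.count, fun i hi => ?_, fun i hi => ?_, fun i hi => ?_, fun i hi j => ?_⟩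
  · rw [ha _ (by simp), h.num i hi]
  · rw [ha _ (by simp), h.den i hi]
  · rw [ha _ (by simp), h.left i hi]
  · rw [ha _ (by simp), h.set i hi]

theorem closeGap_spec (hN : 4 ≤ N) {src : ℕ} (hsrc : src ≠ 16) {s : Store} (hb : s.Bdd N)
    (hn : s.reg 0 = n) (hnN : n ≤ N) {x : Finset (Fin n)}
    (hx : ∀ j : Fin n, s.arr src j = if j ∈ x then 1 else 0) :
    Tri N (closeGap src) s (20 * n + 20) fun s' =>
      (∀ x, x ≠ 11 → x < 26 → s'.reg x = s.reg x) ∧ s'.reg 11 = 1 ∧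
      (∀ v ≠ 16, ∀ l, s'.arr v l = s.arr v l) ∧
      ∀ j : Fin n, s'.arr 16 j = if j ∈ x then 1 else 0 := by
  refine Tri.assign_seq hN hb (by decide) (by simp [Ok]) (z := 0) (by simp [eval])
    (by simp) fun hb => ?_
  refine Tri.assign_seq hN hb (by decide) (by simp [Ok]) (z := 0) (by simp [eval])
    (by simp) fun hb => ?_
  refine Tri.seq _ (copyRow_spec hN hsrc hb (n := n) (d := 0) (r := 0) (by simp [hn]) hnN
    (by simp) (by simp)) ?_
  rintro s₁ hb ⟨h1, h2, h3, -⟩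
  refine Tri.assign hN hb (by decide) (by simp [Ok]) (z := 1) (by simp [eval]) (by simp; omega)
    (by simp only [cost]; omega) ⟨?_, by simp, ?_, ?_⟩
  · intro x hx hx'
    simp [hx, h1 x (by omega), show x ≠ 26 by omega, show x ≠ 27 by omega]
  · intro v hv l
    simp [h2 v hv l]
  · intro j
    have := h3 j j.2
    simp only [zero_add] at this
    rw [← hx j]
    simpa using this

theorem advance_spec (hN : 4 ≤ N) {d : Bool} {K : Stack n} {s : Store} (hb : s.Bdd N)
    (hn : s.reg 0 = n) (hK : K.Rep d s) (hkN : (K.k + 1) * (n + 1) ≤ N) {x : Finset (Fin n)}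
    (hx : ∀ j : Fin n, s.arr 19 j = if j ∈ x then 1 else 0) :
    Tri N (advance d) s (20 * n + 60) fun s' =>
      (∀ x < 26, x ≠ countReg d → x ≠ numReg d → x ≠ denReg d → s'.reg x = s.reg x) ∧
      s'.reg 33 = s.reg 33 ∧ s'.reg (numReg d) = s.reg 20 ∧ s'.reg (denReg d) = s.reg 21 ∧
      (∀ v, v ≠ numArr d → v ≠ denArr d → v ≠ leftArr d → v ≠ setArr d →
        ∀ l, s'.arr v l = s.arr v l) ∧ (K.push (s.reg 20) (s.reg 21) x).Rep d s' := by
  have hk1 : K.k + 1 ≤ N := (Nat.le_mul_of_pos_right _ (by omega)).trans hkN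
  have hk2 : (K.k + 1) * n ≤ N := (Nat.mul_le_mul_left _ (by omega)).trans hkN
  have hk3 : K.k * n + n ≤ N := by rwa [Nat.succ_mul] at hk2
  have h20 := hb.1 20
  have h21 := hb.1 21
  have hrow : ∀ {i : ℕ}, i < K.k → ∀ j : Fin n, i * n + j < K.k * n := fun {i} h j =>
    (by rw [Nat.succ_mul]; omega : i * n + j < (i + 1) * n).trans_le (Nat.mul_le_mul_right n h)
  obtain ⟨g1, g2, g3, g4, g5⟩ := hK
  cases d
  all_goals
    simp only [advance, countReg, numReg, denReg, numArr, denArr, leftArr, setArr] at *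
    refine Tri.put_seq hN hb (by simp [deg]) (by simp [deg]) (by simp [Ok]) (by simp [Ok])
      (j := K.k) (by simp [eval, g1]) (z := s.reg 20) (by simp [eval]) h20 fun hb => ?_
    refine Tri.put_seq hN hb (by simp [deg]) (by simp [deg]) (by simp [Ok]) (by simp [Ok])
      (j := K.k) (by simp [eval, g1]) (z := s.reg 21) (by simp [eval]) h21 fun hb => ?_
    refine Tri.put_seq hN hb (by simp [deg]) (by simp [deg]) (by simp [Ok]) (by simp [Ok])
      (j := K.k) (by simp [eval, g1]) (z := 1) (by simp [eval]) (by simp; omega) fun hb => ?_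
    refine Tri.assign_seq hN hb (by simp [deg]) (by simp [Ok]) (z := (K.k * n : ℕ))
      (by simp [eval, g1, hn]) (by rw [Nat.abs_cast]; omega) fun hb => ?_
    refine Tri.assign_seq hN hb (by decide) (by simp [Ok]) (z := 0) (by simp [eval])
      (by simp) fun hb => ?_
    refine Tri.seq _ (copyRow_spec hN (by norm_num) hb (n := n) (d := K.k * n) (r := 0)
      (by simp [hn]) (by omega) (by simp) (by simp)) ?_
    rintro s₁ hb ⟨r1, r2, r3, r4⟩
    have f20 : s₁.reg 20 = s.reg 20 := by rw [r1 20 (by norm_num)]; simp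
    have f21 : s₁.reg 21 = s.reg 21 := by rw [r1 21 (by norm_num)]; simp
    refine Tri.assign_seq hN hb (by simp [deg]) (by simp [Ok]) (z := (K.k + 1 : ℕ))
      (by simp [eval, r1, g1]) (by rw [Nat.abs_cast]; omega) fun hb => ?_
    refine Tri.assign_seq hN hb (by simp [deg]) (by simp [Ok]) (z := s.reg 20)
      (by simp [eval, f20]) h20 fun hb => ?_
    refine Tri.assign hN hb (by simp [deg]) (by simp [Ok]) (z := s.reg 21)
      (by simp [eval, f21]) h21 (by simp only [cost]; omega) ?_
    refine ⟨?_, by simp [r1], by simp, by simp, ?_, ⟨by simp [Stack.push, countReg], ?_, ?_, ?_, ?_⟩⟩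
    · intro x hx hx1 hx2 hx3
      simp [hx1, hx2, hx3, r1 x (by omega), show x ≠ 26 by omega, show x ≠ 27 by omega]
    · intro v hv1 hv2 hv3 hv4 l
      simp [hv1, hv2, hv3, r2 v hv4]
    · intro i hi
      rcases Nat.lt_succ_iff_lt_or_eq.mp hi with hi | rfl
      · simp [numArr, r2, Stack.push, hi.ne, g2 i hi]
      · simp [numArr, r2, Stack.push]
    · intro i hi
      rcases Nat.lt_succ_iff_lt_or_eq.mp hi with hi | rfl
      · simp [denArr, r2, Stack.push, hi.ne, g3 i hi]
      · simp [denArr, r2, Stack.push]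
    · intro i hi
      rcases Nat.lt_succ_iff_lt_or_eq.mp hi with hi | rfl
      · simp [leftArr, r2, hi.ne, g4 i hi]
      · simp [leftArr, r2]
    · intro i hi j
      rcases Nat.lt_succ_iff_lt_or_eq.mp hi with hi | rfl
      · have := r4 (i * n + j) (Or.inl (hrow hi j))
        simp [setArr, Stack.push, hi.ne, this, g5 i hi]
      · have := r3 j j.2
        simp [setArr, Stack.push, this, hx]

end ParamKnapsack

/-! ### Correctness of a step from one side -/

namespace ParamKnapsack
open _root_.ParamKnapsack.Expr

variable {N n : ℕ}

/-- The input, the parameters and the scaled profits are the same. -/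
def Store.Frame (s s' : Store) : Prop :=
  (∀ x, x < 11 ∨ x = 12 → s'.reg x = s.reg x) ∧ ∀ v, v < 3 ∨ v = 18 → ∀ l, s'.arr v l = s.arr v l

theorem Store.Frame.trans {s s' s'' : Store} (h : s.Frame s') (h' : s'.Frame s'') : s.Frame s'' :=
  ⟨fun x hx => (h'.1 x hx).trans (h.1 x hx), fun v hv l => (h'.2 v hv l).trans (h.2 v hv l)⟩

theorem Store.Frame.of_same {s s' : Store} (h : Store.Same 19 19 s s') : s.Frame s' :=
  ⟨fun x hx => h.1 x (by omega), fun v hv l => h.2 v (by omega) l⟩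

theorem Problem.Env.frame {I : Problem n} {w : Fin n → ℕ} {T : ℕ} {s s' : Store}
    (h : I.Env w T s) (hs : s.Frame s') : I.Env w T s' where
  n_eq := by rw [hs.1 _ (by norm_num), h.n_eq]
  W_eq := by rw [hs.1 _ (by norm_num), h.W_eq]
  size_eq := by rw [hs.1 _ (by norm_num), h.size_eq]
  T_eq := by rw [hs.1 _ (by norm_num), h.T_eq]
  Z_eq := by rw [hs.1 _ (by norm_num), h.Z_eq]
  a_eq i := by rw [hs.2 _ (by norm_num), h.a_eq]
  b_eq i := by rw [hs.2 _ (by norm_num), h.b_eq]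
  w_eq i := by rw [hs.2 _ (by norm_num), h.w_eq]

/-- The parameter values between the frontiers. -/
def Store.Gap (s : Store) (t : ℝ) : Prop :=
  (s.reg (numReg false) / s.reg (denReg false) : ℝ) < t ∧
    t < -(s.reg (numReg true) / s.reg (denReg true) : ℝ)

/-- In the coordinate of the side `d` the gap always starts at the frontier of `d`; this lets one
proof cover both sweeps. -/
theorem Store.gap_orient {s : Store} {t : ℝ} (d : Bool) : s.Gap (orient d * t) ↔
    (s.reg (numReg d) / s.reg (denReg d) : ℝ) < t ∧
      t < -(s.reg (numReg !d) / s.reg (denReg !d) : ℝ) := by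
  cases d
  · simp [Gap, orient]
  · simp only [Gap, orient, Bool.not_true, Int.cast_neg, Int.cast_one, neg_mul, one_mul]
    rw [neg_lt_neg_iff, and_comm, lt_neg]

theorem orient_mul_self (d : Bool) (t : ℝ) : (orient d : ℝ) * (orient d * t) = t := by
  cases d <;> simp [orient]

/-- Everything outside of the gap between the frontiers is solved; in the gap, the optimal profit is
at most `r`, or a single item set solves it. -/
structure Problem.Sweep (I : Problem n) (ε : ℝ) (r : ℕ) (K : Bool → Stack n) (s : Store) :
    Prop where
  rep : ∀ d, (K d).Rep d s
  front : ∀ d, (K d).Front I ε (orient d) (s.reg (numReg d)) (s.reg (denReg d))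
  gap : ∀ d, s.reg (numReg d) * s.reg (denReg !d) + s.reg (numReg !d) * s.reg (denReg d) < 0
  mid : (s.reg 11 = 0 ∧ (∀ j : Fin n, s.arr 16 j = 0) ∧ ∀ t, s.Gap t → I.optProfit t ≤ r) ∨
    (s.reg 11 = 1 ∧ ∃ x : Finset (Fin n), (∀ j : Fin n, s.arr 16 j = if j ∈ x then 1 else 0) ∧
      ∀ t, s.Gap t → I.Appr ε t x)

namespace Problem

variable {I : Problem n} {ε : ℝ} {r : ℕ} {K : Bool → Stack n} {s s' : Store}

theorem Sweep.congr {r' : ℕ} (h : I.Sweep ε r K s) (hr : ∀ x, 13 ≤ x → x < 19 → s'.reg x = s.reg x)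
    (ha : ∀ v, v < 16 → ∀ l, s'.arr v l = s.arr v l)
    (hm : (s'.reg 11 = 0 ∧ (∀ j : Fin n, s'.arr 16 j = 0) ∧ ∀ t, s.Gap t → I.optProfit t ≤ r') ∨
    (s'.reg 11 = 1 ∧ ∃ x : Finset (Fin n), (∀ j : Fin n, s'.arr 16 j = if j ∈ x then 1 else 0) ∧
      ∀ t, s.Gap t → I.Appr ε t x)) : I.Sweep ε r' K s' := by
  have hn : ∀ d, s'.reg (numReg d) = s.reg (numReg d) := fun d =>
    hr _ (by cases d <;> decide) (by cases d <;> decide)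
  have hd : ∀ d, s'.reg (denReg d) = s.reg (denReg d) := fun d =>
    hr _ (by cases d <;> decide) (by cases d <;> decide)
  have hg : s'.Gap = s.Gap := by
    funext t
    simp only [Store.Gap, hn, hd]
  refine ⟨fun d => (h.rep d).congr (hr _ (by cases d <;> decide) (by cases d <;> decide))
    fun v hv => ha v ?_, fun d => ?_, fun d => ?_, ?_⟩
  · rcases hv with rfl | rfl | rfl | rfl <;> cases d <;> decide
  · rw [hn, hd]
    exact h.front d
  · rw [hn, hd, hn, hd]
    exact h.gap d
  · rwa [hg]

theorem Sweep.gap_lt (h : I.Sweep ε r K s) (d : Bool) :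
    (s.reg (numReg d) / s.reg (denReg d) : ℝ) < -(s.reg (numReg !d) / s.reg (denReg !d) : ℝ) := by
  have h1 : (0 : ℝ) < s.reg (denReg d) := by exact_mod_cast (h.front d).g_pos
  have h2 : (0 : ℝ) < s.reg (denReg !d) := by exact_mod_cast (h.front !d).g_pos
  have h3 : (s.reg (numReg d) * s.reg (denReg !d) + s.reg (numReg !d) * s.reg (denReg d) : ℝ) < 0 := by
    exact_mod_cast h.gap d
  rw [← neg_div, div_lt_div_iff₀ h1 h2]
  linarith

end Problem

/-- The outcome of the program `side d`. -/
structure Problem.SidePost (I : Problem n) (ε : ℝ) (r : ℕ) (w : Fin n → ℕ) (T : ℕ) (d : Bool)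
    (K : Bool → Stack n) (s s' : Store) : Prop where
  frame : s.Frame s'
  sweep : ∃ K', I.Sweep ε r K' s' ∧ (K' d).k ≤ (K d).k + 1 ∧ K' (!d) = K !d
  num : s'.reg (numReg !d) = s.reg (numReg !d)
  den : s'.reg (denReg !d) = s.reg (denReg !d)
  fin : s'.reg 11 = 0 → s.reg 11 = 0
  tight : s'.reg 11 = 0 → I.Tight (orient d) w T (s'.reg (numReg d)) (s'.reg (denReg d))

/-- The choice that `side d` makes after the Newton method. -/
theorem side_choice (hN : 4 ≤ N) {I : Problem n} {ε : ℝ} {m r : ℕ} (hn : 0 < n) (hm : 1 ≤ m)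
    (hε : 2 ≤ ε * m) {d : Bool} {K : Bool → Stack n} {s s₁ : Store} (hb : s₁.Bdd N)
    (hn0 : s₁.reg 0 = n) (h : I.Sweep ε r K s) (h11 : s.reg 11 = 0)
    (hkN : ((K d).k + 1) * (n + 1) ≤ N) (hs : Store.Same 19 19 s s₁) (hg : 0 < s₁.reg 21)
    (hP : I.NewtonPost (orient d) (I.scaled m (r - r / m)) (n * (m - 1))
      (s.reg (numReg d)) (s.reg (denReg d)) s₁) :
    Tri N (Prog.iteLE (mul (reg 20) (reg (denReg d))) (mul (reg (numReg d)) (reg 21)) Prog.skip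
      (Prog.iteLE (sub (const 0) (mul (reg (numReg !d)) (reg 21)))
        (mul (reg 20) (reg (denReg !d))) (closeGap 19) (advance d))) s₁ (20 * n + 80) fun s' =>
      s.Frame s' ∧ (∃ K', I.Sweep ε r K' s' ∧ (K' d).k ≤ (K d).k + 1 ∧ K' (!d) = K !d) ∧
      s'.reg (numReg !d) = s.reg (numReg !d) ∧ s'.reg (denReg !d) = s.reg (denReg !d) ∧
      (s'.reg 11 = 0 → s'.reg (numReg d) = s₁.reg 20 ∧ s'.reg (denReg d) = s₁.reg 21 ∧
        s'.reg 33 = s₁.reg 33 ∧ ∀ l, s'.arr 22 l = s₁.arr 22 l) := by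
  have hnN : n ≤ N := by
    have := (Nat.le_mul_of_pos_left (n + 1) (Nat.succ_pos (K d).k)).trans hkN
    omega
  have l1 : ∀ d, numReg d < 19 := fun d => by cases d <;> decide
  have l2 : ∀ d, denReg d < 19 := fun d => by cases d <;> decide
  have l3 : ∀ d, countReg d < 19 := fun d => by cases d <;> decide
  have hSw : I.Sweep ε r K s₁ := h.congr (fun x _ hx => hs.1 x hx)
    (fun v hv => hs.2 v (by omega)) (by
      rw [hs.1 11 (by norm_num)]
      simp only [hs.2 16 (by norm_num)]
      exact h.mid)
  have h11' : s₁.reg 11 = 0 := by rw [hs.1 11 (by norm_num), h11]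
  have hmid : ∀ t, s₁.Gap t → I.optProfit t ≤ r := by
    rcases hSw.mid with h | h
    · exact h.2.2
    · omega
  have hl := hP.left
  rw [← hs.1 _ (l1 d), ← hs.1 _ (l2 d)] at hl
  have hG := (hSw.front d).g_pos
  have hG' := (hSw.front !d).g_pos
  refine Tri.ite hN hb (by simp [deg]) (by simp [deg]) (by simp [Ok]) (by simp [Ok]) (fun hc => ?_)
    (fun hc => ?_)
  · simp only [eval] at hc
    rcases hl with ⟨e1, e2⟩ | ⟨hlt, -⟩
    · exact Tri.skip hb ⟨Store.Frame.of_same hs, ⟨K, hSw, by omega, rfl⟩, hs.1 _ (l1 _),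
        hs.1 _ (l2 _), fun _ => ⟨e1.symm, e2.symm, rfl, fun _ => rfl⟩⟩ (by simp only [cost]; omega)
    · omega
  simp only [eval] at hc
  rcases hl with ⟨e1, e2⟩ | ⟨hlt, x, hx, hreach, hsl, hf, hg'⟩
  · rw [e1, e2] at hc
    omega
  have hgr : (0 : ℝ) < s₁.reg 21 := by exact_mod_cast hg
  have hGr : (0 : ℝ) < s₁.reg (denReg d) := by exact_mod_cast hG
  have hGr' : (0 : ℝ) < s₁.reg (denReg !d) := by exact_mod_cast hG'
  have hlt' : (s₁.reg (numReg d) / s₁.reg (denReg d) : ℝ) < s₁.reg 20 / s₁.reg 21 := by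
    rw [div_lt_div_iff₀ hGr hgr]
    exact_mod_cast hlt
  -- The slope of `x` is positive and the new root is where `x` fills the knapsack, so `x` is
  -- feasible up to the root; approximation then comes from the bound `r` in the gap.
  have happr : ∀ t : ℝ, t ≤ s₁.reg 20 / s₁.reg 21 → s₁.Gap (orient d * t) →
      I.Appr ε (orient d * t) x := by
    intro t ht hgap
    refine Problem.appr_of_reach hn hm hε ((I.feasible_iff _ _ _).mpr ?_) (hmid _ hgap) hreach
    rw [le_div_iff₀ hgr, hf, hg'] at ht
    push_cast at ht
    linarith
  refine Tri.ite hN hb (by simp [deg]) (by simp [deg]) (by simp [Ok]) (by simp [Ok]) (fun hc' => ?_)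
    (fun hc' => ?_)
  -- The root reaches or passes the opposite frontier, so `x` serves the whole gap and no breakpoint
  -- is needed.
  · simp only [eval] at hc'
    refine Tri.mono (closeGap_spec hN (by norm_num) hb hn0 hnN hx) (by simp only [cost]; omega) ?_
    rintro s₂ hb ⟨r1, r2, r3, r4⟩
    refine ⟨⟨fun v hv => ?_, fun v hv l => ?_⟩, ⟨K, hSw.congr (fun v hv hv' => r1 v (by omega)
      (by omega)) (fun v hv => r3 v (by omega)) (Or.inr ⟨r2, x, r4, fun t ht => ?_⟩), by omega, rfl⟩,
      ?_, ?_, by omega⟩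
    · rw [r1 v (by omega) (by omega), hs.1 v (by omega)]
    · rw [r3 v (by omega), hs.2 v (by omega)]
    · rw [← orient_mul_self d t] at ht ⊢
      refine happr _ (((Store.gap_orient d).mp ht).2.le.trans ?_) ht
      rw [← neg_div, div_le_div_iff₀ hGr' hgr]
      have : (-s₁.reg (numReg !d)) * s₁.reg 21 ≤ s₁.reg 20 * s₁.reg (denReg !d) := by linarith
      exact_mod_cast this
    · have := l1 !d
      rw [r1 _ (by cases d <;> decide) (by omega), hs.1 _ (l1 _)]
    · have := l2 !d
      rw [r1 _ (by cases d <;> decide) (by omega), hs.1 _ (l2 _)]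
  · simp only [eval] at hc'
    refine Tri.mono (advance_spec hN hb hn0 (hSw.rep d) hkN hx) (by simp only [cost]; omega) ?_
    rintro s₂ hb ⟨r1, r2, r3, r4, r5, r6⟩
    have n1 : ∀ x < 11 + 2, s₂.reg x = s₁.reg x := fun x hx =>
      r1 x (by omega) (by cases d <;> simp only [countReg] <;> omega)
        (by cases d <;> simp only [numReg] <;> omega) (by cases d <;> simp only [denReg] <;> omega)
    have n2 : ∀ v, v < 3 ∨ 14 ≤ v → ∀ l, s₂.arr v l = s₁.arr v l := fun v hv =>
      r5 v (by cases d <;> simp only [numArr] <;> omega)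
        (by cases d <;> simp only [denArr] <;> omega)
        (by cases d <;> simp only [leftArr] <;> omega)
        (by cases d <;> simp only [setArr] <;> omega)
    have n3 : s₂.reg (countReg !d) = s₁.reg (countReg !d) := by
      cases d <;> exact r1 _ (by decide) (by decide) (by decide) (by decide)
    have n4 : s₂.reg (numReg !d) = s₁.reg (numReg !d) := by
      cases d <;> exact r1 _ (by decide) (by decide) (by decide) (by decide)
    have n5 : s₂.reg (denReg !d) = s₁.reg (denReg !d) := by
      cases d <;> exact r1 _ (by decide) (by decide) (by decide) (by decide)
    have n6 : ∀ v, v = numArr (!d) ∨ v = denArr (!d) ∨ v = leftArr (!d) ∨ v = setArr (!d) →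
        ∀ l, s₂.arr v l = s₁.arr v l := by
      rintro v (rfl | rfl | rfl | rfl) <;>
        cases d <;> exact r5 _ (by decide) (by decide) (by decide) (by decide)
    have hgap' : s₁.reg 20 * s₁.reg (denReg !d) + s₁.reg (numReg !d) * s₁.reg 21 < 0 := by linarith
    refine ⟨⟨fun v hv => ?_, fun v hv l => ?_⟩, ⟨Function.update K d
      ((K d).push (s₁.reg 20) (s₁.reg 21) x), ⟨?_, ?_, ?_, Or.inl ⟨?_, ?_, ?_⟩⟩, ?_, ?_⟩,
      ?_, ?_, ?_⟩
    · rw [n1 v (by omega), hs.1 v (by omega)]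
    · rw [n2 v (by omega), hs.2 v (by omega)]
    · intro e
      rcases Bool.eq_or_eq_not e d with rfl | rfl
      · simpa using r6
      · rw [Function.update_of_ne (by simp)]
        exact (hSw.rep !d).congr n3 n6
    · intro e
      rcases Bool.eq_or_eq_not e d with rfl | rfl
      · rw [Function.update_self, r3, r4]
        refine (hSw.front e).push (abs_orient e) hf hg' hg hlt' fun t h1 h2 => happr t h2 ?_
        rw [Store.gap_orient]
        refine ⟨h1, h2.trans_lt ?_⟩
        rw [← neg_div, div_lt_div_iff₀ hgr hGr']
        have : s₁.reg 20 * s₁.reg (denReg !e) < (-s₁.reg (numReg !e)) * s₁.reg 21 := by linarith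
        exact_mod_cast this
      · rw [Function.update_of_ne (by simp), n4, n5]
        exact hSw.front !d
    · intro e
      rcases Bool.eq_or_eq_not e d with rfl | rfl
      · rw [n4, n5, r3, r4]
        exact hgap'
      · rw [Bool.not_not, n4, n5, r3, r4]
        linarith
    · rw [n1 11 (by norm_num), h11']
    · intro j
      rw [n2 16 (by norm_num), hs.2 16 (by norm_num)]
      rcases h.mid with h | h
      · exact h.2.1 j
      · omega
    · intro t ht
      refine hmid t ?_
      rw [← orient_mul_self d t] at ht ⊢
      rw [Store.gap_orient] at ht ⊢
      rw [n4, n5, r3, r4] at ht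
      exact ⟨hlt'.trans ht.1, ht.2⟩
    · simp [Stack.push]
    · rw [Function.update_of_ne (by simp)]
    · rw [n4, hs.1 _ (l1 _)]
    · rw [n5, hs.1 _ (l2 _)]
    · exact fun _ => ⟨r3, r4, r2, n2 22 (by norm_num)⟩

/-- If the Newton search ends at a feasible set of nonpositive slope, that set stays feasible
through the rest of the gap and closes it. If the gap is still open at the end, the other
alternative of `NewtonPost.right` supplies tightness. -/
theorem side_spec (hN : 4 ≤ N) {I : Problem n} {ε : ℝ} {m r : ℕ} (hn : 0 < n) (hm : 1 ≤ m)
    (hε : 2 ≤ ε * m) (d : Bool) {K : Bool → Stack n} {s : Store} (hb : s.Bdd N)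
    (hE : I.Env (I.scaled m (r - r / m)) (n * (m - 1)) s) (h : I.Sweep ε r K s)
    (hkN : ((K d).k + 1) * (n + 1) ≤ N) (hTN : n * (m - 1) + 1 ≤ N)
    (hSN : 160 * (I.size + 2) ^ 6 ≤ N) :
    Tri N (side d) s ((I.newtonBound + 3) * (600 * ((n + 1) * (n * (m - 1) + 1))))
      (I.SidePost ε r (I.scaled m (r - r / m)) (n * (m - 1)) d K s) := by
  have hnN : n ≤ N := by
    have := (Nat.le_mul_of_pos_left (n + 1) (Nat.succ_pos (K d).k)).trans hkN
    omega
  have hnT : n + 1 ≤ (n + 1) * (n * (m - 1) + 1) := Nat.le_mul_of_pos_right _ (by positivity)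
  have l1 : ∀ d, numReg d < 19 := fun d => by cases d <;> decide
  have l2 : ∀ d, denReg d < 19 := fun d => by cases d <;> decide
  rw [Nat.succ_mul (I.newtonBound + 2)]
  generalize hX : 600 * ((n + 1) * (n * (m - 1) + 1)) = X at *
  refine Tri.ite hN hb (by decide) (by decide) (by simp [Ok]) (by simp [Ok]) (fun hc => ?_)
    (fun hc => ?_)
  swap
  · simp only [eval] at hc
    have h1 : s.reg 11 = 1 := by
      rcases h.mid with h | h
      · omega
      · exact h.1
    exact Tri.skip hb ⟨⟨fun _ _ => rfl, fun _ _ _ => rfl⟩, ⟨K, h, by omega, rfl⟩, rfl, rfl,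
      fun h => h, fun h => by omega⟩ (by simp only [cost]; omega)
  have h11 : s.reg 11 = 0 := by
    simp only [eval] at hc
    rcases h.mid with h | h
    · exact h.1
    · omega
  have hF := h.front d
  refine Tri.assign_seq hN hb (by simp [deg]) (by simp [Ok]) (z := s.reg (numReg d)) (by simp [eval])
    (hb.1 _) fun hb' => ?_
  refine Tri.assign_seq hN hb' (by simp [deg]) (by simp [Ok]) (z := s.reg (denReg d))
    (by have := l2 d; simp [eval]; omega) (hb.1 _) fun hb => ?_
  have hs₀ := (((Store.Same.refl 19 19 s).setReg (x := 20) (by norm_num)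
    (s.reg (numReg d))).setReg (x := 21) (by norm_num) (s.reg (denReg d)))
  refine Tri.seq _ (newton_spec hN (abs_orient d) hb (hE.frame (Store.Frame.of_same hs₀)) (by simp)
    (by simp) hF.g_pos hF.g_le hF.g_le_M hF.f_le hnN hTN hSN) ?_
  rintro s₁ hb ⟨hs₁, hg, hP⟩
  replace hs₁ := hs₀.trans hs₁
  refine Tri.seq _ (side_choice hN hn hm hε hb (by rw [hs₁.1 0 (by norm_num), hE.n_eq]) h h11 hkN
    hs₁ hg hP) ?_
  rintro s₂ hb ⟨hfr, ⟨K', hK, hk, hk'⟩, c1, c2, c3⟩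
  have hn0 : s₂.reg 0 = n := (hE.frame hfr).n_eq
  rw [hX]
  generalize (I.newtonBound + 2) * X = Y at *
  refine Tri.ite hN hb (by decide) (by decide) (by simp [Ok]) (by simp [Ok]) (fun hc => ?_)
    (fun hc => ?_)
  swap
  · simp only [eval] at hc
    exact Tri.skip hb ⟨hfr, ⟨K', hK, hk, hk'⟩, c1, c2, fun _ => h11, fun h => by omega⟩
      (by simp only [cost]; omega)
  have h11' : s₂.reg 11 = 0 := by
    simp only [eval] at hc
    rcases hK.mid with h | h
    · exact h.1
    · omega
  obtain ⟨c3, c4, c5, c6⟩ := c3 h11'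
  have hmid : ∀ t, s₂.Gap t → I.optProfit t ≤ r := by
    rcases hK.mid with h | h
    · exact h.2.2
    · omega
  have hflag : (mul (sub (reg 33) (const 2)) (sub (reg 33) (const 2))).eval s₂
      ≤ (const 0 : Expr).eval s₂ ↔ s₁.reg 33 = 2 := by
    simp only [eval, c5]
    constructor
    · intro h
      by_contra hne
      have := mul_self_pos.mpr (sub_ne_zero.mpr hne)
      omega
    · intro h
      simp [h]
  refine Tri.ite hN hb (by decide) (by decide) (by simp [Ok]) (by simp [Ok]) (fun hc => ?_)
    (fun hc => ?_)
  · rw [hflag] at hc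
    rcases hP.right with ⟨-, y, hy, hreach, hy1, hy2⟩ | ⟨hne, -⟩
    swap
    · exact absurd hc hne
    refine Tri.mono (closeGap_spec hN (by norm_num : 22 ≠ 16) hb hn0 hnN (x := y)
      fun j => by rw [c6, hy]) (by simp only [cost]; omega) ?_
    rintro s₃ hb ⟨r1, r2, r3, r4⟩
    refine ⟨hfr.trans ⟨fun v hv => r1 v (by omega) (by omega), fun v hv l => r3 v (by omega) l⟩,
      ⟨K', hK.congr (fun v hv hv' => r1 v (by omega) (by omega)) (fun v hv => r3 v (by omega))
      (Or.inr ⟨r2, y, r4, fun t ht => ?_⟩), hk, hk'⟩, ?_, ?_, by omega, by omega⟩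
    · rw [← orient_mul_self d t] at ht ⊢
      refine Problem.appr_of_reach hn hm hε ((I.feasible_iff _ _ _).mpr ?_) (hmid _ ht) hreach
      have h1 := ((Store.gap_orient d).mp ht).1
      have hgr : (0 : ℝ) < s₁.reg 21 := by exact_mod_cast hg
      rw [c3, c4, div_lt_iff₀ hgr] at h1
      have h2 : (s₁.reg 21 * I.base y + s₁.reg 20 * I.slope (orient d) y : ℝ) ≤ s₁.reg 21 * I.W := by
        exact_mod_cast hy1
      have h3 : (I.slope (orient d) y : ℝ) ≤ 0 := by exact_mod_cast hy2
      nlinarith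
    · have := l1 !d
      rw [r1 _ (by cases d <;> decide) (by omega), c1]
    · have := l2 !d
      rw [r1 _ (by cases d <;> decide) (by omega), c2]
  · rw [hflag] at hc
    refine Tri.skip hb ⟨hfr, ⟨K', hK, hk, hk'⟩, c1, c2, fun _ => h11, fun _ => ?_⟩
      (by simp only [cost]; omega)
    rw [c3, c4]
    rcases hP.right with ⟨he, -⟩ | ⟨-, h⟩
    · exact absurd he hc
    · exact h

end ParamKnapsack

namespace ParamKnapsack

variable {n : ℕ}

/-! ### The answer -/

namespace Problem

variable {I : Problem n} {ε : ℝ}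

theorem Appr.congr {r r' : ℝ} {x : Finset (Fin n)} (h : I.Appr ε r x)
    (hf : ∀ y, I.Feasible r y ↔ I.Feasible r' y) : I.Appr ε r' x := by
  have ho : I.optProfit r = I.optProfit r' := by
    unfold optProfit
    congr 1
    ext y
    simp [hf]
  rintro ⟨y, hy⟩
  obtain ⟨h1, h2⟩ := h ⟨y, (hf y).mpr hy⟩
  exact ⟨(hf x).mp h1, ho ▸ h2⟩

/-- Beyond the size of the instance, the feasible sets do not depend on the parameter. -/
theorem feasible_iff_of_size_lt {σ : ℤ} {t : ℝ} (ht : (I.size : ℝ) + 1 ≤ t)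
    (y : Finset (Fin n)) : I.Feasible (σ * t) y ↔
      I.slope σ y < 0 ∨ (I.slope σ y = 0 ∧ I.base y ≤ I.W) := by
  rw [feasible_iff]
  have h1 : |I.W - I.base y| ≤ I.size := (abs_sub _ _).trans (I.abs_base_add_le y)
  have h2 : |(I.W : ℝ) - I.base y| ≤ I.size := by exact_mod_cast h1
  have h3 := abs_le.mp h2
  rcases lt_trichotomy (I.slope σ y) 0 with h | h | h
  · have h' : (I.slope σ y : ℝ) ≤ -1 := by exact_mod_cast (by omega : I.slope σ y ≤ -1)
    simp only [h, true_or, iff_true]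
    nlinarith
  · simp [h]
  · have h' : (1 : ℝ) ≤ I.slope σ y := by exact_mod_cast h
    simp only [h.not_gt, h.ne', false_and, or_false, iff_false, not_le]
    nlinarith

end Problem

namespace Stack

variable (K : Bool → Stack n) (x : Finset (Fin n))

/-- The breakpoints of both sides in increasing order; the set `x` belongs to the interval between the
sides. -/
def answer : Answer n where
  k := (K false).k + (K true).k
  bp i := if i.val < (K false).k then ((K false).num i / (K false).den i : ℚ)
    else -((K true).num ((K false).k + (K true).k - 1 - i) /
      (K true).den ((K false).k + (K true).k - 1 - i))
  left i := decide (i.val < (K false).k)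
  sol j := if j.val < (K false).k then (K false).set j
    else if j.val = (K false).k then x else (K true).set ((K false).k + (K true).k - j)

variable {K x}

theorem answer_bp_of_lt {i : Fin (answer K x).k} (hi : i.val < (K false).k) :
    ((answer K x).bp i : ℝ) = (K false).pt i := by
  simp [answer, pt, hi]

theorem answer_bp_of_le {i : Fin (answer K x).k} (hi : (K false).k ≤ i.val) :
    ((answer K x).bp i : ℝ) = -(K true).pt ((K false).k + (K true).k - 1 - i) := by
  simp [answer, pt, hi.not_gt]

variable {I : Problem n} {ε : ℝ} {F G : Bool → ℤ}

theorem abs_answer_bp_le (h : ∀ d, (K d).Front I ε (orient d) (F d) (G d))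
    (i : Fin (answer K x).k) : |((answer K x).bp i : ℝ)| ≤ I.size := by
  have hi : i.val < (K false).k + (K true).k := i.2
  rcases lt_or_ge i.val (K false).k with h1 | h1
  · rw [answer_bp_of_lt h1]
    exact (h false).bound _ h1
  · rw [answer_bp_of_le h1, abs_neg]
    exact (h true).bound _ (by omega)

theorem answer_strictMono (h : ∀ d, (K d).Front I ε (orient d) (F d) (G d))
    (hgap : (F false / G false : ℝ) < -(F true / G true)) : StrictMono (answer K x).bp := by
  intro i j hij
  have hij' : i.val < j.val := hij
  have hi : i.val < (K false).k + (K true).k := i.2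
  have hj : j.val < (K false).k + (K true).k := j.2
  have : ((answer K x).bp i : ℝ) < (answer K x).bp j := by
    rcases lt_or_ge i.val (K false).k with h1 | h1
    · rw [answer_bp_of_lt h1]
      rcases lt_or_ge j.val (K false).k with h2 | h2
      · rw [answer_bp_of_lt h2]
        exact (h false).mono _ _ hij h2
      · rw [answer_bp_of_le h2]
        refine ((h false).le _ h1).trans_lt (hgap.trans_le (neg_le_neg ?_))
        exact (h true).le _ (by omega)
    · rw [answer_bp_of_le h1, answer_bp_of_le (h1.trans hij'.le)]
      exact neg_lt_neg ((h true).mono _ _ (by omega) (by omega))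
  exact_mod_cast this

/-- Each set is still feasible at its own breakpoint, so a breakpoint belongs to the outer of its
two intervals. Thus the strict and weak inequalities `a1` to `a4` match those in `Front.appr` on
both sides. -/
theorem answer_appr_of_abs_lt (h : ∀ d, (K d).Front I ε (orient d) (F d) (G d))
    (hx : ∀ t : ℝ, (F false / G false : ℝ) < t → t < -(F true / G true) → I.Appr ε t x)
    (j : Fin ((answer K x).k + 1)) {r : ℝ} (hr : r ∈ (answer K x).piece j)
    (hlt : |r| < I.size + 2) : I.Appr ε r ((answer K x).sol j) := by
  obtain ⟨hl, hu⟩ := abs_lt.mp hlt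
  obtain ⟨h1, h2⟩ := hr
  have hj : j.val < (K false).k + (K true).k + 1 := j.2
  have hk : (answer K x).k = (K false).k + (K true).k := rfl
  have a1 : ∀ i < (K false).k, i < j.val → (K false).pt i < r := by
    intro i hi hij
    have := h1 ⟨i, by omega⟩ hij
    rw [answer_bp_of_lt hi] at this
    simpa [answer, hi] using this
  have a2 : ∀ i < (K false).k, j.val ≤ i → r ≤ (K false).pt i := by
    intro i hi hij
    have := h2 ⟨i, by omega⟩ hij
    rw [answer_bp_of_lt hi] at this
    rcases this with h | h
    exacts [h.le, h.1.le]
  have e : ∀ i < (K true).k,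
      (K false).k + (K true).k - 1 - ((K false).k + (K true).k - 1 - i) = i := by omega
  have a3 : ∀ i < (K true).k, j.val + i < (K false).k + (K true).k → (K true).pt i < -r := by
    intro i hi hij
    have := h2 ⟨(K false).k + (K true).k - 1 - i, by omega⟩ (by simp only; omega)
    rw [answer_bp_of_le (by simp only; omega)] at this
    simp only [e i hi] at this
    rcases this with h | ⟨-, h⟩
    · linarith
    · simp only [answer, decide_eq_true_eq] at h
      omega
  have a4 : ∀ i < (K true).k, (K false).k + (K true).k ≤ j.val + i → -r ≤ (K true).pt i := by
    intro i hi hij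
    have := h1 ⟨(K false).k + (K true).k - 1 - i, by omega⟩ (by simp only; omega)
    rw [answer_bp_of_le (by simp only; omega)] at this
    simp only [e i hi] at this
    rcases this with h | ⟨h, -⟩ <;> linarith
  rcases lt_trichotomy j.val (K false).k with hjk | hjk | hjk
  · have := (h false).appr j hjk r hl (fun i hi => a1 i (hi.trans hjk) hi) (a2 j hjk le_rfl)
    simpa [answer, hjk, orient] using this
  · have b1 := (h false).lt_of_forall hl fun i hi => a1 i hi (by omega)
    have b2 := (h true).lt_of_forall (t := -r) (by linarith) fun i hi => a3 i hi (by omega)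
    simpa [answer, hjk] using hx r b1 (lt_neg.mpr b2)
  · have := (h true).appr ((K false).k + (K true).k - j) (by omega) (-r) (by linarith)
      (fun i hi => a3 i (by omega) (by omega)) (a4 _ (by omega) (by omega))
    simpa [answer, hjk.not_gt, hjk.ne', orient] using this

/-- The sweeps start at distance `I.size + 2` from the origin and say nothing farther out. But all
breakpoints lie within distance `I.size`, and from distance `I.size + 1` on the family of feasible
sets is constant on each side, so the solution at `±(I.size + 1)` carries over. -/
theorem answer_isApproxFor (h : ∀ d, (K d).Front I ε (orient d) (F d) (G d))
    (hgap : (F false / G false : ℝ) < -(F true / G true))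
    (hx : ∀ t : ℝ, (F false / G false : ℝ) < t → t < -(F true / G true) → I.Appr ε t x) :
    (answer K x).IsApproxFor I ε := by
  refine ⟨answer_strictMono h hgap, fun j r hr => ?_⟩
  rcases lt_or_ge |r| (I.size + 2) with hlt | hge
  · exact answer_appr_of_abs_lt h hx j hr hlt
  obtain ⟨d, t, ht, rfl⟩ : ∃ (d : Bool) (t : ℝ), (I.size : ℝ) + 2 ≤ t ∧ r = orient d * t := by
    rcases le_abs.mp hge with h | h
    · exact ⟨false, r, h, by simp [orient]⟩
    · exact ⟨true, -r, h, by simp [orient]⟩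
  have habs : |(orient d : ℝ)| = 1 := by cases d <;> simp [orient]
  have hS : (0 : ℝ) ≤ I.size := by positivity
  refine (answer_appr_of_abs_lt h hx j (r := orient d * (I.size + 1)) ?_ ?_).congr
    fun y => ?_
  -- No breakpoint separates the far point from the sample point on the same side, so both lie in
  -- the same piece.
  · have key : ∀ b : ℝ, |b| ≤ I.size → (b < orient d * t → b < orient d * (I.size + 1)) ∧
        (orient d * t < b → orient d * (I.size + 1) < b) ∧ b ≠ orient d * t := by
      intro b hb
      obtain ⟨hb1, hb2⟩ := abs_le.mp hb
      cases d <;> simp only [orient, Int.cast_one, Int.cast_neg, one_mul, neg_mul]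
      · exact ⟨fun _ => by linarith, fun _ => by linarith, fun _ => by linarith⟩
      · exact ⟨fun _ => by linarith, fun _ => by linarith, fun _ => by linarith⟩
    refine ⟨fun i hi => ?_, fun i hi => ?_⟩
    · obtain ⟨k1, -, k3⟩ := key _ (abs_answer_bp_le h i)
      rcases hr.1 i hi with h | h
      · exact Or.inl (k1 h)
      · exact absurd h.1 k3
    · obtain ⟨-, k2, k3⟩ := key _ (abs_answer_bp_le h i)
      rcases hr.2 i hi with h | h
      · exact Or.inl (k2 h)
      · exact absurd h.1.symm k3
  · rw [abs_mul, habs, one_mul, abs_of_nonneg (by linarith)]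
    linarith
  · rw [Problem.feasible_iff_of_size_lt le_rfl,
      Problem.feasible_iff_of_size_lt (by linarith)]

end Stack
end ParamKnapsack

namespace ParamKnapsack
open _root_.ParamKnapsack.Expr

variable {N n : ℕ}

/-! ### The whole program -/

/-- Add the absolute value of the cell `reg 28` of the array `v` to `reg 6`. -/
def addAbs (v : ℕ) : Prog :=
  Prog.iteLE (const 0) (get v (reg 28)) (Prog.assign 6 (add (reg 6) (get v (reg 28))))
    (Prog.assign 6 (sub (reg 6) (get v (reg 28))))

/-- Compute the size of the instance in `reg 6`. -/
def computeSize : Prog :=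
  Prog.iteLE (const 0) (reg 1) (Prog.assign 6 (reg 1)) (Prog.assign 6 (sub (const 0) (reg 1))) ;;
  Prog.assign 28 (const 0) ;;
  Prog.whileLE (add (reg 28) (const 1)) (reg 0)
    (addAbs 0 ;; addAbs 1 ;; Prog.assign 28 (add (reg 28) (const 1)))

/-- Compute the parameters of the algorithm from the input. -/
def setup : Prog :=
  computeSize ;;
  Prog.assign 7 (div (sub (add (mul (const 2) (reg 4)) (reg 3)) (const 1)) (reg 3)) ;;
  Prog.assign 8 (mul (reg 0) (sub (reg 7) (const 1))) ;;
  Prog.assign 12 (add (mul (const 2) (reg 6)) (const 3)) ;;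
  Prog.assign 15 (sub (const 0) (add (reg 6) (const 2))) ;; Prog.assign 16 (reg 15) ;;
  Prog.assign 17 (const 1) ;; Prog.assign 18 (const 1) ;; Prog.assign 9 (reg 2)

/-- Scale the profits for the profit level `reg 10`. -/
def scaleProfits : Prog :=
  Prog.assign 28 (const 0) ;;
  Prog.whileLE (add (reg 28) (const 1)) (reg 0)
    (Prog.put 18 (reg 28) (div (mul (get 2 (reg 28)) (mul (reg 0) (reg 7))) (reg 10)) ;;
      Prog.assign 28 (add (reg 28) (const 1)))

theorem addAbs_spec (hN : 4 ≤ N) {v k : ℕ} {s : Store} (hb : s.Bdd N) (h28 : s.reg 28 = k)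
    (hz : abs (s.reg 6 + |s.arr v k|) ≤ N) :
    Tri N (addAbs v) s 10 fun s' => s' = s.setReg 6 (s.reg 6 + |s.arr v k|) := by
  refine Tri.ite hN hb (by simp [deg]) (by simp [deg]) (by simp [Ok]) (by simp [Ok, eval, h28])
    (fun h => ?_) (fun h => ?_)
  · simp only [eval, h28, Int.toNat_natCast] at h
    exact Tri.assign hN hb (by simp [deg]) (by simp [Ok, eval, h28])
      (z := s.reg 6 + |s.arr v k|) (by simp [eval, h28, abs_of_nonneg h]) hz (by simp [cost]) rfl
  · simp only [eval, h28, Int.toNat_natCast] at h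
    refine Tri.assign hN hb (by simp [deg]) (by simp [Ok, eval, h28])
      (z := s.reg 6 + |s.arr v k|) ?_ hz (by simp [cost]) rfl
    rw [abs_of_neg (not_le.mp h)]
    simp [eval, h28, sub_eq_add_neg]

theorem computeSize_spec (hN : 4 ≤ N) {I : Problem n} {s : Store} (hb : s.Bdd N)
    (hn : s.reg 0 = n) (hW : s.reg 1 = I.W) (ha : ∀ i : Fin n, s.arr 0 i = I.a i)
    (hb' : ∀ i : Fin n, s.arr 1 i = I.b i) (hnN : n ≤ N) (hS : I.size ≤ N) :
    Tri N computeSize s (40 * n + 40) fun s' => (∀ x, x ≠ 6 → x ≠ 28 → s'.reg x = s.reg x) ∧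
      (∀ v l, s'.arr v l = s.arr v l) ∧ s'.reg 6 = I.size := by
  set f : ℕ → ℤ := fun j => |s.arr 0 j| + |s.arr 1 j| with hf
  have hf0 : ∀ j, 0 ≤ f j := fun j => add_nonneg (abs_nonneg _) (abs_nonneg _)
  have htot : |I.W| + ∑ j ∈ Finset.range n, f j = I.size := by
    rw [Finset.sum_range, ← I.sum_abs_add_le, ← Finset.sum_add_distrib]
    simp only [hf, ha, hb']
  have hpart : ∀ k ≤ n, |I.W| + ∑ j ∈ Finset.range k, f j ≤ N := by
    intro k hk
    have h1 : ∑ j ∈ Finset.range k, f j ≤ ∑ j ∈ Finset.range n, f j :=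
      Finset.sum_le_sum_of_subset_of_nonneg (by simpa using hk) fun j _ _ => hf0 j
    have h2 : (I.size : ℤ) ≤ N := by exact_mod_cast hS
    linarith
  have hW' : |I.W| ≤ N := by simpa using hpart 0 (Nat.zero_le _)
  refine Tri.seq 10 (Q := fun s' => s' = s.setReg 6 |I.W|) ?_ ?_
  · refine Tri.ite hN hb (by decide) (by decide) (by simp [Ok]) (by simp [Ok])
      (fun h => ?_) (fun h => ?_)
    · simp only [eval, hW] at h
      exact Tri.assign hN hb (by simp [deg]) (by simp [Ok])
        (by simp [eval, hW, abs_of_nonneg h]) (by rwa [abs_abs]) (by simp [cost]) rfl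
    · simp only [eval, hW] at h
      exact Tri.assign hN hb (by simp [deg]) (by simp [Ok])
        (by simp [eval, hW, abs_of_neg (not_le.mp h)]) (by rwa [abs_abs]) (by simp [cost]) rfl
  rintro _ hb rfl
  refine Tri.assign_seq hN hb (by decide) (by simp [Ok]) (z := 0) (by simp [eval])
    (by simp) fun hb => ?_
  refine Tri.loop hN (by decide) (by decide) (fun k s' =>
      (∀ x, x ≠ 6 → x ≠ 28 → s'.reg x = s.reg x) ∧ (∀ v l, s'.arr v l = s.arr v l) ∧
      s'.reg 6 = |I.W| + ∑ j ∈ Finset.range k, f j ∧ s'.reg 28 = k ∧ k ≤ n) n 24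
    (fun _ _ _ _ => by simp [Ok]) ?_ ?_ hb ?_ (by simp only [cost]; omega)
  · rintro k s' hb ⟨h1, h2, h3, h4, h5⟩ hle
    have e0 : s'.reg 0 = n := by rw [h1 0 (by norm_num) (by norm_num), hn]
    simp only [eval, h4, e0] at hle
    refine ⟨by omega, ?_⟩
    have hk := hpart (k + 1) (by omega)
    have hW0 := abs_nonneg I.W
    have hs0 : 0 ≤ ∑ j ∈ Finset.range k, f j := Finset.sum_nonneg fun j _ => hf0 j
    have ha0 := abs_nonneg (s.arr 0 k)
    have ha1 := abs_nonneg (s.arr 1 k)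
    rw [Finset.sum_range_succ] at hk
    simp only [hf] at hk hs0 h3
    refine Tri.seq _ (addAbs_spec hN hb h4 ?_) ?_
    · rw [h2, h3, abs_of_nonneg] <;> linarith
    rintro _ hb rfl
    refine Tri.seq _ (addAbs_spec hN hb (v := 1) (k := k) (by simp [h4]) ?_) ?_
    · simp only [Store.reg_setReg, if_true, Store.arr_setReg]
      rw [h2, h2, h3, abs_of_nonneg] <;> linarith
    rintro _ hb rfl
    refine Tri.assign hN hb (by decide) (by simp [Ok]) (z := k + 1) (by simp [eval, h4])
      (by rw [abs_of_nonneg] <;> omega) (by simp [cost]) ?_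
    refine ⟨fun x hx hx' => by simp [hx, hx', h1], fun v l => by simp [h2], ?_, by simp, by omega⟩
    simp only [Store.reg_setReg, Store.arr_setReg, h2, h3, Finset.sum_range_succ, hf]
    norm_num
    ring
  · rintro k s' hb ⟨h1, h2, h3, h4, h5⟩ hle
    have e0 : s'.reg 0 = n := by rw [h1 0 (by norm_num) (by norm_num), hn]
    simp only [eval, h4, e0] at hle
    obtain rfl : k = n := by omega
    exact ⟨h1, h2, h3.trans htot⟩
  · refine ⟨fun x hx hx' => by simp [hx, hx'], fun v l => by simp, by simp, by simp, by simp⟩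

theorem scaleProfits_spec (hN : 4 ≤ N) {I : Problem n} {m q : ℕ} (hq : 0 < q) {s : Store}
    (hb : s.Bdd N) (hn : s.reg 0 = n) (hm : s.reg 7 = m) (h10 : s.reg 10 = q)
    (hp : ∀ i : Fin n, s.arr 2 i = I.p i) (hnN : n ≤ N)
    (hpN : ∀ i, I.p i * (n * m) ≤ N) :
    Tri N scaleProfits s (30 * n + 10) fun s' => (∀ x ≠ 28, s'.reg x = s.reg x) ∧
      (∀ v ≠ 18, ∀ l, s'.arr v l = s.arr v l) ∧
      ∀ i : Fin n, s'.arr 18 i = I.scaled m q i := by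
  refine Tri.assign_seq hN hb (by decide) (by simp [Ok]) (z := 0) (by simp [eval])
    (by simp) fun hb => ?_
  refine Tri.loop hN (by decide) (by decide) (fun k s' => (∀ x ≠ 28, s'.reg x = s.reg x) ∧
      (∀ v ≠ 18, ∀ l, s'.arr v l = s.arr v l) ∧
      (∀ i : Fin n, i.val < k → s'.arr 18 i = I.scaled m q i) ∧ s'.reg 28 = k ∧ k ≤ n) n 18
    (fun _ _ _ _ => by simp [Ok]) ?_ ?_ hb ?_ (by simp only [cost]; omega)
  · rintro k s' hb ⟨h1, h2, h3, h4, h5⟩ hle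
    have e0 : s'.reg 0 = n := by rw [h1 0 (by norm_num), hn]
    have e7 : s'.reg 7 = m := by rw [h1 7 (by norm_num), hm]
    have e10 : s'.reg 10 = q := by rw [h1 10 (by norm_num), h10]
    simp only [eval, h4, e0] at hle
    have hk : k < n := by omega
    refine ⟨hk, ?_⟩
    have e2 : s'.arr 2 k = I.p ⟨k, hk⟩ := by rw [h2 2 (by norm_num)]; exact hp ⟨k, hk⟩
    refine Tri.put_seq hN hb (by decide) (by decide) (by simp [Ok])
      (by simp [Ok, eval, h4, e10]; omega) (j := k) (by simp [eval, h4])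
      (z := (I.scaled m q ⟨k, hk⟩ : ℕ)) (by simp [eval, h4, e2, e0, e7, e10, Problem.scaled])
      (by
        rw [Nat.abs_cast]
        exact_mod_cast (Nat.div_le_self _ _).trans (hpN ⟨k, hk⟩)) fun hb => ?_
    refine Tri.assign hN hb (by decide) (by simp [Ok]) (z := k + 1) (by simp [eval, h4])
      (by rw [abs_of_nonneg] <;> omega) (by simp [cost]) ?_
    refine ⟨fun x hx => by simp [hx, h1], fun v hv l => by simp [hv, h2], fun i hi => ?_, by simp,
      by omega⟩
    by_cases hik : i.val = k
    · obtain rfl : i = ⟨k, hk⟩ := Fin.ext hik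
      simp
    · simp [hik, h3 i (by omega)]
  · rintro k s' hb ⟨h1, h2, h3, h4, h5⟩ hle
    have e0 : s'.reg 0 = n := by rw [h1 0 (by norm_num), hn]
    simp only [eval, h4, e0] at hle
    exact ⟨h1, h2, fun i => h3 i (by omega)⟩
  · exact ⟨fun x hx => by simp [hx], fun v _ l => by simp, by simp, by simp, by simp⟩

/-- The memory after the setup. -/
structure Problem.Setup (I : Problem n) (m : ℕ) (s : Store) : Prop where
  n_eq : s.reg 0 = n
  W_eq : s.reg 1 = I.W
  size_eq : s.reg 6 = I.size
  m_eq : s.reg 7 = m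
  T_eq : s.reg 8 = (n * (m - 1) : ℕ)
  Z_eq : s.reg 12 = 2 * I.size + 3
  a_eq : ∀ i : Fin n, s.arr 0 i = I.a i
  b_eq : ∀ i : Fin n, s.arr 1 i = I.b i
  p_eq : ∀ i : Fin n, s.arr 2 i = I.p i

theorem Problem.Setup.congr {I : Problem n} {m : ℕ} {s s' : Store} (h : I.Setup m s)
    (hr : ∀ x, x < 9 ∨ x = 12 → s'.reg x = s.reg x) (ha : ∀ v < 3, ∀ l, s'.arr v l = s.arr v l) :
    I.Setup m s' where
  n_eq := by rw [hr _ (by norm_num), h.n_eq]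
  W_eq := by rw [hr _ (by norm_num), h.W_eq]
  size_eq := by rw [hr _ (by norm_num), h.size_eq]
  m_eq := by rw [hr _ (by norm_num), h.m_eq]
  T_eq := by rw [hr _ (by norm_num), h.T_eq]
  Z_eq := by rw [hr _ (by norm_num), h.Z_eq]
  a_eq i := by rw [ha _ (by norm_num), h.a_eq]
  b_eq i := by rw [ha _ (by norm_num), h.b_eq]
  p_eq i := by rw [ha _ (by norm_num), h.p_eq]

/-- The memory before the `j`-th profit level. -/
structure Problem.LevelInv (I : Problem n) (ε : ℝ) (P m : ℕ) (j r : ℕ) (K : Bool → Stack n)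
    (s : Store) : Prop where
  setup : I.Setup m s
  r_eq : s.reg 9 = r
  sweep : I.Sweep ε r K s
  k_le : ∀ d, (K d).k ≤ j
  k_le_P : ∀ d, (K d).k ≤ P
  level : r = 0 ∨ (s.reg 11 = 0 ∧ j + r ≤ P ∧ r * m ^ j ≤ P * (m - 1) ^ j)

/-- No breakpoints. -/
def Stack.nil : Stack n := ⟨0, fun _ => 0, fun _ => 0, fun _ => ∅⟩

theorem Stack.front_nil (I : Problem n) (ε : ℝ) (σ : ℤ) :
    Stack.nil.Front I ε σ (-(I.size + 2)) 1 := by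
  have h : ∀ i, ¬ i < (Stack.nil : Stack n).k := fun i => Nat.not_lt_zero i
  refine ⟨one_pos, ?_, by omega, by simp, fun i hi => absurd hi (h i), fun i hi => absurd hi (h i),
    fun i j _ hj => absurd hj (h j), fun i hi => absurd hi (h i), Or.inl ⟨rfl, rfl⟩,
    fun i hi => absurd hi (h i)⟩
  rw [abs_neg, abs_of_nonneg (by positivity)]

theorem setup_spec (hN : 4 ≤ N) {I : Problem n} (ε : ℝ) {P u v m : ℕ} (hu : 0 < u)
    (huv : u < v) (hm : m = (2 * v + u - 1) / u) (hb : (inputStore I P u v).Bdd N)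
    (hnm : n * m + 1 ≤ N) (hnN : n ≤ N) (hmN : m ≤ N)
    (hSN : 160 * (I.size + 2) ^ 6 ≤ N) (hP : ∀ r : ℝ, I.optProfit r ≤ P) :
    Tri N setup (inputStore I P u v) (40 * n + 100)
      (I.LevelInv ε P m 0 P fun _ => Stack.nil) := by
  have hSN' : (160 : ℤ) * ((I.size : ℤ) + 2) ^ 6 ≤ N := by exact_mod_cast hSN
  have hS0 : (0 : ℤ) ≤ I.size := by positivity
  have hS6 : ((I.size : ℤ) + 2) ^ 1 ≤ ((I.size : ℤ) + 2) ^ 6 :=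
    pow_le_pow_right₀ (by omega) (by norm_num)
  have hS : 3 * (I.size : ℤ) + 6 ≤ N := by linarith
  have hm1 : 1 ≤ m := by
    rw [hm, Nat.le_div_iff_mul_le hu]
    omega
  have hTN : n * (m - 1) ≤ N := (Nat.mul_le_mul_left n (Nat.sub_le m 1)).trans (by omega)
  refine Tri.seq _ (computeSize_spec hN (I := I) hb rfl rfl (fun i => by simp [inputStore])
    (fun i => by simp [inputStore]) hnN (by omega)) ?_
  rintro s hb ⟨r1, a1, h6⟩
  have e0 : s.reg 0 = n := by rw [r1 0 (by norm_num) (by norm_num)]; rfl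
  have e1 : s.reg 1 = I.W := by rw [r1 1 (by norm_num) (by norm_num)]; rfl
  have e2 : s.reg 2 = P := by rw [r1 2 (by norm_num) (by norm_num)]; rfl
  have e3 : s.reg 3 = u := by rw [r1 3 (by norm_num) (by norm_num)]; rfl
  have e4 : s.reg 4 = v := by rw [r1 4 (by norm_num) (by norm_num)]; rfl
  have e11 : s.reg 11 = 0 := by rw [r1 11 (by norm_num) (by norm_num)]; rfl
  have e13 : s.reg 13 = 0 := by rw [r1 13 (by norm_num) (by norm_num)]; rfl
  have e14 : s.reg 14 = 0 := by rw [r1 14 (by norm_num) (by norm_num)]; rfl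
  have hPN : (P : ℤ) ≤ N := by
    have := hb.1 2
    rwa [e2, Nat.abs_cast] at this
  have hm7 : (2 * (v : ℤ) + u - 1) / u = m := by
    rw [hm, Int.natCast_div, Nat.cast_sub (by omega)]
    push_cast
    rfl
  refine Tri.assign_seq hN hb (by decide) (by simp [Ok, eval, e3]; omega) (z := m)
    (by simp [eval, e3, e4, hm7]) (by rw [Nat.abs_cast]; exact_mod_cast hmN) fun hb => ?_
  refine Tri.assign_seq hN hb (by decide) (by simp [Ok]) (z := (n * (m - 1) : ℕ))
    (by simp [eval, e0, Nat.cast_sub hm1]) (by rw [Nat.abs_cast]; exact_mod_cast hTN) fun hb => ?_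
  refine Tri.assign_seq hN hb (by decide) (by simp [Ok]) (z := 2 * I.size + 3)
    (by simp [eval, h6]) (by rw [abs_of_nonneg] <;> linarith) fun hb => ?_
  refine Tri.assign_seq hN hb (by decide) (by simp [Ok]) (z := -(I.size + 2))
    (by simp [eval, h6]) (by rw [abs_neg, abs_of_nonneg] <;> linarith) fun hb => ?_
  refine Tri.assign_seq hN hb (by decide) (by simp [Ok]) (z := -(I.size + 2))
    (by simp [eval]) (by rw [abs_neg, abs_of_nonneg] <;> linarith) fun hb => ?_
  refine Tri.assign_seq hN hb (by decide) (by simp [Ok]) (z := 1)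
    (by simp [eval]) (by simp; omega) fun hb => ?_
  refine Tri.assign_seq hN hb (by decide) (by simp [Ok]) (z := 1)
    (by simp [eval]) (by simp; omega) fun hb => ?_
  refine Tri.assign hN hb (by decide) (by simp [Ok]) (z := P)
    (by simp [eval, e2]) (by rwa [Nat.abs_cast]) (by simp only [cost]; omega) ?_
  refine ⟨⟨by simp [e0], by simp [e1], by simp [h6], by simp, by simp, by simp,
    fun i => by simp [a1, inputStore], fun i => by simp [a1, inputStore],
    fun i => by simp [a1, inputStore]⟩, by simp, ⟨fun d => ?_, fun d => ?_, fun d => ?_, ?_⟩,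
    fun d => le_rfl, fun d => Nat.zero_le _, Or.inr ⟨by simp [e11], by omega, by simp⟩⟩
  · have h : ∀ i, ¬ i < (Stack.nil : Stack n).k := fun i => Nat.not_lt_zero i
    refine ⟨?_, fun i hi => absurd hi (h i), fun i hi => absurd hi (h i),
      fun i hi => absurd hi (h i), fun i hi => absurd hi (h i)⟩
    cases d <;> simp [countReg, e13, e14, Stack.nil]
  · have := Stack.front_nil I ε (orient d)
    cases d <;> simpa [numReg, denReg] using this
  · cases d <;> simp [numReg, denReg] <;> omega
  · refine Or.inl ⟨by simp [e11], fun j => by simp [a1, inputStore], fun t _ => hP t⟩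

end ParamKnapsack

/-! ### One profit level, and joining the two sweeps -/

namespace ParamKnapsack
open _root_.ParamKnapsack.Expr

variable {N n : ℕ}

/-- Solve the profit level `reg 9`. -/
def level : Prog :=
  Prog.assign 10 (sub (reg 9) (div (reg 9) (reg 7))) ;; scaleProfits ;; side false ;; side true ;;
  Prog.iteLE (reg 11) (const 0) (Prog.assign 9 (sub (reg 10) (const 1))) (Prog.assign 9 (const 0))

/-- Append the breakpoints of the downward sweep to the breakpoints of the upward sweep. -/
def joinSides : Prog :=
  Prog.assign 26 (mul (reg 13) (reg 0)) ;; Prog.assign 27 (const 0) ;; copyRow 6 16 ;;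
  Prog.assign 19 (const 0) ;;
  Prog.whileLE (add (reg 19) (const 1)) (reg 14)
    (Prog.assign 20 (add (reg 13) (reg 19)) ;;
    Prog.assign 21 (sub (sub (reg 14) (const 1)) (reg 19)) ;;
    Prog.put 3 (reg 20) (sub (const 0) (get 10 (reg 21))) ;;
    Prog.put 4 (reg 20) (get 11 (reg 21)) ;;
    Prog.put 5 (reg 20) (const 0) ;;
    Prog.assign 26 (mul (add (reg 20) (const 1)) (reg 0)) ;;
    Prog.assign 27 (mul (reg 21) (reg 0)) ;;
    copyRow 6 13 ;;
    Prog.assign 19 (add (reg 19) (const 1))) ;;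
  Prog.assign 5 (add (reg 13) (reg 14))

/-- The approximation scheme. -/
def scheme : Prog :=
  setup ;; Prog.whileLE (const 1) (reg 9) level ;; joinSides

/-- As `⌊r/m⌋ + 1` exceeds `r / m`, the `- 1` that tightness yields makes up for the rounding, and
the level shrinks by the full factor `(m - 1) / m`. The additive bound limits the number of
breakpoints per side by `P`, hence the array addresses. -/
theorem next_level {m r j P : ℕ} (hm : 1 ≤ m) (h1 : 0 < r - r / m)
    (h : j + r ≤ P ∧ r * m ^ j ≤ P * (m - 1) ^ j) :
    (j + 1) + (r - r / m - 1) ≤ P ∧ (r - r / m - 1) * m ^ (j + 1) ≤ P * (m - 1) ^ (j + 1) := by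
  refine ⟨by generalize r / m = d at *; omega, ?_⟩
  have h2 : (r - r / m - 1) * m ≤ r * (m - 1) := by
    obtain ⟨m, rfl⟩ : ∃ m', m = m' + 1 := ⟨m - 1, by omega⟩
    have h3 := Nat.lt_mul_div_succ r (Nat.succ_pos m)
    have h4 := Nat.div_le_self r (m + 1)
    obtain ⟨e, he⟩ : ∃ e, r = r / (m + 1) + 1 + e := ⟨r - r / (m + 1) - 1, by omega⟩
    generalize r / (m + 1) = q at *
    subst he
    simp only [Nat.add_sub_cancel, Nat.succ_eq_add_one] at *
    have : q + 1 + e - q - 1 = e := by omega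
    rw [this]
    nlinarith
  calc (r - r / m - 1) * m ^ (j + 1) = (r - r / m - 1) * m * m ^ j := by ring
    _ ≤ r * (m - 1) * m ^ j := Nat.mul_le_mul_right _ h2
    _ = r * m ^ j * (m - 1) := by ring
    _ ≤ P * (m - 1) ^ j * (m - 1) := Nat.mul_le_mul_right _ h.2
    _ = P * (m - 1) ^ (j + 1) := by ring

/-- If the gap survives both sides, both frontiers are tight for the same demand and the optimum
drops below `q`. If some set closes the gap, `reg 9` is set to `0`, which ends the main loop. -/
theorem level_spec (hN : 4 ≤ N) {I : Problem n} {ε : ℝ} {P m j r : ℕ} {K : Bool → Stack n}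
    (hn : 0 < n) (hm : 2 ≤ m) (hε : 2 ≤ ε * m) {s : Store} (hb : s.Bdd N)
    (h : I.LevelInv ε P m j r K s) (hr : 0 < r) (hPN : (P + 1) * (n + 1) ≤ N)
    (hpN : ∀ i, I.p i * (n * m) ≤ N) (hnm : n * m + 1 ≤ N)
    (hSN : 160 * (I.size + 2) ^ 6 ≤ N) :
    Tri N level s ((I.newtonBound + 3) * (1300 * ((n + 1) * (n * (m - 1) + 1)))) fun s' =>
      ∃ r' K', I.LevelInv ε P m (j + 1) r' K' s' := by
  have hnP : n ≤ N := by
    have := (Nat.le_mul_of_pos_left (n + 1) (Nat.succ_pos P)).trans hPN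
    omega
  have hP1 : P ≤ N := by
    have := (Nat.le_mul_of_pos_right (P + 1) (Nat.succ_pos n)).trans hPN
    omega
  have hTN : n * (m - 1) + 1 ≤ N :=
    (Nat.add_le_add_right (Nat.mul_le_mul_left n (Nat.sub_le m 1)) 1).trans hnm
  have hdiv : r / m < r := Nat.div_lt_self hr hm
  obtain ⟨q, hq⟩ : ∃ q, q = r - r / m := ⟨_, rfl⟩
  have hq0 : 0 < q := by omega
  have hqr : q ≤ r := by
    rw [hq]
    exact Nat.sub_le _ _
  obtain ⟨h11, hjr, hjm⟩ := h.level.resolve_left hr.ne'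
  have hkN : ∀ d, ((K d).k + 1) * (n + 1) ≤ N := fun d =>
    (Nat.mul_le_mul_right _ (Nat.succ_le_succ (h.k_le_P d))).trans hPN
  have htime : 30 * n + 100 + 2 * ((I.newtonBound + 3) * (600 * ((n + 1) * (n * (m - 1) + 1))))
      ≤ (I.newtonBound + 3) * (1300 * ((n + 1) * (n * (m - 1) + 1))) := by
    have hnT : n + 1 ≤ (n + 1) * (n * (m - 1) + 1) := Nat.le_mul_of_pos_right _ (by positivity)
    generalize (n + 1) * (n * (m - 1) + 1) = X at *
    nlinarith
  refine Tri.mono_time ?_ htime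
  obtain ⟨Y, hY⟩ : ∃ Y, Y = (I.newtonBound + 3) * (600 * ((n + 1) * (n * (m - 1) + 1))) :=
    ⟨_, rfl⟩
  rw [← hY]
  have e9 := h.r_eq
  have e7 := h.setup.m_eq
  have hqz : (r : ℤ) - r / m = q := by
    rw [hq, Nat.cast_sub hdiv.le, Int.natCast_div]
  refine Tri.assign_seq hN hb (by decide) (by simp [Ok, eval, e7]; omega) (z := q)
    (by simp [eval, e9, e7, hqz]) (by rw [Nat.abs_cast]; omega) fun hb => ?_
  refine Tri.seq _ (scaleProfits_spec hN hq0 (I := I) (m := m) hb (by simp [h.setup.n_eq])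
    (by simp [e7]) (by simp) (fun i => by simp [h.setup.p_eq]) hnP hpN) ?_
  rintro s₁ hb ⟨r1, a1, w1⟩
  have hs₁ : I.Setup m s₁ := h.setup.congr
    (fun x hx => by rw [r1 x (by omega)]; simp [show x ≠ 10 by omega])
    (fun v hv l => by rw [a1 v (by omega)]; simp)
  have hE : I.Env (I.scaled m (r - r / m)) (n * (m - 1)) s₁ := ⟨hs₁.n_eq, hs₁.W_eq, hs₁.size_eq,
    hs₁.T_eq, hs₁.Z_eq, hs₁.a_eq, hs₁.b_eq, by rw [← hq]; exact w1⟩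
  have hSw : I.Sweep ε r K s₁ := by
    refine h.sweep.congr (fun x hx hx' => ?_) (fun v hv l => ?_) ?_
    · rw [r1 x (by omega)]
      simp [show x ≠ 10 by omega]
    · rw [a1 v (by omega)]
      simp
    · rw [r1 11 (by norm_num)]
      simpa [a1] using h.sweep.mid
  refine Tri.seq Y (by rw [hY]; exact side_spec hN hn (by omega) hε false hb hE hSw (hkN _) hTN hSN) ?_
  rintro s₂ hb hP₁
  obtain ⟨K₂, hSw₂, hk, hk'⟩ := hP₁.sweep
  refine Tri.seq Y (by
    rw [hY]
    exact side_spec hN hn (by omega) hε true hb (hE.frame hP₁.frame) hSw₂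
      (by rw [show K₂ true = K true from hk']; exact hkN _) hTN hSN) ?_
  rintro s₃ hb hP₂
  obtain ⟨K₃, hSw₃, hl, hl'⟩ := hP₂.sweep
  rw [show K₂ true = K true from hk'] at hl
  have hKj : ∀ d, (K₃ d).k ≤ (K d).k + 1 := by
    intro d
    cases d
    · rw [show K₃ false = K₂ false from hl']
      exact hk
    · exact hl
  have hKj' : ∀ d, (K₃ d).k ≤ j + 1 := fun d => (hKj d).trans (Nat.succ_le_succ (h.k_le d))
  have hfr := hP₁.frame.trans hP₂.frame
  have e10 : s₃.reg 10 = q := by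
    rw [hfr.1 10 (by norm_num), r1 10 (by norm_num)]
    simp
  have hs₃ : I.Setup m s₃ := hs₁.congr (fun x hx => hfr.1 x (by omega))
    (fun v hv => hfr.2 v (by omega))
  refine Tri.ite hN hb (by decide) (by decide) (by simp [Ok]) (by simp [Ok]) (fun hc => ?_)
    (fun hc => ?_)
  · have h11' : s₃.reg 11 = 0 := by
      simp only [eval] at hc
      rcases hSw₃.mid with h | h
      · exact h.1
      · omega
    have h0 : ∀ j : Fin n, s₃.arr 16 j = 0 := by
      rcases hSw₃.mid with h | h
      · exact h.2.1
      · omega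
    -- Tightness on the first side survives the second one, which does not move the opposite
    -- frontier.
    have t₁ := hP₁.tight (hP₂.fin h11')
    rw [← show s₃.reg (numReg false) = s₂.reg (numReg false) from hP₂.num,
      ← show s₃.reg (denReg false) = s₂.reg (denReg false) from hP₂.den, ← hq] at t₁
    have t₂ := hP₂.tight h11'
    rw [← hq] at t₂
    refine Tri.assign hN hb (by decide) (by simp [Ok]) (z := (q - 1 : ℕ))
      (by simp [eval, e10, Nat.cast_sub hq0]) (by rw [Nat.abs_cast]; omega)
      (by simp only [cost]; omega) ?_
    refine ⟨q - 1, K₃, hs₃.congr (fun x hx => by simp [show x ≠ 9 by omega]) (fun v _ l => by simp),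
      by simp, ?_, hKj', fun d => (hKj' d).trans (by omega), Or.inr ⟨by simp [h11'], ?_⟩⟩
    · refine hSw₃.congr (fun x hx _ => by simp [show x ≠ 9 by omega]) (fun v _ l => by simp)
        (Or.inl ⟨by simp [h11'], by simpa using h0, fun t ht => ?_⟩)
      exact Problem.optProfit_le_of_tight hq0 (hSw₃.front false).g_pos (hSw₃.front true).g_pos t₁ t₂
        ht.1 ht.2
    · rw [hq]
      exact next_level (by omega) (by omega) ⟨hjr, hjm⟩
  · simp only [eval] at hc
    have hm := hSw₃.mid.resolve_left (by omega)
    refine Tri.assign hN hb (by decide) (by simp [Ok]) (z := (0 : ℕ))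
      (by simp [eval]) (by simp) (by simp only [cost]; omega) ?_
    refine ⟨0, K₃, hs₃.congr (fun x hx => by simp [show x ≠ 9 by omega]) (fun v _ l => by simp),
      by simp, ?_, hKj', fun d => (hKj' d).trans (by omega), Or.inl rfl⟩
    exact hSw₃.congr (fun x hx _ => by simp [show x ≠ 9 by omega]) (fun v _ l => by simp)
      (Or.inr (by simpa using hm))

/-- The downward sweep lists its breakpoints from the outside inwards and with opposite sign, so it
is copied in reverse and negated. There is one set more than breakpoints: row `k₀` is the set of the
gap, and the set that goes with breakpoint `k₀ + k` occupies row `k₀ + k + 1`. -/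
theorem joinSides_spec (hN : 4 ≤ N) {K : Bool → Stack n} {s : Store} (hb : s.Bdd N)
    (hn : s.reg 0 = n) (hK : ∀ d, (K d).Rep d s) (hpos : ∀ d, ∀ i < (K d).k, 0 < (K d).den i)
    {x : Finset (Fin n)} (hx : ∀ j : Fin n, s.arr 16 j = if j ∈ x then 1 else 0)
    (hkN : ((K false).k + (K true).k + 1) * (n + 1) ≤ N) :
    Tri N joinSides s (((K true).k + 1) * (20 * n + 80)) fun s' =>
      Holds s' (Stack.answer K x) := by
  obtain ⟨k₀, hk₀⟩ : ∃ k, k = (K false).k := ⟨_, rfl⟩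
  obtain ⟨k₁, hk₁⟩ : ∃ k, k = (K true).k := ⟨_, rfl⟩
  obtain ⟨f1, f2, f3, f4, f5⟩ := hK false
  obtain ⟨g1, g2, g3, -, g5⟩ := hK true
  have p0 := hpos false
  have p1 := hpos true
  simp only [countReg, numArr, denArr, leftArr, setArr, ← hk₀, ← hk₁] at f1 f2 f3 f4 f5 g1 g2 g3 g5 p0 p1 hkN ⊢
  have hrow : ∀ i ≤ k₀ + k₁, i * n + i ≤ N := by
    intro i hi
    have := (Nat.mul_le_mul_right (n + 1) (by omega : i ≤ k₀ + k₁ + 1)).trans hkN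
    rwa [Nat.mul_succ] at this
  have hlast : k₀ + k₁ + 1 ≤ N ∧ n ≤ N :=
    ⟨(Nat.le_mul_of_pos_right _ (Nat.succ_pos n)).trans hkN,
      (Nat.le_succ n).trans ((Nat.le_mul_of_pos_left _ (Nat.succ_pos _)).trans hkN)⟩
  obtain ⟨num, hnum⟩ : ∃ f : ℕ → ℤ, f = fun i => if i < k₀ then (K false).num i
    else -(K true).num (k₀ + k₁ - 1 - i) := ⟨_, rfl⟩
  obtain ⟨den, hden⟩ : ∃ f : ℕ → ℤ, f = fun i => if i < k₀ then (K false).den i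
    else (K true).den (k₀ + k₁ - 1 - i) := ⟨_, rfl⟩
  obtain ⟨sol, hsol⟩ : ∃ f : ℕ → Finset (Fin n), f = fun i => if i < k₀ then (K false).set i
    else if i = k₀ then x else (K true).set (k₀ + k₁ - i) := ⟨_, rfl⟩
  have hbelow : ∀ {i k : ℕ}, i < k → ∀ j : Fin n, i * n + j < k * n := fun {i k} h j =>
    (by rw [Nat.succ_mul]; omega : i * n + j < (i + 1) * n).trans_le (Nat.mul_le_mul_right n h)
  rw [Nat.succ_mul]
  obtain ⟨Y, hY⟩ : ∃ Y, Y = k₁ * (20 * n + 80) := ⟨_, rfl⟩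
  rw [← hY]
  refine Tri.assign_seq hN hb (by decide) (by simp [Ok]) (z := (k₀ * n : ℕ)) (by simp [eval, f1, hn])
    (by have := hrow k₀ (by omega); rw [Nat.abs_cast]; omega) fun hb => ?_
  refine Tri.assign_seq hN hb (by decide) (by simp [Ok]) (z := 0) (by simp [eval])
    (by simp) fun hb => ?_
  refine Tri.seq _ (copyRow_spec hN (by norm_num : 16 ≠ 6) hb (n := n) (d := k₀ * n) (r := 0)
    (by simp [hn]) hlast.2 (by simp) (by simp)) ?_
  rintro s₁ hb ⟨r1, r2, r3, r4⟩
  refine Tri.assign_seq hN hb (by decide) (by simp [Ok]) (z := 0) (by simp [eval])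
    (by simp) fun hb => ?_
  refine Tri.seq (Y + 5) (Q := fun s' => s'.reg 13 = k₀ ∧ s'.reg 14 = k₁ ∧
    (∀ i < k₀ + k₁, s'.arr 3 i = num i ∧ s'.arr 4 i = den i ∧
      s'.arr 5 i = if i < k₀ then 1 else 0) ∧
    ∀ i < k₀ + k₁ + 1, ∀ j : Fin n, s'.arr 6 (i * n + j) = if j ∈ sol i then 1 else 0) ?_ ?_
  · refine Tri.loop hN (by decide) (by decide) (fun k s' => (∀ x < 19, s'.reg x = s.reg x) ∧
      (∀ v ≥ 7, ∀ l, s'.arr v l = s.arr v l) ∧ s'.reg 19 = k ∧ k ≤ k₁ ∧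
      (∀ i < k₀ + k, s'.arr 3 i = num i ∧ s'.arr 4 i = den i ∧
        s'.arr 5 i = if i < k₀ then 1 else 0) ∧
      ∀ i < k₀ + k + 1, ∀ j : Fin n, s'.arr 6 (i * n + j) = if j ∈ sol i then 1 else 0)
      k₁ (20 * n + 75) (fun _ _ _ _ => by simp [Ok]) ?_ ?_ hb ?_ ?_
    · rintro k s' hb ⟨h1, h2, h3, h4, h5, h6⟩ hle
      have e13 : s'.reg 13 = k₀ := by rw [h1 13 (by norm_num), f1]
      have e14 : s'.reg 14 = k₁ := by rw [h1 14 (by norm_num), g1]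
      have e0 : s'.reg 0 = n := by rw [h1 0 (by norm_num), hn]
      simp only [eval, h3, e14] at hle
      have hk : k < k₁ := by omega
      refine ⟨hk, ?_⟩
      have hsub : ((k₁ - 1 - k : ℕ) : ℤ) = k₁ - 1 - k := by omega
      have c1 : s'.arr 10 (k₁ - 1 - k) = (K true).num (k₁ - 1 - k) := by
        rw [h2 10 (by norm_num), g2 _ (by omega)]
      have c2 : s'.arr 11 (k₁ - 1 - k) = (K true).den (k₁ - 1 - k) := by
        rw [h2 11 (by norm_num), g3 _ (by omega)]
      have d1 := hb.2 10 (k₁ - 1 - k)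
      have d2 := hb.2 11 (k₁ - 1 - k)
      rw [c1] at d1
      rw [c2] at d2
      refine Tri.assign_seq hN hb (by decide) (by simp [Ok]) (z := (k₀ + k : ℕ))
        (by simp [eval, e13, h3]) (by rw [Nat.abs_cast]; omega) fun hb => ?_
      refine Tri.assign_seq hN hb (by decide) (by simp [Ok]) (z := (k₁ - 1 - k : ℕ))
        (by simp [eval, e14, h3, hsub]) (by rw [Nat.abs_cast]; omega) fun hb => ?_
      refine Tri.put_seq hN hb (by decide) (by decide) (by simp [Ok]) (by simp [Ok, eval])
        (j := k₀ + k) (by simp [eval]) (z := -(K true).num (k₁ - 1 - k)) (by simp [eval, c1])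
        (by rwa [abs_neg]) fun hb => ?_
      refine Tri.put_seq hN hb (by decide) (by decide) (by simp [Ok]) (by simp [Ok, eval])
        (j := k₀ + k) (by simp [eval]) (z := (K true).den (k₁ - 1 - k)) (by simp [eval, c2])
        d2 fun hb => ?_
      refine Tri.put_seq hN hb (by decide) (by decide) (by simp [Ok]) (by simp [Ok])
        (j := k₀ + k) (by simp [eval]) (z := 0) (by simp [eval]) (by simp) fun hb => ?_
      refine Tri.assign_seq hN hb (by decide) (by simp [Ok]) (z := ((k₀ + k + 1) * n : ℕ))
        (by simp [eval, e0]) (by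
          have := hrow (k₀ + k + 1) (by omega)
          rw [Nat.abs_cast]
          omega) fun hb => ?_
      refine Tri.assign_seq hN hb (by decide) (by simp [Ok]) (z := ((k₁ - 1 - k) * n : ℕ))
        (by simp [eval, e0]) (by
          have := hrow (k₁ - 1 - k) (by omega)
          rw [Nat.abs_cast]
          omega) fun hb => ?_
      refine Tri.seq _ (copyRow_spec hN (by norm_num : 13 ≠ 6) hb (n := n) (d := (k₀ + k + 1) * n)
        (r := (k₁ - 1 - k) * n) (by simp [e0]) hlast.2 (by simp) (by simp)) ?_
      rintro s₂ hb ⟨q1, q2, q3, q4⟩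
      refine Tri.assign hN hb (by decide) (by simp [Ok]) (z := (k + 1 : ℕ))
        (by simp [eval, q1, h3]) (by rw [Nat.abs_cast]; omega) (by simp only [cost]; omega) ?_
      refine ⟨fun x hx => ?_, fun v hv l => ?_, by simp, by omega, fun i hi => ?_,
        fun i hi j => ?_⟩
      · simp [show x ≠ 19 by omega, q1 x (by omega), show x ≠ 20 by omega, show x ≠ 21 by omega,
          show x ≠ 26 by omega, show x ≠ 27 by omega, h1 x hx]
      · simp [q2 v (by omega), show v ≠ 3 by omega, show v ≠ 4 by omega, show v ≠ 5 by omega,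
          h2 v hv]
      · simp only [Store.arr_setReg, q2 3 (by norm_num), q2 4 (by norm_num), q2 5 (by norm_num)]
        by_cases hik : i = k₀ + k
        · subst hik
          have : k₀ + k₁ - 1 - (k₀ + k) = k₁ - 1 - k := by omega
          simp [hnum, hden, this]
        · simpa [hik] using h5 i (by omega)
      · simp only [Store.arr_setReg]
        rcases (Nat.lt_succ_iff_lt_or_eq.mp (by omega : i < k₀ + k + 1 + 1)) with hi' | rfl
        · rw [q4 _ (Or.inl (hbelow hi' j))]
          simpa using h6 i hi' j
        · have e : k₀ + k₁ - (k₀ + k + 1) = k₁ - 1 - k := by omega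
          have e' : sol (k₀ + k + 1) = (K true).set (k₁ - 1 - k) := by
            simp only [hsol, e]
            rw [if_neg (by omega), if_neg (by omega)]
          rw [q3 j j.2, e', ← g5 _ (by omega) j, ← h2 13 (by norm_num)]
          simp
    · rintro k s' hb ⟨h1, h2, h3, h4, h5, h6⟩ hle
      have e14 : s'.reg 14 = k₁ := by rw [h1 14 (by norm_num), g1]
      simp only [eval, h3, e14] at hle
      obtain rfl : k = k₁ := by omega
      exact ⟨by rw [h1 13 (by norm_num), f1], e14, h5, h6⟩
    · refine ⟨fun x hx => ?_, fun v hv l => ?_, by simp, by omega, fun i hi => ?_, fun i hi j => ?_⟩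
      · simp [show x ≠ 19 by omega, r1 x (by omega), show x ≠ 26 by omega, show x ≠ 27 by omega]
      · simp [r2 v (by omega)]
      · have hi : i < k₀ := hi
        simp [r2, hnum, hden, hi, f2 i hi, f3 i hi, f4 i hi]
      · simp only [Store.arr_setReg]
        rcases (Nat.lt_succ_iff_lt_or_eq.mp (by omega : i < k₀ + 1)) with hi' | rfl
        · rw [r4 _ (Or.inl (hbelow hi' j))]
          simpa [hsol, hi'] using f5 i hi' j
        · rw [r3 j j.2]
          simpa [hsol] using hx j
    · simp only [cost]
      have : (1 + 1 + 1 + 1 + 1 + (20 * n + 75)) = 20 * n + 80 := by omega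
      rw [this, hY]
  · rintro s₂ hb ⟨h1, h2, h3, h4⟩
    refine Tri.assign hN hb (by decide) (by simp [Ok]) (z := (k₀ + k₁ : ℕ))
      (by simp [eval, h1, h2]) (by rw [Nat.abs_cast]; omega) (by simp only [cost]; omega) ?_
    refine ⟨by simp [Stack.answer, hk₀, hk₁], fun i => ?_, fun j i => ?_⟩
    · have hi : i.val < k₀ + k₁ := by
        have := i.2
        simp only [Stack.answer] at this
        omega
      obtain ⟨a1, a2, a3⟩ := h3 i hi
      simp only [Store.arr_setReg, a1, a2, a3, hnum, hden, Stack.answer, ← hk₀, ← hk₁]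
      by_cases hik : i.val < k₀
      · simp [hik, p0 _ hik]
      · simp [hik, p1 (k₀ + k₁ - 1 - i) (by omega), neg_div]
    · have hj : j.val < k₀ + k₁ + 1 := by
        have := j.2
        simp only [Stack.answer] at this
        omega
      simp only [Store.arr_setReg, h4 j hj i, hsol, Stack.answer, ← hk₀, ← hk₁]

end ParamKnapsack

/-! ### The complete scheme -/

namespace ParamKnapsack
open _root_.ParamKnapsack.Expr

variable {N n : ℕ}

theorem scheme_spec (hN : 4 ≤ N) {I : Problem n} {ε : ℝ} {P u v m L : ℕ} (hn : 0 < n) (hu : 0 < u)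
    (huv : u < v) (hm : m = (2 * v + u - 1) / u) (hm2 : 2 ≤ m) (hε : 2 ≤ ε * m)
    (hL : ∀ j, m ^ j ≤ P * (m - 1) ^ j → j < L) (hP : ∀ r : ℝ, I.optProfit r ≤ P)
    (hb : (inputStore I P u v).Bdd N) (hPN : (2 * P + 1) * (n + 1) ≤ N)
    (hpN : ∀ i, I.p i * (n * m) ≤ N) (hnm : n * m + 1 ≤ N)
    (hSN : 160 * (I.size + 2) ^ 6 ≤ N) :
    Tri N scheme (inputStore I P u v)
      ((L + 1) * ((I.newtonBound + 3) * (1500 * ((n + 1) * (n * (m - 1) + 1))))) fun s =>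
      ∃ S : Answer n, Holds s S ∧ S.IsApproxFor I ε := by
  have hnN : n ≤ N := (Nat.le_mul_of_pos_right n (by omega : 0 < m)).trans (by omega)
  have hmN : m ≤ N := (Nat.le_mul_of_pos_left m hn).trans (by omega)
  have hPN' : (P + 1) * (n + 1) ≤ N := (Nat.mul_le_mul_right _ (by omega)).trans hPN
  obtain ⟨X, hX⟩ : ∃ X, X = (n + 1) * (n * (m - 1) + 1) := ⟨_, rfl⟩
  obtain ⟨Y, hY⟩ : ∃ Y, Y = (I.newtonBound + 3) * (1300 * X) := ⟨_, rfl⟩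
  have hT : 40 * n + 100 + (L * (3 + Y) + 3) + (L + 1) * (20 * n + 80) ≤
      (L + 1) * ((I.newtonBound + 3) * (1500 * X)) := by
    have hnT : n + 1 ≤ X := by
      rw [hX]
      exact Nat.le_mul_of_pos_right _ (by positivity)
    have h1 : Y + 3 * (200 * X) ≤ (I.newtonBound + 3) * (1500 * X) := by
      rw [hY]
      nlinarith
    have h2 := Nat.mul_le_mul_left (L + 1) h1
    nlinarith
  rw [← hX]
  refine Tri.mono_time ?_ hT
  refine Tri.seq _ (setup_spec hN ε hu huv hm hb hnm hnN hmN hSN hP) fun s hb hs => ?_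
  refine Tri.seq (L * (3 + Y) + 3) (Q := fun s' => s'.reg 0 = n ∧ ∃ K : Bool → Stack n,
    I.Sweep ε 0 K s' ∧ ∀ d, (K d).k ≤ L ∧ (K d).k ≤ P) ?_ ?_
  · refine Tri.loop hN (by decide) (by decide) (fun j s' => j ≤ L ∧ ∃ r K,
      I.LevelInv ε P m j r K s') L Y (fun _ _ _ _ => by simp [Ok]) ?_ ?_ hb
      ⟨Nat.zero_le _, _, _, hs⟩
      (by
        simp only [cost]
        rw [show 1 + 1 + 1 + Y = 3 + Y by omega])
    · rintro j s' hb ⟨hj, r, K, h⟩ hle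
      simp only [eval, h.r_eq] at hle
      have hr : 0 < r := by omega
      obtain ⟨-, -, h1⟩ := h.level.resolve_left hr.ne'
      -- The loop runs only for `r ≥ 1`, so the factor `r` in the invariant may be dropped.
      have hjL := hL j ((Nat.le_mul_of_pos_left _ hr).trans h1)
      refine ⟨hjL, ?_⟩
      rw [hY, hX]
      exact (level_spec hN hn hm2 hε hb h hr hPN' hpN hnm hSN).mono le_rfl
        fun s'' _ hs'' => ⟨hjL, hs''⟩
    · rintro j s' hb ⟨hj, r, K, h⟩ hle
      simp only [eval, h.r_eq] at hle
      obtain rfl : r = 0 := by omega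
      exact ⟨h.setup.n_eq, K, h.sweep, fun d => ⟨(h.k_le d).trans hj, h.k_le_P d⟩⟩
  · rintro s₁ hb ⟨h0, K, hSw, hk⟩
    obtain ⟨x, hx, hx'⟩ : ∃ x : Finset (Fin n), (∀ j : Fin n, s₁.arr 16 j = if j ∈ x then 1 else 0) ∧
        ∀ t, s₁.Gap t → I.Appr ε t x := by
      rcases hSw.mid with ⟨-, h1, h2⟩ | ⟨-, h⟩
      -- If the gap was never closed, the level has come down to `0` and the empty set solves what
      -- is left.
      · exact ⟨∅, fun j => by simpa using h1 j, fun t ht => Problem.appr_empty (h2 t ht)⟩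
      · exact h
    refine Tri.mono (joinSides_spec hN hb h0 hSw.rep (fun d => (hSw.front d).den_pos) hx ?_) ?_
      fun s' _ hs' => ⟨_, hs', ?_⟩
    · exact (Nat.mul_le_mul_right _ (by have := (hk false).2; have := (hk true).2; omega)).trans hPN
    · have := Nat.mul_le_mul_right (20 * n + 80) (Nat.succ_le_succ (hk true).1)
      simp only [Nat.succ_eq_add_one] at this
      generalize (L + 1) * (20 * n + 80) = Z at *
      generalize L * (3 + Y) = Z' at *
      omega
    · exact Stack.answer_isApproxFor (F := fun d => s₁.reg (numReg d))
        (G := fun d => s₁.reg (denReg d)) hSw.front (hSw.gap_lt false) fun t h1 h2 => hx' t ⟨h1, h2⟩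

/-! ### The running time and the word length -/

theorem one_le_lg (x : ℝ) : 1 ≤ lg x := le_max_left _ _

theorem log_le_lg (x : ℝ) : Real.log x ≤ lg x := le_max_right _ _

/-- Taking logarithms, `j * log (m / (m - 1)) ≤ log P`, and `log (m / (m - 1)) ≥ 1 / m`. -/
theorem lt_of_pow_le {m P j : ℕ} (hm : 2 ≤ m) (h : m ^ j ≤ P * (m - 1) ^ j) :
    j < ⌊(m : ℝ) * Real.log P⌋₊ + 1 := by
  have hP : 0 < P := by
    rcases Nat.eq_zero_or_pos P with rfl | h'
    · have : 0 < m ^ j := by positivity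
      omega
    · exact h'
  obtain ⟨k, rfl⟩ : ∃ k, m = k + 1 := ⟨m - 1, by omega⟩
  have hk : (0 : ℝ) < k := by exact_mod_cast (by omega : 0 < k)
  have h1 : ((k : ℝ) + 1) ^ j ≤ P * (k : ℝ) ^ j := by exact_mod_cast h
  have h2 : (((k : ℝ) + 1) / k) ^ j ≤ P := by
    rw [div_pow, div_le_iff₀ (by positivity)]
    exact h1
  have h3 : (j : ℝ) * Real.log (((k : ℝ) + 1) / k) ≤ Real.log P := by
    rw [← Real.log_pow]
    exact Real.log_le_log (by positivity) h2
  have h4 := Real.one_sub_inv_le_log_of_pos (show (0 : ℝ) < ((k : ℝ) + 1) / k by positivity)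
  have h5 : 1 - (((k : ℝ) + 1) / k)⁻¹ = 1 / (k + 1) := by
    field_simp
    ring
  rw [h5] at h4
  have h6 : (j : ℝ) * (1 / (k + 1)) ≤ Real.log P :=
    (mul_le_mul_of_nonneg_left h4 (by positivity)).trans h3
  rw [mul_one_div, div_le_iff₀ (by positivity)] at h6
  refine Nat.lt_succ_of_le (Nat.le_floor ?_)
  push_cast
  linarith

/-- From `log (x * lg y) = log x + log (lg y)` and `log z ≤ z - 1`. It shows that the second term in
the minimum of the time bound is at least `n / 2`. -/
theorem lg_mul_lg_le {x y : ℝ} (hx : 1 ≤ x) (hxy : x ≤ y) : lg (x * lg y) ≤ 2 * lg y := by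
  have h0 := one_le_lg y
  refine max_le (by linarith) ?_
  rw [Real.log_mul (by linarith) (by linarith)]
  have h1 := (Real.log_le_log (by linarith) hxy).trans (log_le_lg y)
  have h2 := Real.log_le_sub_one_of_pos (show 0 < lg y by linarith)
  linarith

/-- Since `log 2 > 1 / 2`, the binary logarithm is at most `4 + 10 * lg M`; the constants are
absorbed by `1 ≤ lg M`. -/
theorem log_two_le {M : ℕ} : (Nat.log 2 (16 * M ^ 5) : ℝ) + 3 ≤ 17 * lg M := by
  have h0 := one_le_lg M
  rcases Nat.eq_zero_or_pos M with rfl | hM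
  · simp only [Nat.cast_zero] at h0 ⊢
    norm_num
    linarith
  have hMr : (0 : ℝ) < M := by exact_mod_cast hM
  have h1 : (Nat.log 2 (16 * M ^ 5) : ℝ) ≤ Real.logb 2 ((16 * M ^ 5 : ℕ) : ℝ) := by
    have := Real.natLog_le_logb (16 * M ^ 5) 2
    simpa using this
  have hl := Real.log_two_gt_d9
  have h2 : Real.logb 2 ((16 * M ^ 5 : ℕ) : ℝ) ≤ 4 + 10 * lg M := by
    rw [Real.logb, div_le_iff₀ (by linarith)]
    push_cast
    rw [Real.log_mul (by norm_num) (by positivity), Real.log_pow,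
      show (16 : ℝ) = 2 ^ 4 by norm_num, Real.log_pow]
    have h3 := log_le_lg M
    push_cast
    nlinarith
  linarith

/-- The constant is dictated by the polynomial bound: `4 (n + 1)² + 5 ≤ 21 n² = 42 n * (n / 2)`. The
logarithmic bound has room to spare. -/
theorem newtonBound_le {I : Problem n} (hn : 0 < n) {y : ℝ} (hy : n ≤ y) :
    (I.newtonBound : ℝ) + 3 ≤ 42 * n * min (lg I.M) (n * lg y / lg (n * lg y)) := by
  have hn1 : (1 : ℝ) ≤ n := by exact_mod_cast hn
  have h0 := one_le_lg I.M
  have h1 := one_le_lg y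
  rw [mul_min_of_nonneg _ _ (by positivity)]
  refine le_min ?_ ?_
  · have h2 : (I.newtonBound : ℝ) ≤ Nat.log 2 (16 * I.M ^ 5) := by
      exact_mod_cast min_le_right _ _
    have h3 := log_two_le (M := I.M)
    nlinarith
  · have h2 : (I.newtonBound : ℝ) ≤ 4 * ((n : ℝ) + 1) ^ 2 + 2 := by
      exact_mod_cast min_le_left _ _
    have h3 : (n : ℝ) / 2 ≤ n * lg y / lg (n * lg y) := by
      rw [div_le_div_iff₀ (by norm_num) (by linarith [one_le_lg (n * lg y)])]
      have := lg_mul_lg_le hn1 hy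
      nlinarith
    nlinarith

theorem size_add_two_le (I : Problem n) (P u v : ℕ) : I.size + 2 ≤ inputMagnitude I P u v := by
  have : ∑ i, ((I.a i).natAbs + (I.b i).natAbs) ≤
      ∑ i, ((I.a i).natAbs + (I.b i).natAbs + I.p i) :=
    Finset.sum_le_sum fun i _ => Nat.le_add_right _ _
  rw [Problem.size, inputMagnitude]
  omega

theorem inputStore_bdd (I : Problem n) (P u v : ℕ) :
    (inputStore I P u v).Bdd (inputMagnitude I P u v) := by
  have hS := size_add_two_le I P u v
  have hi : ∀ i : Fin n, (I.a i).natAbs + (I.b i).natAbs + I.p i ≤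
      ∑ i, ((I.a i).natAbs + (I.b i).natAbs + I.p i) := fun i =>
    Finset.single_le_sum (f := fun i => (I.a i).natAbs + (I.b i).natAbs + I.p i)
      (fun _ _ => Nat.zero_le _) (Finset.mem_univ i)
  have key : ∀ z : ℤ, z.natAbs ≤ inputMagnitude I P u v → |z| ≤ inputMagnitude I P u v := by
    intro z hz
    rw [Int.abs_eq_natAbs]
    exact_mod_cast hz
  refine ⟨fun x => key _ ?_, fun w j => key _ ?_⟩
  · simp only [inputStore, inputMagnitude]
    split <;> omega
  · simp only [inputStore, inputMagnitude]
    split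
    · rename_i h
      have := hi ⟨j, h⟩
      split <;> omega
    · simp

end ParamKnapsack

open ParamKnapsack
/-- There is one program which, on every instance with `n ≥ 1` items, every upper bound
`P ≤ ∑ p_i` on the optimal profit and every rational precision `ε = u / v` in `(0, 1)`, computes a
partition of the real line into intervals together with a `(1 - ε)`-approximate solution for each
of them, in at most `C * timeBound` steps on words of `O(log (input numbers))` bits. -/
theorem theorem2 :
    ∃ (A : Prog) (C c : ℕ),
      ∀ (n : ℕ) (I : Problem n) (P u v : ℕ),
        0 < n → 0 < u → u < v →
        (∀ r : ℝ, I.optProfit r ≤ P) → P ≤ ∑ i, I.p i →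
        ∃ (s : Store) (t : ℕ) (S : Answer n),
          Exec (inputMagnitude I P u v ^ c) A (inputStore I P u v) s t ∧
          (t : ℝ) ≤ C * timeBound n ((u : ℝ) / (v : ℝ)) P I.M ∧
          Holds s S ∧
          S.IsApproxFor I ((u : ℝ) / (v : ℝ)) := by
  -- The time constant is `2 * 42 * 1500 * 2 * 9`, from the levels, the Newton iterations, the cost
  -- per table entry, the table size, and `m² ≤ 9 / ε²`. The exponent is `14 * 8`: cells are bounded
  -- by `β ^ 14`, intermediate values by the eighth power of that.
  refine ⟨scheme, 2268000, 112, fun n I P u v hn hu huv hP _ => ?_⟩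
  obtain ⟨β, hβ⟩ : ∃ β, β = inputMagnitude I P u v := ⟨_, rfl⟩
  obtain ⟨m, hm⟩ : ∃ m, m = (2 * v + u - 1) / u := ⟨_, rfl⟩
  have hur : (0 : ℝ) < u := by exact_mod_cast hu
  have hvr : (0 : ℝ) < v := by exact_mod_cast hu.trans huv
  have huvr : (u : ℝ) < v := by exact_mod_cast huv
  have hn1 : (1 : ℝ) ≤ n := by exact_mod_cast hn
  have hm2 : 2 ≤ m := by
    rw [hm, Nat.le_div_iff_mul_le hu]
    omega
  -- `m` is `2 v / u` rounded up, so `2 ≤ ε * m`; together with `u < v` this also gives `m ≤ 3 / ε`.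
  have hum : 2 * v ≤ u * m := by
    have := Nat.lt_mul_div_succ (2 * v + u - 1) hu
    rw [← hm, Nat.mul_succ] at this
    omega
  have hmu : u * m ≤ 3 * v := by
    have := Nat.mul_div_le (2 * v + u - 1) u
    rw [← hm] at this
    omega
  have hε : 2 ≤ (u / v : ℝ) * m := by
    rw [div_mul_eq_mul_div, le_div_iff₀ hvr]
    exact_mod_cast hum
  have hm3 : (m : ℝ) ≤ 3 * (v / u) := by
    rw [← mul_div_assoc, le_div_iff₀ hur, mul_comm]
    exact_mod_cast hmu
  have hβ' : β = 2 + n + I.W.natAbs + (∑ i, ((I.a i).natAbs + (I.b i).natAbs + I.p i)) + P + u + v :=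
    hβ
  have hβ2 : 2 ≤ β := by omega
  have hβp : ∀ i, I.p i ≤ β := by
    intro i
    have := Finset.single_le_sum (f := fun i => (I.a i).natAbs + (I.b i).natAbs + I.p i)
      (fun _ _ => Nat.zero_le _) (Finset.mem_univ i)
    omega
  have hmono : ∀ {k l : ℕ}, k ≤ l → β ^ k ≤ β ^ l := fun h => Nat.pow_le_pow_right (by omega) h
  have hmβ : m ≤ β ^ 3 := by
    have h1 : m ≤ 3 * β := (Nat.le_mul_of_pos_left m hu).trans (hmu.trans (by omega))
    nlinarith [Nat.mul_le_mul hβ2 hβ2]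
  have hnβ : n * m + 1 ≤ β ^ 5 := by
    have h1 : n * m ≤ β * β ^ 3 := Nat.mul_le_mul (by omega) hmβ
    have h2 : 0 < β ^ 4 := by positivity
    have h3 : β ^ 5 = β ^ 4 * β := by ring
    nlinarith
  obtain ⟨s, t, hexec, ht, -, S, hS, hA⟩ := scheme_spec (N := β ^ 14) (I := I) (P := P)
    ((by norm_num : 4 ≤ 2 ^ 14).trans (Nat.pow_le_pow_left hβ2 14)) hn hu huv hm hm2 hε
    (fun j => lt_of_pow_le hm2) hP
    (by
      have h1 : β ≤ β ^ 14 := Nat.le_self_pow (by norm_num) β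
      have h2 := inputStore_bdd I P u v
      rw [← hβ] at h2
      have h3 : (β : ℤ) ≤ (β ^ 14 : ℕ) := by exact_mod_cast h1
      exact ⟨fun x => (h2.1 x).trans h3, fun w j => (h2.2 w j).trans h3⟩)
    (by
      have h1 : (2 * P + 1) * (n + 1) ≤ β ^ 3 := by
        have : (2 * P + 1) * (n + 1) ≤ (2 * β) * β := Nat.mul_le_mul (by omega) (by omega)
        nlinarith
      exact h1.trans (hmono (by norm_num)))
    (fun i => by
      have h1 : I.p i * (n * m) ≤ β * β ^ 5 := Nat.mul_le_mul (hβp i) (by omega)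
      rw [← Nat.pow_succ'] at h1
      exact h1.trans (hmono (by norm_num)))
    (hnβ.trans (hmono (by norm_num)))
    (by
      have h1 := size_add_two_le I P u v
      rw [← hβ] at h1
      -- This requirement determines the exponent: `160 ≤ 2 ^ 8 ≤ β ^ 8`, hence `β ^ 14`.
      have h2 : 160 * (I.size + 2) ^ 6 ≤ 2 ^ 8 * β ^ 6 :=
        Nat.mul_le_mul (by norm_num) (Nat.pow_le_pow_left h1 6)
      have h3 : 2 ^ 8 * β ^ 6 ≤ β ^ 8 * β ^ 6 :=
        Nat.mul_le_mul_right _ (Nat.pow_le_pow_left hβ2 8)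
      rw [← pow_add] at h3
      exact h2.trans h3)
  refine ⟨s, t, S, ?_, ?_, hS, hA⟩
  · rw [← pow_mul] at hexec
    rwa [← hβ]
  have hy : (n : ℝ) ≤ n / (u / v) := by
    rw [le_div_iff₀ (by positivity)]
    have : (u / v : ℝ) ≤ 1 := (div_le_one hvr).mpr huvr.le
    nlinarith
  have hB := newtonBound_le (I := I) hn hy
  have hlP := one_le_lg (P : ℝ)
  have hm2r : (2 : ℝ) ≤ m := by exact_mod_cast hm2
  -- The two extra rounds are absorbed because `2 ≤ m` and `1 ≤ lg P`.
  have hL : ((⌊(m : ℝ) * Real.log P⌋₊ : ℝ) + 1 + 1) ≤ 2 * m * lg P := by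
    have h1 := Nat.floor_le (mul_nonneg (Nat.cast_nonneg m) (Real.log_natCast_nonneg P))
    have h2 := log_le_lg (P : ℝ)
    nlinarith
  have hX : ((n + 1) * (n * (m - 1) + 1) : ℕ) ≤ (2 * n ^ 2 * m : ℝ) := by
    have h1 : n * (m - 1) + 1 ≤ n * m := by
      rw [Nat.mul_sub_one]
      have := Nat.le_mul_of_pos_right n (by omega : 0 < m)
      omega
    have h2 : (n + 1) * (n * (m - 1) + 1) ≤ (2 * n) * (n * m) := Nat.mul_le_mul (by omega) h1
    calc (((n + 1) * (n * (m - 1) + 1) : ℕ) : ℝ) ≤ (((2 * n) * (n * m) : ℕ) : ℝ) := by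
          exact_mod_cast h2
      _ = 2 * n ^ 2 * m := by push_cast; ring
  have ht' : (t : ℝ) ≤ (2 * m * lg P) * ((42 * n * min (lg I.M)
      (n * lg (n / (u / v)) / lg (n * lg (n / (u / v))))) * (1500 * (2 * n ^ 2 * m))) := by
    refine (Nat.cast_le.mpr ht).trans ?_
    rw [Nat.cast_mul, Nat.cast_mul, Nat.cast_mul]
    push_cast at hL hB hX ⊢
    gcongr
    · linarith [hB, Nat.cast_nonneg (α := ℝ) I.newtonBound]
  refine ht'.trans ?_
  have hmin : 0 ≤ min (lg I.M) ((n : ℝ) * lg (n / (u / v)) / lg (n * lg (n / (u / v)))) := by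
    have h1 := one_le_lg I.M
    have h2 := one_le_lg ((n : ℝ) / (u / v))
    have h3 := one_le_lg ((n : ℝ) * lg (n / (u / v)))
    exact le_min (by linarith) (by positivity)
  rw [timeBound]
  generalize min (lg I.M) ((n : ℝ) * lg (n / (u / v)) / lg (n * lg (n / (u / v)))) = q at *
  have hmm : (m : ℝ) * m ≤ 9 / (u / v) ^ 2 := by
    have h1 := mul_le_mul hm3 hm3 (by positivity) (by positivity)
    have h2 : (9 : ℝ) / (u / v) ^ 2 = 3 * (v / u) * (3 * (v / u)) := by
      field_simp
      norm_num
    linarith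
  -- The count gives a single factor `lg P`; the square in the time bound is not needed.
  have hll : lg (P : ℝ) ≤ lg P ^ 2 := by nlinarith
  calc _ = 252000 * ((n : ℝ) ^ 3 * q) * ((m * m) * lg P) := by ring
    _ ≤ 252000 * ((n : ℝ) ^ 3 * q) * (9 / (u / v) ^ 2 * lg P ^ 2) := by gcongr
    _ = _ := by push_cast; ring
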